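/- **Setting.** There are $M$ clients; client $m$ has a loss $f_m(x,z)$, $x\in\mathbb R^d$ (differentiable in $x$, measurable and integrable in $z$), and local data that are either a data set of $n$ samples (the same $n$ for all clients) or, in the online case $n=\infty$, a distribution. A batch $B$ of $s\le n$ samples is drawn uniformly without replacement from the data set (independently from the distribution if $n=\infty$); $f_m(x,B)$ is the average loss on $B$, $F_m(x)=\mathbb E f_m(x,z)$, $F=\frac1M\sum_m F_m$, and $F_*=\inf F>-\infty$. Assume for all clients $m$, all $v,w\in\mathbb R^d$ and all batch sizes $|B|\le n$: (i) $F_m$ is differentiable and $\|\nabla F_m(v)-\nabla F_m(w)\|\le L\|v-w\|$, $L>0$; (ii) $\mathbb E\|\nabla f_m(v,B)-\nabla F_m(v)\|^2\le\sigma^2/|B|$; (iii) $\mathbb E\|(\nabla f_m(v,B)-\nabla f_m(w,B))-(\nabla F_m(v)-\nabla F_m(w))\|^2\le\frac{L_\sigma^2}{|B|}\|v-w\|^2$. **Algorithm (FedAMD, sequential probabilities).** Let $1\le A\le M$, $K\ge1$, $\tau\ge2$, and $p_t=1$ if $\tau\mid t$, $p_t=0$ otherwise. Start from $x_0$ and $v_0^{(m)}=\nabla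 f_m(x_0,B_m)$ with $|B_m|=b$ for all $m$. In round $t=0,1,\dots$ a uniformly random set of $A$ clients participates and $g_t=\frac1M\sum_m v_t^{(m)}$. Each participant is, with probability $p_t$, an anchor, and otherwise a miner. An anchor $i$ receives $x_t$ and replaces its caching gradient by $v_{t+1}^{(i)}=\nabla f_i(x_t,B)$, $|B|=b$, which it sends to the server; all other caching gradients are kept. A miner $i$ receives $x_t,g_t$, puts $x_{-1}^{(i)}=x_0^{(i)}=x_t$, $g_0^{(i)}=g_t$, and for $k=0,\dots,K-1$ draws a fresh batch $B_k$ of size $b'$ and sets $g_{k+1}^{(i)}=g_k^{(i)}-\nabla f_i(x_{k-1}^{(i)},B_k)+\nabla f_i(x_k^{(i)},B_k)$, $x_{k+1}^{(i)}=x_k^{(i)}-\eta_l g_{k+1}^{(i)}$; it sends $x_t-x_K^{(i)}$ to the server. Then $x_{t+1}=x_t-\eta_s\cdot$(average of $x_t-x_K^{(i)}$ over the miners), and $x_{t+1}=x_t$ if there is no miner. All random choices are independent. **Claim.** There is an absolute constant $c_0>0$, and for all $L>0$, $\Delta\ge0$, $\varepsilon_0>0$ there is a constant $C$ depending only on $L,\Delta,\varepsilon_0$,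 such that the following holds whenever $F(x_0)-F_*\le\Delta$, $0<\varepsilon\le\varepsilon_0$, and, for some $\kappa>0$, $$b=\min\Big\{\Big\lceil\frac{\kappa\,\sigma^2}{M\varepsilon}\Big\rceil,\,n\Big\},\quad 1\le b'<b,\quad \eta_s\eta_l=\frac1{KL}\Big(1+\frac{2M\tau}A\Big)^{-1},\quad 0<\eta_l\le\min\Big\{\frac1{2\sqrt6KL},\frac{\sqrt{b'/K}}{4\sqrt3L_\sigma}\Big\}$$ (the last bound being void if $L_\sigma=0$). There is a number of rounds $T\ge1$ with $$T\le C\Big(1+\frac{2M\tau}A\Big)\frac{\tau}{\tau-1}\cdot\frac1\varepsilon\quad\text{and}\quad\min_{0\le t<T}\mathbb E\|\nabla F(x_t)\|^2\le\max\{1,c_0/\kappa\}\,\varepsilon$$ (so $\le\varepsilon$ if $\kappa\ge c_0$, and $\le \max\{1,c_0\}\,\varepsilon$ if $\kappa=1$), such that, almost surely, during these $T$ rounds, initialization included, 1. all clients together compute at most $C\big(\frac{Mb}{\varepsilon}+\frac{\tau MKb'}{\varepsilon}\big)$ gradients of single-sample losses; 2. the communication overhead, i.e. the total number of vectors of $\mathbb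 R^d$ sent between the server and the clients divided by the number $A$ of participants per round, is at most $C\,\frac{M\tau}{A\varepsilon}$. Moreover $\tau=2$ is optimal for these complexity bounds: each of $\big(1+\frac{2M\tau}A\big)\frac{\tau}{\tau-1}\frac1\varepsilon$, $\frac{Mb}{\varepsilon}+\frac{\tau MKb'}{\varepsilon}$ and $\frac{M\tau}{A\varepsilon}$ is, over the integers $\tau\ge2$, smallest at $\tau=2$ and only there. -/

import Mathlib

open MeasureTheory ProbabilityTheory
open scoped ENNReal

noncomputable section

namespace FedAMD

/-- The parameter space `ℝ^d` with its Euclidean norm. -/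
abbrev Vec (d : ℕ) : Type := EuclideanSpace ℝ (Fin d)

/-! ### The federated problem -/

/-- The local data of `M` clients. Either every client `m` holds a data set of the same finite
size `n`, or (streaming / online case) every client draws fresh samples from a distribution. -/
inductive ClientData (M : ℕ) (Z : Type*) [MeasurableSpace Z]
  | finite (n : ℕ) (z : Fin M → Fin n → Z)
  | online (D : Fin M → ProbabilityMeasure Z)

namespace ClientData

variable {M : ℕ} {Z : Type*} [MeasurableSpace Z]

/-- The size `n` of each local data set; `⊤` in the online case. -/
def size : ClientData M Z → ℕ∞
  | finite n _ => n
  | online _ => ⊤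

/-- The law of one sample of client `m`: uniform on the data set, or the given distribution. -/
def sampleLaw : ClientData M Z → Fin M → Measure Z
  | finite n z, m => (n : ℝ≥0∞)⁻¹ • ∑ j, Measure.dirac (z m j)
  | online D, m => (D m : Measure Z)

/-- The law of a batch of `s` samples of client `m`: `s` entries of the data set drawn uniformly
without replacement (an injective choice of `s` of the `n` indices), or `s` independent samples
in the online case. -/
def batchLaw : ClientData M Z → Fin M → (s : ℕ) → Measure (Fin s → Z)
  | finite n z, m, s =>
      (Fintype.card (Fin s ↪ Fin n) : ℝ≥0∞)⁻¹ •
        ∑ e : Fin s ↪ Fin n, Measure.dirac (fun j => z m (e j))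
  | online D, m, _ => Measure.pi fun _ => (D m : Measure Z)

end ClientData

/-- A federated optimization problem: the clients' data and, for every client `m`, the loss
`loss m x z` of the model `x` on the sample `z`. -/
structure Problem (d M : ℕ) (Z : Type*) [MeasurableSpace Z] where
  data : ClientData M Z
  loss : Fin M → Vec d → Z → ℝ

namespace Problem

variable {d M : ℕ} {Z : Type*} [MeasurableSpace Z] (P : Problem d M Z)

/-- The expected local loss `F_m`. -/
def localObj (m : Fin M) (x : Vec d) : ℝ := ∫ z, P.loss m x z ∂(P.data.sampleLaw m)

/-- The global objective `F = (1/M) ∑ F_m`. -/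
def obj (x : Vec d) : ℝ := (M : ℝ)⁻¹ * ∑ m, P.localObj m x

/-- The empirical loss `f_m(x, B)` on a batch `B` of `s` samples. -/
def empLoss (m : Fin M) {s : ℕ} (B : Fin s → Z) (x : Vec d) : ℝ :=
  (s : ℝ)⁻¹ * ∑ j, P.loss m x (B j)

/-- The batch gradient `∇ f_m(x, B)`. -/
def batchGrad (m : Fin M) {s : ℕ} (B : Fin s → Z) (x : Vec d) : Vec d :=
  gradient (P.empLoss m B) x

/-- The sample losses are differentiable in the model, measurable in the sample, and have a finite
expectation. -/
structure Regular : Prop where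
  differentiable : ∀ m z, Differentiable ℝ fun x => P.loss m x z
  measurable : ∀ m x, Measurable (P.loss m x)
  integrable : ∀ m x, Integrable (P.loss m x) (P.data.sampleLaw m)

/-- The local objectives are differentiable with `L`-Lipschitz gradients. -/
structure LSmooth (L : ℝ) : Prop where
  differentiable : ∀ m, Differentiable ℝ (P.localObj m)
  lipschitz : ∀ m v w,
    ‖gradient (P.localObj m) v - gradient (P.localObj m) w‖ ≤ L * ‖v - w‖

/-- Bounded noise: `𝔼 ‖∇f_m(v, B) - ∇F_m(v)‖² ≤ σ² / |B|` for every batch size that the data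
admit. -/
def BoundedNoise (σ : ℝ) : Prop :=
  ∀ (m : Fin M) (s : ℕ), 1 ≤ s → (s : ℕ∞) ≤ P.data.size → ∀ v : Vec d,
    ∫⁻ B : Fin s → Z, ‖P.batchGrad m B v - gradient (P.localObj m) v‖ₑ ^ 2 ∂(P.data.batchLaw m s)
      ≤ ENNReal.ofReal (σ ^ 2 / s)

/-- Average smoothness:
`𝔼 ‖(∇f_m(v, B) - ∇f_m(w, B)) - (∇F_m(v) - ∇F_m(w))‖² ≤ (L_σ² / |B|) ‖v - w‖²`. -/
def AverageSmooth (Lσ : ℝ) : Prop :=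
  ∀ (m : Fin M) (s : ℕ), 1 ≤ s → (s : ℕ∞) ≤ P.data.size → ∀ v w : Vec d,
    ∫⁻ B : Fin s → Z,
        ‖(P.batchGrad m B v - P.batchGrad m B w)
          - (gradient (P.localObj m) v - gradient (P.localObj m) w)‖ₑ ^ 2 ∂(P.data.batchLaw m s)
      ≤ ENNReal.ofReal (Lσ ^ 2 / s * ‖v - w‖ ^ 2)

end Problem

/-! ### The algorithm -/

/-- The inputs of the algorithm: number `A` of participants per round, number `K` of local updates,
batch sizes `b` and `b'`, learning rates, anchor probabilities `p t`, and the initial model. -/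
structure Params (d : ℕ) where
  A : ℕ
  K : ℕ
  b : ℕ
  b' : ℕ
  ηl : ℝ
  ηs : ℝ
  p : ℕ → ℝ
  x₀ : Vec d

/-- Labels of the independent sources of randomness. -/
inductive Source (M : ℕ)
  | participants (t : ℕ)
  | coin (t : ℕ) (m : Fin M)
  | initBatch (m : Fin M)
  | anchorBatch (t : ℕ) (m : Fin M)
  | minerBatch (t : ℕ) (m : Fin M) (k : ℕ)

/-- The random choices of the algorithm on a probability space: the set of participants of round
`t`, the coin with which client `m` joins the anchors (`true`) or the miners (`false`), the batches
of the initial caching gradients, the large batch of an anchor, and the small batch of a miner at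
its local iteration `k`. (Draws of clients that do not use them are never looked at.) -/
structure Draws {d M : ℕ} {Z : Type*} [MeasurableSpace Z] (P : Problem d M Z) (h : Params d)
    {Ω : Type*} [MeasurableSpace Ω] (μ : Measure Ω) where
  participants : ℕ → Ω → Finset (Fin M)
  coin : ℕ → Fin M → Ω → Bool
  initBatch : Fin M → Ω → (Fin h.b → Z)
  anchorBatch : ℕ → Fin M → Ω → (Fin h.b → Z)
  minerBatch : ℕ → Fin M → ℕ → Ω → (Fin h.b' → Z)
  participants_meas : ∀ t S, MeasurableSet {ω | participants t ω = S}
  coin_meas : ∀ t m, Measurable (coin t m)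
  initBatch_meas : ∀ m, Measurable (initBatch m)
  anchorBatch_meas : ∀ t m, Measurable (anchorBatch t m)
  minerBatch_meas : ∀ t m k, Measurable (minerBatch t m k)
  /-- The participants are a uniformly random set of `A` of the `M` clients. -/
  participants_law : ∀ t S, μ {ω | participants t ω = S} =
    if S.card = h.A then (M.choose h.A : ℝ≥0∞)⁻¹ else 0
  coin_law : ∀ t m, μ {ω | coin t m ω = true} = ENNReal.ofReal (h.p t)
  initBatch_law : ∀ m, μ.map (initBatch m) = P.data.batchLaw m h.b
  anchorBatch_law : ∀ t m, μ.map (anchorBatch t m) = P.data.batchLaw m h.b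
  minerBatch_law : ∀ t m k, μ.map (minerBatch t m k) = P.data.batchLaw m h.b'
  /-- All these choices are mutually independent. -/
  indep : iIndep (fun s : Source M => match s with
    | .participants t => MeasurableSpace.comap (participants t) ⊤
    | .coin t m => MeasurableSpace.comap (coin t m) inferInstance
    | .initBatch m => MeasurableSpace.comap (initBatch m) inferInstance
    | .anchorBatch t m => MeasurableSpace.comap (anchorBatch t m) inferInstance
    | .minerBatch t m k => MeasurableSpace.comap (minerBatch t m k) inferInstance) μ

/-- State of a miner before its local iteration `k`: the models `x_{k-1}` and `x_k`, the direction
`g_k`, and the number of sample gradients computed so far in this round. -/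
structure MinerState (d : ℕ) where
  prev : Vec d
  cur : Vec d
  dir : Vec d
  grads : ℕ

/-- State of the system before round `t`: the global model, the caching gradients, the number of
sample gradients computed so far by all clients, and the number of `d`-dimensional vectors
transmitted so far between the server and the clients. -/
structure State (d M : ℕ) where
  x : Vec d
  v : Fin M → Vec d
  grads : ℕ
  vecs : ℕ

namespace State

/-- The averaged caching gradient. -/
def g {d M : ℕ} (s : State d M) : Vec d := (M : ℝ)⁻¹ • ∑ m, s.v m

end State

namespace Draws

variable {d M : ℕ} {Z : Type*} [MeasurableSpace Z] {P : Problem d M Z} {h : Params d}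
  {Ω : Type*} [MeasurableSpace Ω] {μ : Measure Ω} (R : Draws P h μ)

/-- The local iterations of miner `i` in round `t`, started from `x_{-1} = x_0 = x` and `g_0 = g`:
`g_{k+1} = g_k - ∇f_i(x_{k-1}, B_k) + ∇f_i(x_k, B_k)` and `x_{k+1} = x_k - η_l g_{k+1}`.
One iteration computes two gradients for each of the `b'` samples. -/
def miner (ω : Ω) (t : ℕ) (i : Fin M) (x g : Vec d) : ℕ → MinerState d
  | 0 => { prev := x, cur := x, dir := g, grads := 0 }
  | k + 1 =>
    let s := miner ω t i x g k
    let B := R.minerBatch t i k ω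
    let dir' := s.dir - P.batchGrad i B s.prev + P.batchGrad i B s.cur
    { prev := s.cur
      cur := s.cur - h.ηl • dir'
      dir := dir'
      grads := s.grads + 2 * h.b' }

/-- The participants of round `t` whose coin shows `true`. -/
def anchors (ω : Ω) (t : ℕ) : Finset (Fin M) :=
  (R.participants t ω).filter fun i => R.coin t i ω = true

/-- The participants of round `t` whose coin shows `false`. -/
def miners (ω : Ω) (t : ℕ) : Finset (Fin M) :=
  (R.participants t ω).filter fun i => R.coin t i ω = false

/-- One round. An anchor receives `x`, computes a gradient on `b` samples, and sends it to the
server (two vectors). A miner receives `x` and `g`, performs its `K` local iterations, and sends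
its model change to the server (three vectors). The server moves the model by the average of the
model changes of the miners, and not at all if there is no miner. -/
def round (ω : Ω) (t : ℕ) (s : State d M) : State d M :=
  { x := if (R.miners ω t).card = 0 then s.x else
      s.x - (h.ηs / (R.miners ω t).card) •
        ∑ i ∈ R.miners ω t, (s.x - (R.miner ω t i s.x s.g h.K).cur)
    v := fun i => if i ∈ R.anchors ω t then P.batchGrad i (R.anchorBatch t i ω) s.x else s.v i
    grads := s.grads + ∑ _i ∈ R.anchors ω t, h.b
      + ∑ i ∈ R.miners ω t, (R.miner ω t i s.x s.g h.K).grads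
    vecs := s.vecs + 2 * (R.anchors ω t).card + 3 * (R.miners ω t).card }

/-- The state after `t` rounds. Initially every client computes its caching gradient at `x₀` on a
batch of `b` samples and sends it to the server. -/
def state (ω : Ω) : ℕ → State d M
  | 0 =>
    { x := h.x₀
      v := fun m => P.batchGrad m (R.initBatch m ω) h.x₀
      grads := M * h.b
      vecs := M }
  | t + 1 => R.round ω t (state ω t)

/-- The number of sample gradients that all clients compute in the first `T` rounds,
initialization included. -/
def gradCount (ω : Ω) (T : ℕ) : ℕ := (R.state ω T).grads

/-- The communication overhead of the first `T` rounds, initialization included: the number of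
transmitted vectors per participant, i.e. divided by the number `A` of participants of a round. -/
def commOverhead (ω : Ω) (T : ℕ) : ℝ := ((R.state ω T).vecs : ℝ) / h.A

end Draws

/-! ### The sequential probability setting and the complexity bounds -/

/-- `p_t = 1` if `τ` divides `t`, and `p_t = 0` otherwise. -/
def seqProb (τ t : ℕ) : ℝ := if t % τ = 0 then 1 else 0

/-- `(1 + 2Mτ/A) · τ/(τ-1) · 1/ε`, the order of the number of rounds. -/
def roundBound (M A τ : ℕ) (ε : ℝ) : ℝ :=
  (1 + 2 * (M : ℝ) * τ / A) * ((τ : ℝ) / ((τ : ℝ) - 1)) * (1 / ε)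

/-- `Mb/ε + τMKb'/ε`, the order of the number of gradients. -/
def gradBound (M K b b' τ : ℕ) (ε : ℝ) : ℝ :=
  (M : ℝ) * b / ε + (τ : ℝ) * M * K * b' / ε

/-- `Mτ/(Aε)`, the order of the communication overhead. -/
def commBound (M A τ : ℕ) (ε : ℝ) : ℝ := (M : ℝ) * τ / (A * ε)

end FedAMD

end

/-! With sequential probabilities the algorithm is almost surely cyclic: one round in which every
participant is an anchor, then `τ - 1` rounds in which every participant is a miner. The analysis
concerns the process `Draws.run` with this schedule built in; `Draws.Sequential.state_eq_run`
transfers the result to the algorithm.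

In a round of miners the model moves by `-γ d`, where `γ = η_s η_l K = 1 / (L (1 + 2Mτ/A))` and `d`
is the average of the local directions. Smoothness of `F` gives `F(x - γd) ≤ F(x) - γ/2 ‖∇F‖² - γ/2
(1 - Lγ) ‖d‖² + γ/2 ‖d - ∇F‖²`. The error `d - ∇F` has three sources. The drift of the local steps
is at most `7/60 · 𝔼‖g‖²` in mean square (`local_direction_bound`), because the noises of the
variance-reduced directions are martingale differences, each controlled by the length of one local
step. The sampling errors of the `M` caching gradients stay pairwise orthogonal throughout
(`Draws.cacheErr_bound`), so their average has mean square at most `ς/M ≤ ε/κ`. The third source is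
staleness: caches were computed at older models.

Staleness is the heart of the matter, because the prescribed step size leaves almost no slack in the
constants. With `a = A/M`, a given client misses `j` anchor rounds with probability `(1-a)^j`, and
two distinct clients both miss them with probability at most `(1-a)^(2j)`. Hence the second moment
of the average distance between model and cache points is smaller than the average second moment.
Cauchy–Schwarz with geometric weights, followed by summation of a convolution, bounds the total
staleness by `9/5 · (τ-1)²/a²` times the total squared movement (`Draws.sum_msq_staleness_le`). In
the descent inequality it carries the factor `13/6`, and `13/6 · 9/5 = 39/10 < 4` is just enough for
the negative `‖d‖²` term to absorb it.

Telescoping over `J` cycles bounds the average of `𝔼‖∇F‖²` over the rounds of miners by `16 (F(x₀) -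
F_*) / (γ J (τ-1)) + 1300/3 · ς/M` (`Draws.sum_msq_gradient_le`). A suitable `J` (`exists_periods`)
makes the first term at most `ε/2`, and some round does no worse than the average. The costs of a
cycle are deterministic, so the complexity bounds follow by counting. -/

namespace FedAMD

/-! ### Mean squares of random vectors. -/

section MeanSquare

variable {Ω : Type*} [MeasurableSpace Ω] {μ : Measure Ω} {E : Type*} [NormedAddCommGroup E]

/-- The mean square `𝔼 ‖X‖²`. -/
noncomputable def msq (μ : Measure Ω) (X : Ω → E) : ℝ := ∫ ω, ‖X ω‖ ^ 2 ∂μ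

theorem msq_nonneg (X : Ω → E) : 0 ≤ msq μ X := integral_nonneg fun _ => by positivity

theorem integrable_norm_sq {X : Ω → E} (hX : MemLp X 2 μ) :
    Integrable (fun ω => ‖X ω‖ ^ 2) μ :=
  (memLp_two_iff_integrable_sq_norm hX.1).1 hX

/-- Young's inequality for the cross term. The weight `z` stays free because later constants are
tuned to a prescribed learning rate. -/
theorem norm_add_sq_le_of_pos (x y : E) {z : ℝ} (hz : 0 < z) :
    ‖x + y‖ ^ 2 ≤ (1 + z) * ‖x‖ ^ 2 + (1 + z⁻¹) * ‖y‖ ^ 2 := by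
  have h1 := norm_add_le x y
  have h2 : ‖x + y‖ ^ 2 ≤ (‖x‖ + ‖y‖) ^ 2 := by gcongr
  have h3 : 0 ≤ z⁻¹ * (z * ‖x‖ - ‖y‖) ^ 2 := by positivity
  have h4 : z⁻¹ * (z * ‖x‖ - ‖y‖) ^ 2 = z * ‖x‖ ^ 2 - 2 * ‖x‖ * ‖y‖ + z⁻¹ * ‖y‖ ^ 2 := by
    field_simp
    ring
  nlinarith

/-- Only the majorant has to be square integrable: the Bochner integral of a nonnegative function
that is not integrable is `0`. -/
theorem msq_mono {F : Type*} [NormedAddCommGroup F]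
    {X : Ω → E} {Y : Ω → F} (hY : MemLp Y 2 μ)
    (h : ∀ ω, ‖X ω‖ ≤ ‖Y ω‖) : msq μ X ≤ msq μ Y :=
  integral_mono_of_nonneg (Filter.Eventually.of_forall fun _ => by positivity)
    (integrable_norm_sq hY) (Filter.Eventually.of_forall fun ω => by
      have := h ω
      simp only
      gcongr)

theorem msq_add_le {X Y : Ω → E} (hX : MemLp X 2 μ) (hY : MemLp Y 2 μ) {z : ℝ} (hz : 0 < z) :
    msq μ (fun ω => X ω + Y ω) ≤ (1 + z) * msq μ X + (1 + z⁻¹) * msq μ Y := by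
  rw [msq, msq, msq, ← integral_const_mul, ← integral_const_mul, ← integral_add
    ((integrable_norm_sq hX).const_mul _) ((integrable_norm_sq hY).const_mul _)]
  exact integral_mono (integrable_norm_sq (hX.add hY))
    (((integrable_norm_sq hX).const_mul _).add ((integrable_norm_sq hY).const_mul _))
    fun ω => norm_add_sq_le_of_pos _ _ hz

theorem norm_sum_sq_le_card_mul {ι : Type*} (s : Finset ι) (x : ι → E) :
    ‖∑ i ∈ s, x i‖ ^ 2 ≤ s.card * ∑ i ∈ s, ‖x i‖ ^ 2 := by
  have h1 : ‖∑ i ∈ s, x i‖ ^ 2 ≤ (∑ i ∈ s, ‖x i‖) ^ 2 := by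
    gcongr
    exact norm_sum_le _ _
  exact h1.trans sq_sum_le_card_mul_sum_sq

theorem msq_sum_le {ι : Type*} (s : Finset ι) {X : ι → Ω → E} (hX : ∀ i ∈ s, MemLp (X i) 2 μ) :
    msq μ (fun ω => ∑ i ∈ s, X i ω) ≤ s.card * ∑ i ∈ s, msq μ (X i) := by
  simp only [msq]
  rw [← integral_finsetSum s fun i hi => integrable_norm_sq (hX i hi), ← integral_const_mul]
  refine integral_mono_of_nonneg (Filter.Eventually.of_forall fun _ => by positivity)
    ((integrable_finsetSum s fun i hi => integrable_norm_sq (hX i hi)).const_mul _)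
    (Filter.Eventually.of_forall fun ω => norm_sum_sq_le_card_mul s _)

theorem ofReal_msq {X : Ω → E} (hX : MemLp X 2 μ) :
    ENNReal.ofReal (msq μ X) = ∫⁻ ω, ‖X ω‖ₑ ^ 2 ∂μ := by
  rw [msq, ofReal_integral_eq_lintegral_ofReal (integrable_norm_sq hX)
    (Filter.Eventually.of_forall fun _ => by positivity)]
  refine lintegral_congr fun ω => ?_
  rw [ENNReal.ofReal_pow (norm_nonneg _), ofReal_norm]

theorem memLp_two_of_lintegral {X : Ω → E} (hX : AEStronglyMeasurable X μ)
    (h : ∫⁻ ω, ‖X ω‖ₑ ^ 2 ∂μ < ∞) : MemLp X 2 μ := by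
  refine ⟨hX, ?_⟩
  rw [eLpNorm_lt_top_iff_lintegral_rpow_enorm_lt_top (by norm_num) (by norm_num)]
  simpa using h

theorem msq_le_of_lintegral {X : Ω → E} (hX : MemLp X 2 μ) {c : ℝ} (hc : 0 ≤ c)
    (h : ∫⁻ ω, ‖X ω‖ₑ ^ 2 ∂μ ≤ ENNReal.ofReal c) : msq μ X ≤ c := by
  rw [← ofReal_msq hX] at h
  exact (ENNReal.ofReal_le_ofReal_iff hc).1 h

variable [InnerProductSpace ℝ E]

theorem integrable_inner_of_memLp {X Y : Ω → E} (hX : MemLp X 2 μ) (hY : MemLp Y 2 μ) :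
    Integrable (fun ω => inner ℝ (X ω) (Y ω)) μ := by
  refine ((integrable_norm_sq hX).add (integrable_norm_sq hY)).mono' (hX.1.inner hY.1)
    (Filter.Eventually.of_forall fun ω => ?_)
  have h := abs_real_inner_le_norm (X ω) (Y ω)
  simp only [Real.norm_eq_abs, Pi.add_apply]
  nlinarith [sq_nonneg (‖X ω‖ - ‖Y ω‖), sq_nonneg ‖X ω‖, sq_nonneg ‖Y ω‖]

theorem msq_smul (c : ℝ) (X : Ω → E) : msq μ (fun ω => c • X ω) = c ^ 2 * msq μ X := by
  simp only [msq, norm_smul, mul_pow, integral_const_mul, Real.norm_eq_abs, sq_abs]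

theorem msq_add_eq {X Y : Ω → E} (hX : MemLp X 2 μ) (hY : MemLp Y 2 μ) :
    msq μ (fun ω => X ω + Y ω) = msq μ X + 2 * ∫ ω, inner ℝ (X ω) (Y ω) ∂μ + msq μ Y := by
  have h1 := integrable_norm_sq hX
  have h2 := integrable_norm_sq hY
  have h3 := (integrable_inner_of_memLp hX hY).const_mul 2
  have h4 : Integrable (fun ω => ‖X ω‖ ^ 2 + 2 * inner ℝ (X ω) (Y ω)) μ := h1.add h3
  rw [msq, msq, msq, ← integral_const_mul, ← integral_add h1 h3, ← integral_add h4 h2]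
  exact integral_congr_ae (Filter.Eventually.of_forall fun ω => norm_add_sq_real _ _)

/-- Pythagoras in `L²`. It saves a factor `M` over `msq_sum_le` when the errors of all caching
gradients are averaged. -/
theorem msq_sum_of_orthogonal {ι : Type*} [DecidableEq ι] (s : Finset ι) {X : ι → Ω → E}
    (hX : ∀ i, MemLp (X i) 2 μ)
    (horth : ∀ i j, i ≠ j → ∫ ω, inner ℝ (X i ω) (X j ω) ∂μ = 0) :
    msq μ (fun ω => ∑ i ∈ s, X i ω) = ∑ i ∈ s, msq μ (X i) := by
  induction s using Finset.induction_on with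
  | empty => simp [msq]
  | insert a s ha ih =>
    simp only [Finset.sum_insert ha]
    rw [msq_add_eq (hX a) (memLp_finsetSum s fun i _ => hX i), ih]
    have : ∫ ω, inner ℝ (X a ω) (∑ i ∈ s, X i ω) ∂μ = 0 := by
      simp only [inner_sum]
      rw [integral_finsetSum s fun i _ => integrable_inner_of_memLp (hX a) (hX i)]
      refine Finset.sum_eq_zero fun i hi => horth a i ?_
      rintro rfl
      exact ha hi
    rw [this]
    ring

end MeanSquare

/-! ### Drift of variance-reduced local steps. -/

section LocalSteps

variable {Ω : Type*} [MeasurableSpace Ω] {μ : Measure Ω}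
  {E : Type*} [NormedAddCommGroup E] [InnerProductSpace ℝ E]

theorem sum_range_id_le (K : ℕ) : ∑ k ∈ Finset.range K, (k : ℝ) ≤ (K : ℝ) ^ 2 / 2 := by
  induction K with
  | zero => simp
  | succ n ih =>
    rw [Finset.sum_range_succ]
    push_cast
    nlinarith

theorem sum_range_sq_le (K : ℕ) : ∑ k ∈ Finset.range K, (k : ℝ) ^ 2 ≤ (K : ℝ) ^ 3 / 3 := by
  induction K with
  | zero => simp
  | succ n ih =>
    rw [Finset.sum_range_succ]
    push_cast
    nlinarith [(Nat.cast_nonneg n : (0 : ℝ) ≤ n)]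

/-- Variance-reduced local steps: the directions `g (k + 1)` stay close in mean square to the
initial direction `g 0`. The process `N` is the accumulated sampling noise. -/
theorem local_direction_bound {K : ℕ} {η L ν : ℝ}
    {x g N : ℕ → Ω → E} {G : E → E} (hG : ∀ u v, ‖G u - G v‖ ≤ L * ‖u - v‖)
    (hg : ∀ k, MemLp (g k) 2 μ) (hN : ∀ k, MemLp (N k) 2 μ)
    (hGx : ∀ k, MemLp (fun ω => G (x k ω) - G (x 0 ω)) 2 μ)
    (hx : ∀ k ω, x (k + 1) ω = x k ω - η • g (k + 1) ω)
    (hgN : ∀ k ω, g (k + 1) ω = g 0 ω + ((G (x k ω) - G (x 0 ω)) + N k ω))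
    (hN0 : msq μ (N 0) = 0)
    (hNsucc : ∀ k, msq μ (N (k + 1)) ≤ msq μ (N k) + ν * η ^ 2 * msq μ (g (k + 1)))
    (hL : 24 * η ^ 2 * L ^ 2 * (K : ℝ) ^ 2 ≤ 1) (hνK : 48 * ν * η ^ 2 * K ≤ 1) :
    ∑ k ∈ Finset.range K, msq μ (fun ω => g (k + 1) ω - g 0 ω) ≤ K * (7 / 60 * msq μ (g 0)) := by
  rcases Nat.eq_zero_or_pos K with rfl | hKpos
  · simp
  have hK : (0 : ℝ) < K := by exact_mod_cast hKpos
  set Q : ℕ → ℝ := fun k => ∑ j ∈ Finset.range k, msq μ (g (j + 1)) with hQ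
  have hQnn : ∀ k, 0 ≤ Q k := fun k => Finset.sum_nonneg fun _ _ => msq_nonneg _
  have h1 : ∀ k, msq μ (N k) ≤ ν * η ^ 2 * Q k := by
    intro k
    induction k with
    | zero => simp [hN0, hQ]
    | succ k ih =>
      have : Q (k + 1) = Q k + msq μ (g (k + 1)) := Finset.sum_range_succ _ _
      rw [this]
      linarith [hNsucc k]
  have hxsum : ∀ k ω, x k ω - x 0 ω = (-η) • ∑ j ∈ Finset.range k, g (j + 1) ω := by
    intro k ω
    induction k with
    | zero => simp
    | succ k ih =>
      rw [Finset.sum_range_succ, smul_add, ← ih, hx]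
      simp only [neg_smul]
      abel
  have h2 : ∀ k, msq μ (fun ω => G (x k ω) - G (x 0 ω)) ≤ L ^ 2 * η ^ 2 * k * Q k := by
    intro k
    have hS : MemLp (fun ω => ∑ j ∈ Finset.range k, g (j + 1) ω) 2 μ :=
      memLp_finsetSum _ fun j _ => hg (j + 1)
    calc msq μ (fun ω => G (x k ω) - G (x 0 ω))
        ≤ msq μ (fun ω => (L * η) • ∑ j ∈ Finset.range k, g (j + 1) ω) := by
          refine msq_mono (hS.const_smul (L * η)) fun ω => ?_
          refine (hG _ _).trans ?_
          rw [hxsum, norm_smul, norm_smul, norm_neg, norm_mul, ← mul_assoc]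
          gcongr
          exact Real.le_norm_self L
      _ = (L * η) ^ 2 * msq μ (fun ω => ∑ j ∈ Finset.range k, g (j + 1) ω) := msq_smul _ _
      _ ≤ (L * η) ^ 2 * (k * Q k) := by
          gcongr
          simpa using msq_sum_le (Finset.range k) fun j _ => hg (j + 1)
      _ = _ := by ring
  have hdiff : ∀ k, (fun ω => g (k + 1) ω - g 0 ω)
      = fun ω => (G (x k ω) - G (x 0 ω)) + N k ω := by
    intro k
    ext1 ω
    rw [hgN]
    abel
  -- Splitting with `z = 1` doubles both parts: the learning-rate conditions turn `2 L²η² k` into `k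
  -- / (12 K²)` and `2 νη²` into `1 / (24 K)`.
  have h3 : ∀ k, msq μ (fun ω => g (k + 1) ω - g 0 ω)
      ≤ Q k * (k / (12 * K ^ 2) + 1 / (24 * K)) := by
    intro k
    have ha := msq_add_le (hGx k) (hN k) (z := 1) one_pos
    rw [hdiff]
    have hb : L ^ 2 * η ^ 2 ≤ 1 / (24 * K ^ 2) := by
      rw [le_div_iff₀ (by positivity)]
      linarith
    have hc : ν * η ^ 2 ≤ 1 / (48 * K) := by
      rw [le_div_iff₀ (by positivity)]
      linarith
    have hd : L ^ 2 * η ^ 2 * k * Q k ≤ 1 / (24 * K ^ 2) * k * Q k := by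
      have := hQnn k
      gcongr
    have he : ν * η ^ 2 * Q k ≤ 1 / (48 * K) * Q k := by
      have := hQnn k
      gcongr
    calc _ ≤ 2 * (1 / (24 * K ^ 2) * k * Q k) + 2 * (1 / (48 * K) * Q k) := by
          norm_num at ha
          linarith [h1 k, h2 k]
      _ = _ := by
          field_simp
          ring
  set S := msq μ (g 0) with hS
  have hSnn : 0 ≤ S := msq_nonneg _
  -- Bootstrap: if all earlier directions have mean square at most `12/5 · S`, the next deviation is
  -- at most `3/10 · S`, since the weight in `h3` is at most `1 / (8K)`. Young's inequality with `z
  -- = 11/20 ≈ √(3/10)` then reproduces `12/5`, which barely exceeds `(1 + √(3/10))²`.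
  have h4 : ∀ k, k ≤ K → Q k ≤ 12 / 5 * S * k := by
    intro k
    induction k with
    | zero => simp [hQ]
    | succ k ih =>
      intro hk
      have hkK : (k : ℝ) ≤ K := by exact_mod_cast (Nat.le_of_succ_le hk)
      have ih' := ih (Nat.le_of_succ_le hk)
      have hQs : Q (k + 1) = Q k + msq μ (g (k + 1)) := Finset.sum_range_succ _ _
      have he : msq μ (fun ω => g (k + 1) ω - g 0 ω) ≤ 3 / 10 * S := by
        refine (h3 k).trans ?_
        have hw : (k : ℝ) / (12 * K ^ 2) + 1 / (24 * K) ≤ 1 / (8 * K) := by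
          rw [div_add_div _ _ (by positivity) (by positivity),
            div_le_div_iff₀ (by positivity) (by positivity)]
          nlinarith [mul_le_mul_of_nonneg_left hkK (by positivity : (0 : ℝ) ≤ (K : ℝ) ^ 2)]
        calc _ ≤ (12 / 5 * S * K) * (1 / (8 * K)) := by
              have : Q k ≤ 12 / 5 * S * K := ih'.trans (by gcongr)
              gcongr
          _ = 3 / 10 * S := by
              field_simp
              ring
      have hgk : msq μ (g (k + 1)) ≤ 12 / 5 * S := by
        have ha := msq_add_le (hg 0) ((hg (k + 1)).sub (hg 0)) (z := 11 / 20) (by norm_num)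
        have hb : (fun ω => g 0 ω + (g (k + 1) - g 0) ω) = g (k + 1) := by
          ext1 ω
          simp
        rw [hb] at ha
        change _ ≤ _ + _ * msq μ (fun ω => g (k + 1) ω - g 0 ω) at ha
        norm_num at ha
        linarith
      rw [hQs]
      push_cast
      linarith
  -- Inserting the bound linear in `k` instead of the uniform `3/10 · S` improves the average
  -- deviation to `12/5 · (1/36 + 1/48) = 7/60`.
  calc ∑ k ∈ Finset.range K, msq μ (fun ω => g (k + 1) ω - g 0 ω)
      ≤ ∑ k ∈ Finset.range K,
          (12 / 5 * S / (12 * K ^ 2) * (k : ℝ) ^ 2 + 12 / 5 * S / (24 * K) * k) := by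
        refine Finset.sum_le_sum fun k hk => (h3 k).trans ?_
        have := h4 k (Finset.mem_range.1 hk).le
        calc _ ≤ (12 / 5 * S * k) * (k / (12 * K ^ 2) + 1 / (24 * K)) := by gcongr
          _ = _ := by ring
    _ = 12 / 5 * S / (12 * K ^ 2) * ∑ k ∈ Finset.range K, (k : ℝ) ^ 2
        + 12 / 5 * S / (24 * K) * ∑ k ∈ Finset.range K, (k : ℝ) := by
        rw [Finset.sum_add_distrib, Finset.mul_sum, Finset.mul_sum]
    _ ≤ 12 / 5 * S / (12 * K ^ 2) * ((K : ℝ) ^ 3 / 3) + 12 / 5 * S / (24 * K) * ((K : ℝ) ^ 2 / 2) := by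
        gcongr
        · exact sum_range_sq_le K
        · exact sum_range_id_le K
    _ = K * (7 / 60 * S) := by
        field_simp
        ring

end LocalSteps

/-! ### Numerical inequalities for the summed staleness. -/

section Numerics

/-- The left side peaks at about `1.76` near `a = 9/20`, whence the squares offered to `nlinarith`.
The value `9/5` must stay below `24/13`, the limit set by the absorption in
`Draws.sum_msq_gradient_le`. -/
theorem staleness_polynomial_le {a : ℝ} (h0 : 0 < a) (h1 : a ≤ 1) :
    (3 - a) / 2 * ((1 - a) * (3 - 2 * a) / (4 - 3 * a) + a * (3 - 2 * a)) ≤ 9 / 5 := by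
  have h4 : (0 : ℝ) < 4 - 3 * a := by linarith
  rw [div_add' _ _ _ h4.ne', mul_div_assoc', div_le_iff₀ h4]
  nlinarith [sq_nonneg (a ^ 2 - a), sq_nonneg (a - 1 / 2), sq_nonneg (a - 9 / 20),
    mul_nonneg h0.le (sub_nonneg.2 h1), mul_nonneg h0.le (sq_nonneg (a - 9 / 20)),
    mul_nonneg (sub_nonneg.2 h1) (sq_nonneg (a - 9 / 20)), sq_nonneg (a ^ 2 - 9 / 20 * a),
    mul_nonneg (mul_nonneg h0.le (sub_nonneg.2 h1)) (sq_nonneg (a - 9 / 20))]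

/-- Young's inequality for the convolution of two `ℓ¹` sequences: exchange the sums and sum the
kernel first. -/
theorem sum_convolution_le {J : ℕ} {k u : ℕ → ℝ} (hu : ∀ l, 0 ≤ u l) {S : ℝ}
    (hS : ∀ n, ∑ j ∈ Finset.range n, k j ≤ S) :
    ∑ n ∈ Finset.range J, ∑ l ∈ Finset.range (n + 1), k (n - l) * u l
      ≤ S * ∑ l ∈ Finset.range J, u l := by
  have h1 : ∑ n ∈ Finset.range J, ∑ l ∈ Finset.range (n + 1), k (n - l) * u l
      = ∑ l ∈ Finset.range J, ∑ n ∈ Finset.Ico l J, k (n - l) * u l := by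
    refine Finset.sum_comm' fun n l => ?_
    simp only [Finset.mem_range, Finset.mem_Ico]
    omega
  rw [h1, Finset.mul_sum]
  refine Finset.sum_le_sum fun l _ => ?_
  rw [← Finset.sum_mul]
  refine mul_le_mul_of_nonneg_right ?_ (hu l)
  rw [Finset.sum_Ico_eq_sum_range]
  simpa using hS (J - l)

theorem geom_sum_le_inv {r : ℝ} (h0 : 0 ≤ r) (h1 : r < 1) (n : ℕ) :
    ∑ j ∈ Finset.range n, r ^ j ≤ (1 - r)⁻¹ := by
  rw [← tsum_geometric_of_lt_one h0 h1]
  exact (summable_geometric_of_lt_one h0 h1).sum_le_tsum _ fun _ _ => by positivity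

/-- Summed staleness: `u l` is the mean square movement in cycle `l`, and `r n i` the mean square
staleness of the caches after `i` moves of cycle `n`. -/
theorem staleness_sum_le {a : ℝ} (h0 : 0 < a) (h1 : a ≤ 1) (J N : ℕ) {u : ℕ → ℝ}
    {r : ℕ → ℕ → ℝ} (hu : ∀ l, 0 ≤ u l)
    (hr : ∀ n i, i < N → r n i ≤
      (i + N * ∑ j ∈ Finset.range n, (1 - 2 * a / 3) ^ (j + 1)) *
        ∑ l ∈ Finset.range (n + 1), ((1 - a) * ((1 - a) ^ 2) ^ (n - l) + a * (1 - a) ^ (n - l)) /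
          (1 - 2 * a / 3) ^ (n - l) * u l) :
    ∑ n ∈ Finset.range J, ∑ i ∈ Finset.range N, r n i
      ≤ (N : ℝ) ^ 2 * (9 / (5 * a ^ 2)) * ∑ l ∈ Finset.range J, u l := by
  -- The Cauchy–Schwarz weights `y ^ j` must be summable and must decay more slowly than `(1 - a) ^
  -- j`, so that the kernel divided by them is summable too. This `y` lies strictly between `1 - a`
  -- and `1`, with gaps `a/3` and `2a/3`.
  set y := 1 - 2 * a / 3 with hy
  have hy0 : 0 < y := by rw [hy]; linarith
  have hy1 : y < 1 := by rw [hy]; linarith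
  set k : ℕ → ℝ := fun j => ((1 - a) * ((1 - a) ^ 2) ^ j + a * (1 - a) ^ j) / y ^ j with hk
  have hq : 0 ≤ 1 - a := by linarith
  have hknn : ∀ j, 0 ≤ k j := fun j => by positivity
  have hYsum : ∀ n, ∑ j ∈ Finset.range n, y ^ (j + 1) ≤ 3 / (2 * a) - 1 := by
    intro n
    simp only [pow_succ]
    rw [← Finset.sum_mul]
    calc _ ≤ (1 - y)⁻¹ * y := by
          gcongr
          exact geom_sum_le_inv hy0.le hy1 n
      _ = _ := by
          have : 1 - y = 2 * a / 3 := by rw [hy]; ring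
          rw [this, hy]
          field_simp
  set B : ℕ → ℝ := fun n => ∑ l ∈ Finset.range (n + 1), k (n - l) * u l with hB
  have hBnn : ∀ n, 0 ≤ B n := fun n =>
    Finset.sum_nonneg fun l _ => mul_nonneg (hknn _) (hu l)
  have hinner : ∀ n, ∑ i ∈ Finset.range N, r n i ≤ (N : ℝ) ^ 2 * ((3 - a) / (2 * a)) * B n := by
    intro n
    calc ∑ i ∈ Finset.range N, r n i
        ≤ ∑ i ∈ Finset.range N, ((i : ℝ) + N * (3 / (2 * a) - 1)) * B n := by
          refine Finset.sum_le_sum fun i hi => (hr n i (Finset.mem_range.1 hi)).trans ?_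
          have := hBnn n
          gcongr
          exact hYsum n
      _ = ((∑ i ∈ Finset.range N, (i : ℝ)) + N * (N * (3 / (2 * a) - 1))) * B n := by
          rw [← Finset.sum_mul, Finset.sum_add_distrib]
          simp
      _ ≤ ((N : ℝ) ^ 2 / 2 + N * (N * (3 / (2 * a) - 1))) * B n := by
          have := hBnn n
          gcongr
          exact sum_range_id_le N
      _ = _ := by
          field_simp
          ring
  have hd1 : y - (1 - a) ^ 2 = a * (4 / 3 - a) := by rw [hy]; ring
  have hd2 : y - (1 - a) = a / 3 := by rw [hy]; ring
  have hd1p : 0 < y - (1 - a) ^ 2 := by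
    rw [hd1]
    exact mul_pos h0 (by linarith)
  have hd2p : 0 < y - (1 - a) := by rw [hd2]; linarith
  have hkS : ∀ n, ∑ j ∈ Finset.range n, k j
      ≤ (1 - a) * (y / (y - (1 - a) ^ 2)) + a * (y / (y - (1 - a))) := by
    intro n
    have : ∀ j, k j = (1 - a) * ((1 - a) ^ 2 / y) ^ j + a * ((1 - a) / y) ^ j := by
      intro j
      simp only [hk, div_pow]
      ring
    simp only [this]
    rw [Finset.sum_add_distrib, ← Finset.mul_sum, ← Finset.mul_sum]
    have e1 : y / (y - (1 - a) ^ 2) = (1 - (1 - a) ^ 2 / y)⁻¹ := by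
      rw [one_sub_div hy0.ne', inv_div]
    have e2 : y / (y - (1 - a)) = (1 - (1 - a) / y)⁻¹ := by
      rw [one_sub_div hy0.ne', inv_div]
    rw [e1, e2]
    gcongr
    · exact geom_sum_le_inv (by positivity) (by rw [div_lt_one hy0]; linarith) n
    · exact geom_sum_le_inv (by positivity) (by rw [div_lt_one hy0]; linarith) n
  calc ∑ n ∈ Finset.range J, ∑ i ∈ Finset.range N, r n i
      ≤ ∑ n ∈ Finset.range J, (N : ℝ) ^ 2 * ((3 - a) / (2 * a)) * B n :=
        Finset.sum_le_sum fun n _ => hinner n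
    _ = (N : ℝ) ^ 2 * ((3 - a) / (2 * a)) * ∑ n ∈ Finset.range J, B n := by rw [Finset.mul_sum]
    _ ≤ (N : ℝ) ^ 2 * ((3 - a) / (2 * a)) *
        (((1 - a) * (y / (y - (1 - a) ^ 2)) + a * (y / (y - (1 - a))))
          * ∑ l ∈ Finset.range J, u l) := by
        have : 0 ≤ (3 - a) / (2 * a) := div_nonneg (by linarith) (by linarith)
        gcongr
        exact sum_convolution_le hu hkS
    _ = (N : ℝ) ^ 2 * ((3 - a) / (2 * a) *
        ((1 - a) * (y / (y - (1 - a) ^ 2)) + a * (y / (y - (1 - a)))))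
          * ∑ l ∈ Finset.range J, u l := by ring
    _ ≤ _ := by
        have hsum : 0 ≤ ∑ l ∈ Finset.range J, u l := Finset.sum_nonneg fun l _ => hu l
        gcongr
        have := staleness_polynomial_le h0 h1
        rw [hd1, hd2]
        have h43 : (4 - 3 * a) ≠ 0 := by linarith
        have h43' : (4 / 3 - a) ≠ 0 := by linarith
        have key : (3 - a) / (2 * a) * ((1 - a) * (y / (a * (4 / 3 - a))) + a * (y / (a / 3)))
            = ((3 - a) / 2 * ((1 - a) * (3 - 2 * a) / (4 - 3 * a) + a * (3 - 2 * a))) / a ^ 2 := by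
          have e : a * (4 / 3 - a) = a * (4 - 3 * a) / 3 := by ring
          rw [e, hy]
          field_simp
          try ring
        rw [key, ← div_div]
        gcongr

end Numerics

/-! ### Gradients: finite averages, the descent inequality, measurability. -/

section Gradients

variable {E : Type*} [NormedAddCommGroup E] [InnerProductSpace ℝ E] [CompleteSpace E]

theorem hasGradientAt_const_mul_sum {ι : Type*} (s : Finset ι) (c : ℝ) {f : ι → E → ℝ} {x : E}
    (hf : ∀ i ∈ s, DifferentiableAt ℝ (f i) x) :
    HasGradientAt (fun y => c * ∑ i ∈ s, f i y) (c • ∑ i ∈ s, gradient (f i) x) x := by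
  rw [hasGradientAt_iff_hasFDerivAt]
  have h1 : HasFDerivAt (fun y => ∑ i ∈ s, f i y)
      (∑ i ∈ s, InnerProductSpace.toDual ℝ E (gradient (f i) x)) x :=
    HasFDerivAt.fun_sum fun i hi => ((hf i hi).hasGradientAt).hasFDerivAt
  have h2 := h1.const_mul c
  simpa [map_sum] using h2

theorem gradient_const_mul_sum {ι : Type*} (s : Finset ι) (c : ℝ) {f : ι → E → ℝ} {x : E}
    (hf : ∀ i ∈ s, DifferentiableAt ℝ (f i) x) :
    gradient (fun y => c * ∑ i ∈ s, f i y) x = c • ∑ i ∈ s, gradient (f i) x :=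
  (hasGradientAt_const_mul_sum s c hf).gradient

/-- The quadratic upper bound for a function with Lipschitz gradient. -/
theorem descent_bound {f : E → ℝ} (hf : Differentiable ℝ f) {L : ℝ}
    (hL : ∀ v w, ‖gradient f v - gradient f w‖ ≤ L * ‖v - w‖) (x y : E) :
    f (x + y) ≤ f x + inner ℝ (gradient f x) y + L / 2 * ‖y‖ ^ 2 := by
  set φ : ℝ → ℝ := fun t => f (x + t • y) with hφ
  set ψ : ℝ → ℝ := fun t => f x + t * inner ℝ (gradient f x) y + L / 2 * ‖y‖ ^ 2 * t ^ 2 with hψ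
  have hφ' : ∀ t, HasDerivAt φ (inner ℝ (gradient f (x + t • y)) y) t := by
    intro t
    have h1 : HasFDerivAt f (InnerProductSpace.toDual ℝ E (gradient f (x + t • y))) (x + t • y) :=
      (hf _).hasGradientAt.hasFDerivAt
    have h2 : HasDerivAt (fun t : ℝ => x + t • y) y t := by
      simpa using ((hasDerivAt_id t).smul_const y).const_add x
    have h3 := h1.comp_hasDerivAt t h2
    rw [InnerProductSpace.toDual_apply_apply] at h3
    exact h3
  have hψ' : ∀ t, HasDerivAt ψ (inner ℝ (gradient f x) y + L * ‖y‖ ^ 2 * t) t := by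
    intro t
    have h1 : HasDerivAt (fun t : ℝ => t * inner ℝ (gradient f x) y) (inner ℝ (gradient f x) y) t := by
      simpa using (hasDerivAt_id t).mul_const (inner ℝ (gradient f x) y)
    have h2 := ((hasDerivAt_pow 2 t).const_mul (L / 2 * ‖y‖ ^ 2))
    refine ((h1.const_add (f x)).add h2).congr_deriv ?_
    push_cast
    ring
  -- Along the segment from `x` to `x + y` the derivative of `f` is at most that of the quadratic
  -- `ψ`, and the two functions agree at `0`.
  have key : ∀ ⦃t⦄, t ∈ Set.Icc (0 : ℝ) 1 → φ t ≤ ψ t := by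
    refine image_le_of_deriv_right_le_deriv_boundary (f' := fun t => inner ℝ (gradient f (x + t • y)) y)
      (B' := fun t => inner ℝ (gradient f x) y + L * ‖y‖ ^ 2 * t)
      (fun t _ => (hφ' t).continuousAt.continuousWithinAt) (fun t _ => (hφ' t).hasDerivWithinAt)
      (by simp [hφ, hψ]) (fun t _ => (hψ' t).continuousAt.continuousWithinAt)
      (fun t _ => (hψ' t).hasDerivWithinAt) fun t ht => ?_
    have h1 : inner ℝ (gradient f (x + t • y)) y - inner ℝ (gradient f x) y
        ≤ ‖gradient f (x + t • y) - gradient f x‖ * ‖y‖ := by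
      rw [← inner_sub_left]
      exact real_inner_le_norm _ _
    have h2 := hL (x + t • y) x
    rw [add_sub_cancel_left, norm_smul, Real.norm_of_nonneg ht.1] at h2
    nlinarith [mul_le_mul_of_nonneg_right h2 (norm_nonneg y)]
  have := key (Set.right_mem_Icc.2 zero_le_one)
  simpa [hφ, hψ] using this

end Gradients

/-- Joint measurability of the gradient of a function that depends measurably on a parameter. -/
theorem measurable_gradient_with_param {d : ℕ} {Z : Type*} [MeasurableSpace Z]
    {f : Vec d → Z → ℝ} (hd : ∀ z, Differentiable ℝ fun x => f x z) (hm : ∀ x, Measurable (f x)) :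
    Measurable fun p : Z × Vec d => gradient (fun x => f x p.1) p.2 := by
  have hf : Measurable (Function.uncurry f) :=
    measurable_uncurry_of_continuous_of_measurable (fun z => (hd z).continuous) hm
  have hdir : ∀ v : Vec d, Measurable fun p : Z × Vec d =>
      inner ℝ v (gradient (fun x => f x p.1) p.2) := by
    intro v
    -- Difference quotients with step `1/(n+1)` are jointly measurable and converge to the
    -- directional derivative; the gradient is then rebuilt from its coordinates in an orthonormal
    -- basis.
    have hn : ∀ n : ℕ, Measurable fun p : Z × Vec d =>
        ((n : ℝ) + 1) • (f (p.2 + ((n : ℝ) + 1)⁻¹ • v) p.1 - f p.2 p.1) := by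
      intro n
      have h1 : Measurable fun p : Z × Vec d => f (p.2 + ((n : ℝ) + 1)⁻¹ • v) p.1 :=
        hf.comp ((measurable_snd.add_const _).prodMk measurable_fst)
      have h2 : Measurable fun p : Z × Vec d => f p.2 p.1 :=
        hf.comp (measurable_snd.prodMk measurable_fst)
      exact (h1.sub h2).const_mul ((n : ℝ) + 1)
    refine measurable_of_tendsto_metrizable hn (tendsto_pi_nhds.2 fun p => ?_)
    have h := ((hd p.1) p.2).hasFDerivAt.lim v (c := fun n : ℕ => (n : ℝ) + 1)
      (l := Filter.atTop) (by
        have : Filter.Tendsto (fun n : ℕ => (n : ℝ) + 1) Filter.atTop Filter.atTop :=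
          Filter.tendsto_atTop_add_const_right _ _ tendsto_natCast_atTop_atTop
        exact tendsto_norm_atTop_atTop.comp this)
    rw [real_inner_comm, inner_gradient_left]
    exact h
  have hrep : (fun p : Z × Vec d => gradient (fun x => f x p.1) p.2) = fun p =>
      ∑ i, inner ℝ (EuclideanSpace.basisFun (Fin d) ℝ i) (gradient (fun x => f x p.1) p.2)
        • EuclideanSpace.basisFun (Fin d) ℝ i := by
    ext1 p
    exact ((EuclideanSpace.basisFun (Fin d) ℝ).sum_repr' _).symm
  rw [hrep]
  exact Finset.measurable_fun_sum _ fun i _ => (hdir _).smul_const _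

/-! ### Batch gradients: measurability, unbiasedness, noise of large batches. -/

namespace Problem

variable {d M : ℕ} {Z : Type*} [MeasurableSpace Z] {P : Problem d M Z}

/-- The gradient of the loss on a single sample. -/
noncomputable def sampleGrad (P : Problem d M Z) (m : Fin M) (v : Vec d) (z : Z) : Vec d :=
  gradient (fun x => P.loss m x z) v

/-- The deviation of the batch gradient from the gradient of the local objective. -/
noncomputable def noise (P : Problem d M Z) (m : Fin M) {s : ℕ} (v : Vec d) (B : Fin s → Z) :
    Vec d :=
  P.batchGrad m B v - gradient (P.localObj m) v

theorem batchGrad_eq (hr : P.Regular) (m : Fin M) {s : ℕ} (B : Fin s → Z) (v : Vec d) :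
    P.batchGrad m B v = (s : ℝ)⁻¹ • ∑ j, P.sampleGrad m v (B j) :=
  gradient_const_mul_sum _ _ fun _ _ => (hr.differentiable m _) v

theorem measurable_sampleGrad (hr : P.Regular) (m : Fin M) :
    Measurable fun p : Vec d × Z => P.sampleGrad m p.1 p.2 :=
  (measurable_gradient_with_param (hr.differentiable m) (hr.measurable m)).comp measurable_swap

theorem measurable_batchGrad (hr : P.Regular) (m : Fin M) (s : ℕ) :
    Measurable fun p : Vec d × (Fin s → Z) => P.batchGrad m p.2 p.1 := by
  simp only [batchGrad_eq hr]
  have h : ∀ j : Fin s, Measurable fun p : Vec d × (Fin s → Z) => P.sampleGrad m p.1 (p.2 j) :=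
    fun j => (measurable_sampleGrad hr m).comp
      (measurable_fst.prodMk ((measurable_pi_apply j).comp measurable_snd))
  exact (Finset.measurable_fun_sum Finset.univ fun j _ => h j).const_smul (s : ℝ)⁻¹

theorem continuous_localGrad {L : ℝ} (hs : P.LSmooth L) (m : Fin M) :
    Continuous (gradient (P.localObj m)) := by
  refine (LipschitzWith.of_dist_le_mul (K := L.toNNReal) fun v w => ?_).continuous
  rw [dist_eq_norm, dist_eq_norm]
  refine (hs.lipschitz m v w).trans ?_
  gcongr
  exact Real.le_coe_toNNReal L

theorem measurable_noise (hr : P.Regular) {L : ℝ} (hs : P.LSmooth L) (m : Fin M) (s : ℕ) :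
    Measurable fun p : Vec d × (Fin s → Z) => P.noise m p.1 p.2 :=
  (measurable_batchGrad hr m s).sub
    ((continuous_localGrad hs m).measurable.comp measurable_fst)

theorem measurable_batchGrad_comp (hr : P.Regular) (m : Fin M) {s : ℕ} {Ω : Type*}
    {m' : MeasurableSpace Ω} {X : Ω → Vec d} {B : Ω → (Fin s → Z)} (hX : Measurable X)
    (hB : Measurable B) : Measurable fun ω => P.batchGrad m (B ω) (X ω) := by
  have h2 := Measurable.comp (measurable_batchGrad hr m s) (hX.prodMk hB)
  simpa only [Function.comp_def] using h2

theorem measurable_noise_comp (hr : P.Regular) {L : ℝ} (hs : P.LSmooth L) (m : Fin M) {s : ℕ}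
    {Ω : Type*} {m' : MeasurableSpace Ω} {X : Ω → Vec d} {B : Ω → (Fin s → Z)}
    (hX : Measurable X) (hB : Measurable B) : Measurable fun ω => P.noise m (X ω) (B ω) := by
  have h2 := Measurable.comp (measurable_noise hr hs m s) (hX.prodMk hB)
  simpa only [Function.comp_def] using h2

theorem measurable_noise_left (hr : P.Regular) {L : ℝ} (hs : P.LSmooth L) (m : Fin M) (s : ℕ)
    (v : Vec d) : Measurable fun B : Fin s → Z => P.noise m v B :=
  measurable_noise_comp hr hs m measurable_const measurable_id

theorem gradient_obj {L : ℝ} (hs : P.LSmooth L) (x : Vec d) :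
    gradient P.obj x = (M : ℝ)⁻¹ • ∑ m, gradient (P.localObj m) x :=
  gradient_const_mul_sum _ _ fun m _ => hs.differentiable m x

theorem differentiable_obj {L : ℝ} (hs : P.LSmooth L) : Differentiable ℝ P.obj := fun x =>
  (hasGradientAt_const_mul_sum (f := fun m y => P.localObj m y) Finset.univ (M : ℝ)⁻¹
    fun m _ => hs.differentiable m x).differentiableAt

theorem lipschitz_gradient_obj {L : ℝ} (hs : P.LSmooth L) (hM : 0 < M) (v w : Vec d) :
    ‖gradient P.obj v - gradient P.obj w‖ ≤ L * ‖v - w‖ := by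
  have hM' : (0 : ℝ) < M := by exact_mod_cast hM
  rw [gradient_obj hs, gradient_obj hs, ← smul_sub, ← Finset.sum_sub_distrib, norm_smul,
    Real.norm_of_nonneg (by positivity), inv_mul_le_iff₀ hM']
  calc _ ≤ ∑ m : Fin M, ‖gradient (P.localObj m) v - gradient (P.localObj m) w‖ := norm_sum_le _ _
    _ ≤ ∑ _m : Fin M, L * ‖v - w‖ := Finset.sum_le_sum fun m _ => hs.lipschitz m v w
    _ = _ := by simp

/-- Cyclic translation of the indices by `r` permutes the embeddings, and for a fixed embedding the
translates of `e j` run through all indices. Summing over `r` and `e` in both orders shows that one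
entry of a batch drawn without replacement is uniform. -/
theorem sum_embedding_apply {V : Type*} [AddCommGroup V] [Module ℝ V] {s n : ℕ}
    (g : Fin n → V) (j : Fin s) :
    (n : ℝ) • ∑ e : Fin s ↪ Fin n, g (e j) = (Fintype.card (Fin s ↪ Fin n) : ℝ) • ∑ i, g i := by
  rcases Nat.eq_zero_or_pos n with rfl | hn
  · have : IsEmpty (Fin s ↪ Fin 0) := ⟨fun e => (e j).elim0⟩
    simp
  have : NeZero n := ⟨hn.ne'⟩
  have h1 : ∀ r : Fin n, ∑ e : Fin s ↪ Fin n, g (e j + r) = ∑ e : Fin s ↪ Fin n, g (e j) :=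
    fun r => Equiv.sum_comp (Equiv.embeddingCongr (Equiv.refl (Fin s)) (Equiv.addRight r))
      (fun e => g (e j))
  have h2 : ∀ e : Fin s ↪ Fin n, ∑ r, g (e j + r) = ∑ i, g i := fun e =>
    Equiv.sum_comp (Equiv.addLeft (e j)) g
  calc (n : ℝ) • ∑ e : Fin s ↪ Fin n, g (e j)
      = ∑ r : Fin n, ∑ e : Fin s ↪ Fin n, g (e j + r) := by
        simp [h1, Nat.cast_smul_eq_nsmul]
    _ = ∑ e : Fin s ↪ Fin n, ∑ r : Fin n, g (e j + r) := Finset.sum_comm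
    _ = _ := by simp [h2, Nat.cast_smul_eq_nsmul]

theorem localGrad_finite (hr : P.Regular) {n : ℕ} {z : Fin M → Fin n → Z}
    (hP : P.data = .finite n z) (m : Fin M) (v : Vec d) :
    gradient (P.localObj m) v = (n : ℝ)⁻¹ • ∑ i, P.sampleGrad m v (z m i) := by
  have h : P.localObj m = fun x => (n : ℝ)⁻¹ * ∑ i, P.loss m x (z m i) := by
    ext1 x
    have hsm := (hr.measurable m x).stronglyMeasurable
    simp only [localObj, hP, ClientData.sampleLaw]
    rw [integral_smul_measure, integral_finsetSum_measure fun i _ => by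
      refine ⟨hsm.aestronglyMeasurable, ?_⟩
      simp [HasFiniteIntegral, lintegral_dirac' _ hsm.measurable.enorm]]
    simp [integral_dirac' _ _ hsm]
  rw [h]
  exact gradient_const_mul_sum _ _ fun _ _ => (hr.differentiable m _) v

theorem integral_noise_finite (hr : P.Regular) {L : ℝ} (hs : P.LSmooth L) {n : ℕ}
    {z : Fin M → Fin n → Z} (hP : P.data = .finite n z) (m : Fin M) {s : ℕ} (h1 : 1 ≤ s)
    (hsn : s ≤ n) (v : Vec d) : ∫ B : Fin s → Z, P.noise m v B ∂(P.data.batchLaw m s) = 0 := by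
  have hmeas : StronglyMeasurable fun B : Fin s → Z => P.noise m v B :=
    (measurable_noise_left hr hs m s v).stronglyMeasurable
  simp only [hP, ClientData.batchLaw]
  rw [integral_smul_measure, integral_finsetSum_measure fun i _ => by
    refine ⟨hmeas.aestronglyMeasurable, ?_⟩
    simp [HasFiniteIntegral, lintegral_dirac' _ hmeas.measurable.enorm]]
  simp only [integral_dirac' _ _ hmeas]
  have hn0 : (n : ℝ) ≠ 0 := by
    have : 0 < n := h1.trans hsn
    exact_mod_cast this.ne'
  have hs0 : (s : ℝ) ≠ 0 := by
    have : 0 < s := h1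
    exact_mod_cast this.ne'
  have key : ∑ e : Fin s ↪ Fin n, P.noise m v (fun j => z m (e j)) = 0 := by
    simp only [noise, batchGrad_eq hr, localGrad_finite hr hP, Finset.sum_sub_distrib,
      ← Finset.smul_sum]
    rw [Finset.sum_comm]
    have h2 : ∀ j : Fin s, ∑ e : Fin s ↪ Fin n, P.sampleGrad m v (z m (e j))
        = (n : ℝ)⁻¹ • (Fintype.card (Fin s ↪ Fin n) : ℝ) • ∑ i, P.sampleGrad m v (z m i) := by
      intro j
      rw [← sum_embedding_apply (fun i => P.sampleGrad m v (z m i)) j, smul_smul,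
        inv_mul_cancel₀ hn0, one_smul]
    simp only [h2, Finset.sum_const, Finset.card_univ, Fintype.card_fin,
      ← Nat.cast_smul_eq_nsmul ℝ, smul_smul]
    rw [← sub_smul]
    convert zero_smul ℝ _
    field_simp
    simp
  rw [key, smul_zero]

theorem isProbabilityMeasure_batchLaw_online {D : Fin M → ProbabilityMeasure Z}
    (hP : P.data = .online D) (m : Fin M) (s : ℕ) :
    IsProbabilityMeasure (P.data.batchLaw m s) := by
  simp only [hP, ClientData.batchLaw]
  infer_instance

/-- Jensen's inequality, read off from the nonnegativity of the variance of `‖X‖`. -/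
theorem norm_sq_integral_le {Ω : Type*} [MeasurableSpace Ω] {μ : Measure Ω}
    [IsProbabilityMeasure μ] {V : Type*} [NormedAddCommGroup V] [NormedSpace ℝ V]
    {X : Ω → V} (hX : MemLp X 2 μ) : ‖∫ ω, X ω ∂μ‖ ^ 2 ≤ msq μ X := by
  have h1 : ‖∫ ω, X ω ∂μ‖ ≤ ∫ ω, ‖X ω‖ ∂μ := norm_integral_le_integral_norm _
  have h2 := variance_nonneg (fun ω => ‖X ω‖) μ
  rw [variance_eq_sub hX.norm] at h2
  have h3 : (∫ ω, ‖X ω‖ ∂μ) ^ 2 ≤ msq μ X := by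
    simpa [msq] using h2
  exact (by gcongr : ‖∫ ω, X ω ∂μ‖ ^ 2 ≤ (∫ ω, ‖X ω‖ ∂μ) ^ 2).trans h3

/-- Exchanging gradient and expectation is not presupposed. The mean of the noise equals that of a
single sample for every batch size, and by Jensen its square is at most `σ²` over the batch size,
which is unbounded for streaming data. -/
theorem integral_noise_online (hr : P.Regular) {L : ℝ} (hs : P.LSmooth L) {σ : ℝ}
    (hσ : P.BoundedNoise σ) {D : Fin M → ProbabilityMeasure Z} (hP : P.data = .online D)
    (m : Fin M) {s : ℕ} (h1 : 1 ≤ s)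
    (v : Vec d) : ∫ B : Fin s → Z, P.noise m v B ∂(P.data.batchLaw m s) = 0 := by
  have hmeas := fun s => measurable_noise_left hr hs m s v
  have hnoise : ∀ s : ℕ, 1 ≤ s →
      ∫⁻ B : Fin s → Z, ‖P.noise m v B‖ₑ ^ 2 ∂(P.data.batchLaw m s)
        ≤ ENNReal.ofReal (σ ^ 2 / s) := by
    intro s hs1
    have hsize : (s : ℕ∞) ≤ P.data.size := by
      rw [hP]
      exact le_top
    exact hσ m s hs1 hsize v
  have hL2 : ∀ s : ℕ, 1 ≤ s →
      MemLp (fun B : Fin s → Z => P.noise m v B) 2 (P.data.batchLaw m s) := fun s hs1 =>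
    memLp_two_of_lintegral (hmeas s).aestronglyMeasurable
      ((hnoise s hs1).trans_lt ENNReal.ofReal_lt_top)
  have hone : ∀ B : Fin 1 → Z, P.noise m v B
      = P.sampleGrad m v (B 0) - gradient (P.localObj m) v := by
    intro B
    simp [noise, batchGrad_eq hr]
  set ρ : Z → Vec d := fun z => P.sampleGrad m v z - gradient (P.localObj m) v with hρ
  have hρm : Measurable ρ := ((measurable_sampleGrad hr m).comp measurable_prodMk_left).sub_const _
  have hlaw : ∀ s : ℕ, P.data.batchLaw m s = Measure.pi fun _ : Fin s => (D m : Measure Z) := by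
    intro s
    simp [hP, ClientData.batchLaw]
  have hev : ∀ (s : ℕ) (j : Fin s), (P.data.batchLaw m s).map (fun B => B j) = (D m : Measure Z) := by
    intro s j
    rw [hlaw]
    exact (measurePreserving_eval (fun _ : Fin s => (D m : Measure Z)) j).map_eq
  have hρint : Integrable ρ (D m : Measure Z) := by
    have := isProbabilityMeasure_batchLaw_online hP m 1
    have h2 : Integrable (fun B : Fin 1 → Z => P.noise m v B) (P.data.batchLaw m 1) :=
      (hL2 1 le_rfl).integrable (by norm_num)
    rw [← hev 1 0]
    rw [integrable_map_measure hρm.aestronglyMeasurable (measurable_pi_apply 0).aemeasurable]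
    refine h2.congr (Filter.Eventually.of_forall fun B => ?_)
    simp [hone, hρ]
  have hmean : ∀ s : ℕ, 1 ≤ s →
      ∫ B : Fin s → Z, P.noise m v B ∂(P.data.batchLaw m s) = ∫ z, ρ z ∂(D m : Measure Z) := by
    intro s hs1
    have hs0 : (s : ℝ) ≠ 0 := by
      have : 0 < s := hs1
      exact_mod_cast this.ne'
    have e1 : ∀ B : Fin s → Z, P.noise m v B = (s : ℝ)⁻¹ • ∑ j, ρ (B j) := by
      intro B
      simp only [noise, batchGrad_eq hr, hρ, Finset.sum_sub_distrib, smul_sub, Finset.sum_const,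
        Finset.card_univ, Fintype.card_fin, ← Nat.cast_smul_eq_nsmul ℝ, smul_smul]
      rw [inv_mul_cancel₀ hs0, one_smul]
    have e2 : ∀ j : Fin s, Integrable (fun B : Fin s → Z => ρ (B j)) (P.data.batchLaw m s) := by
      intro j
      have := hρint
      rw [← hev s j] at this
      exact this.comp_measurable (measurable_pi_apply j)
    have e3 : ∀ j : Fin s, ∫ B : Fin s → Z, ρ (B j) ∂(P.data.batchLaw m s)
        = ∫ z, ρ z ∂(D m : Measure Z) := by
      intro j
      rw [← hev s j, integral_map (measurable_pi_apply j).aemeasurable hρm.aestronglyMeasurable]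
    simp only [e1]
    rw [integral_smul, integral_finsetSum _ fun j _ => e2 j]
    simp only [e3, Finset.sum_const, Finset.card_univ, Fintype.card_fin,
        ← Nat.cast_smul_eq_nsmul ℝ, smul_smul]
    rw [inv_mul_cancel₀ hs0, one_smul]
  rw [hmean s h1]
  have hbias : ∀ n : ℕ, ‖∫ z, ρ z ∂(D m : Measure Z)‖ ^ 2 ≤ σ ^ 2 / ((n : ℝ) + 1) := by
    intro n
    have := isProbabilityMeasure_batchLaw_online hP m (n + 1)
    rw [← hmean (n + 1) (by omega)]
    refine (norm_sq_integral_le (hL2 (n + 1) (by omega))).trans ?_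
    refine msq_le_of_lintegral (hL2 (n + 1) (by omega)) (by positivity) ?_
    simpa using hnoise (n + 1) (by omega)
  have hlim : Filter.Tendsto (fun n : ℕ => σ ^ 2 / ((n : ℝ) + 1)) Filter.atTop (nhds 0) :=
    tendsto_const_div_atTop_nhds_zero_nat (σ ^ 2) |>.comp (Filter.tendsto_add_atTop_nat 1) |>.congr
      fun n => by simp
  have h0 := ge_of_tendsto' hlim hbias
  have h00 : ‖∫ z, ρ z ∂(D m : Measure Z)‖ ^ 2 = 0 := le_antisymm h0 (by positivity)
  simpa using h00

/-- Batch gradients are unbiased. For streaming data this is a consequence of the noise bound: the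
mean of a batch gradient does not depend on the batch size, whereas its bias vanishes when the
batch grows. -/
theorem integral_noise (hr : P.Regular) {L : ℝ} (hs : P.LSmooth L) {σ : ℝ}
    (hσ : P.BoundedNoise σ) (m : Fin M) {s : ℕ} (h1 : 1 ≤ s) (hsn : (s : ℕ∞) ≤ P.data.size)
    (v : Vec d) : ∫ B : Fin s → Z, P.noise m v B ∂(P.data.batchLaw m s) = 0 := by
  rcases hP : P.data with ⟨n, z⟩ | D
  · rw [hP] at hsn
    rw [← hP]
    exact integral_noise_finite hr hs hP m h1 (by simpa [ClientData.size] using hsn) v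
  · rw [← hP]
    exact integral_noise_online hr hs hσ hP m h1 v

/-- A batch that exhausts the data set has no noise. -/
theorem noise_full (hr : P.Regular) {n : ℕ} {z : Fin M → Fin n → Z}
    (hP : P.data = .finite n z) (m : Fin M) (v : Vec d) (e : Fin n ↪ Fin n) :
    P.noise m v (fun j => z m (e j)) = 0 := by
  have he : Function.Bijective e := Finite.injective_iff_bijective.1 e.injective
  rw [noise, batchGrad_eq hr, localGrad_finite hr hP, sub_eq_zero]
  congr 1
  exact Equiv.sum_comp (Equiv.ofBijective e he) fun i => P.sampleGrad m v (z m i)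

/-- The noise of the large batches, whose size is the minimum of `⌈κσ²/(Mε)⌉` and the size of the
data set. -/
theorem exists_cache_noise_bound (hr : P.Regular) {L : ℝ} (hs : P.LSmooth L) {σ ε κ : ℝ}
    (hσ : P.BoundedNoise σ) (hM : 0 < M) (hε : 0 < ε) (hκ : 0 < κ) {b : ℕ} (hb1 : 1 ≤ b)
    (hb : (b : ℕ∞) = min ((⌈κ * σ ^ 2 / (M * ε)⌉₊ : ℕ) : ℕ∞) P.data.size) :
    ∃ ς : ℝ, 0 ≤ ς ∧ ς ≤ M * ε / κ ∧ ∀ (m : Fin M) (v : Vec d),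
      ∫⁻ B : Fin b → Z, ‖P.noise m v B‖ₑ ^ 2 ∂(P.data.batchLaw m b) ≤ ENNReal.ofReal ς := by
  have hM' : (0 : ℝ) < M := by exact_mod_cast hM
  have hb0 : (0 : ℝ) < b := by exact_mod_cast hb1
  rcases le_total ((⌈κ * σ ^ 2 / (M * ε)⌉₊ : ℕ) : ℕ∞) P.data.size with hle | hle
  · rw [min_eq_left hle] at hb
    have hb' : b = ⌈κ * σ ^ 2 / (M * ε)⌉₊ := by exact_mod_cast hb
    refine ⟨σ ^ 2 / b, by positivity, ?_, fun m v => hσ m b hb1 (hb ▸ hle) v⟩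
    have h1 : κ * σ ^ 2 / (M * ε) ≤ b := by
      rw [hb']
      exact Nat.le_ceil _
    rw [div_le_iff₀ (by positivity)] at h1
    rw [div_le_div_iff₀ hb0 hκ]
    linarith
  · rw [min_eq_right hle] at hb
    -- If the data set is the smaller term, the batch exhausts it and the noise vanishes. Streaming
    -- data cannot occur here, as `b` would be infinite.
    rcases hP : P.data with ⟨n, z⟩ | D
    · rw [hP] at hb
      have hbn : b = n := by simpa [ClientData.size] using hb
      subst hbn
      refine ⟨0, le_rfl, by positivity, fun m v => ?_⟩
      have hmeas : Measurable fun B : Fin b → Z => ‖P.noise m v B‖ₑ ^ 2 :=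
        (measurable_noise_left hr hs m b v).enorm.pow_const 2
      simp [ClientData.batchLaw, lintegral_smul_measure, lintegral_finsetSum_measure,
        lintegral_dirac' _ hmeas, noise_full hr hP]
    · rw [hP] at hb
      simp [ClientData.size] at hb

end Problem

/-! ### Fresh draws: conditioning on the past by Fubini. -/

section Freezing

variable {Ω : Type*} [MeasurableSpace Ω] {μ : Measure Ω} [IsProbabilityMeasure μ]
  {E β : Type*} [MeasurableSpace E] [MeasurableSpace β]

/-- The joint law of independent variables is a product, so by Tonelli `X` may be frozen while the
draw is averaged. Noise bounds at deterministic points thus extend to random iterates. -/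
theorem lintegral_of_indepFun {X : Ω → E} {B : Ω → β} (hX : Measurable X) (hB : Measurable B)
    (hXB : IndepFun X B μ) {f : E × β → ℝ≥0∞} (hf : Measurable f) :
    ∫⁻ ω, f (X ω, B ω) ∂μ = ∫⁻ ω, ∫⁻ b, f (X ω, b) ∂(μ.map B) ∂μ := by
  have := Measure.isProbabilityMeasure_map (μ := μ) hX.aemeasurable
  have := Measure.isProbabilityMeasure_map (μ := μ) hB.aemeasurable
  have h1 := (indepFun_iff_map_prod_eq_prod_map_map hX.aemeasurable hB.aemeasurable).1 hXB
  rw [← lintegral_map (f := f) (g := fun ω => (X ω, B ω)) hf (hX.prodMk hB), h1,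
    lintegral_prod _ hf.aemeasurable, lintegral_map hf.lintegral_prod_right' hX]

/-- A centred function of a fresh draw is orthogonal to everything that is independent of it. -/
theorem integral_inner_eq_zero_of_indepFun {d : ℕ} {Y : Ω → Vec d} {X : Ω → E} {B : Ω → β}
    (hY : Measurable Y) (hX : Measurable X) (hB : Measurable B)
    (hind : IndepFun (fun ω => (Y ω, X ω)) B μ) {φ : E → β → Vec d}
    (hφ : Measurable fun p : E × β => φ p.1 p.2)
    (hY2 : MemLp Y 2 μ) (hφ2 : MemLp (fun ω => φ (X ω) (B ω)) 2 μ)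
    (hint : ∀ x, Integrable (φ x) (μ.map B)) (hzero : ∀ x, ∫ b, φ x b ∂(μ.map B) = 0) :
    ∫ ω, inner ℝ (Y ω) (φ (X ω) (B ω)) ∂μ = 0 := by
  have hYX : Measurable fun ω => (Y ω, X ω) := hY.prodMk hX
  have := Measure.isProbabilityMeasure_map (μ := μ) hYX.aemeasurable
  have := Measure.isProbabilityMeasure_map (μ := μ) hB.aemeasurable
  have h1 := (indepFun_iff_map_prod_eq_prod_map_map hYX.aemeasurable hB.aemeasurable).1 hind
  set f : (Vec d × E) × β → ℝ := fun p => inner ℝ p.1.1 (φ p.1.2 p.2) with hf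
  have hfm : Measurable f := by
    have h2 : Measurable fun p : (Vec d × E) × β => φ p.1.2 p.2 :=
      hφ.comp ((measurable_snd.comp measurable_fst).prodMk measurable_snd)
    exact (measurable_fst.comp measurable_fst).inner h2
  have hmap : Measurable fun ω => ((Y ω, X ω), B ω) := hYX.prodMk hB
  have hI : Integrable f (μ.map fun ω => ((Y ω, X ω), B ω)) := by
    rw [integrable_map_measure hfm.aestronglyMeasurable hmap.aemeasurable]
    exact integrable_inner_of_memLp hY2 hφ2
  have h3 : ∫ ω, inner ℝ (Y ω) (φ (X ω) (B ω)) ∂μ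
      = ∫ p, f p ∂(μ.map fun ω => ((Y ω, X ω), B ω)) :=
    (integral_map hmap.aemeasurable hfm.aestronglyMeasurable).symm
  rw [h1] at hI h3
  rw [h3, integral_prod _ hI]
  refine integral_eq_zero_of_ae (Filter.Eventually.of_forall fun p => ?_)
  simp only [hf, Pi.zero_apply]
  rw [integral_inner (hint p.2), hzero, inner_zero_right]

end Freezing

/-! ### The sources of randomness and the law of the participants. -/

namespace Draws

variable {d M : ℕ} {Z : Type*} [MeasurableSpace Z] {P : Problem d M Z} {h : Params d}
  {Ω : Type*} [MeasurableSpace Ω] {μ : Measure Ω} (R : Draws P h μ)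

/-- The events decided by one source of randomness. -/
@[reducible] def sigma : Source M → MeasurableSpace Ω
  | .participants t => MeasurableSpace.comap (R.participants t) ⊤
  | .coin t m => MeasurableSpace.comap (R.coin t m) inferInstance
  | .initBatch m => MeasurableSpace.comap (R.initBatch m) inferInstance
  | .anchorBatch t m => MeasurableSpace.comap (R.anchorBatch t m) inferInstance
  | .minerBatch t m k => MeasurableSpace.comap (R.minerBatch t m k) inferInstance

/-- The events decided by a set of sources. -/
@[reducible] def field (S : Set (Source M)) : MeasurableSpace Ω := ⨆ s ∈ S, R.sigma s

theorem measurable_participants (t : ℕ) : @Measurable _ _ _ ⊤ (R.participants t) := by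
  refine @measurable_to_countable' _ _ ⊤ _ _ _ fun S => ?_
  exact R.participants_meas t S

theorem sigma_le (s : Source M) : R.sigma s ≤ ‹MeasurableSpace Ω› := by
  cases s with
  | participants t => exact (R.measurable_participants t).comap_le
  | coin t m => exact (R.coin_meas t m).comap_le
  | initBatch m => exact (R.initBatch_meas m).comap_le
  | anchorBatch t m => exact (R.anchorBatch_meas t m).comap_le
  | minerBatch t m k => exact (R.minerBatch_meas t m k).comap_le

theorem field_le (S : Set (Source M)) : R.field S ≤ ‹MeasurableSpace Ω› :=
  iSup₂_le fun s _ => R.sigma_le s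

theorem sigma_le_field {S : Set (Source M)} {s : Source M} (hs : s ∈ S) : R.sigma s ≤ R.field S :=
  le_iSup₂_of_le s hs le_rfl

theorem field_mono {S T : Set (Source M)} (hST : S ⊆ T) : R.field S ≤ R.field T :=
  biSup_mono hST

theorem iIndep_sigma : iIndep R.sigma μ := by
  refine (congrArg (fun f => iIndep f μ) (funext fun s => ?_)).mp R.indep
  cases s <;> rfl

/-- The only route by which independence enters: it reduces every such claim to the combinatorial
question whether a source belongs to a set of sources. -/
theorem indepFun_of_notMem {S : Set (Source M)} {s : Source M} (hs : s ∉ S)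
    {E β : Type*} [MeasurableSpace E] {mβ : MeasurableSpace β} {X : Ω → E} {B : Ω → β}
    (hX : Measurable[R.field S] X) (hB : Measurable[R.sigma s] B) : IndepFun X B μ := by
  have h1 : Indep (R.field S) (⨆ i ∈ ({s} : Set (Source M)), R.sigma i) μ :=
    indep_iSup_of_disjoint R.sigma_le R.iIndep_sigma (Set.disjoint_singleton_right.2 hs)
  rw [iSup_singleton] at h1
  rw [IndepFun_iff_Indep]
  exact indep_of_indep_of_le_left (indep_of_indep_of_le_right h1 hB.comap_le) hX.comap_le

theorem measurable_sigma_participants (t : ℕ) {β : Type*} [MeasurableSpace β]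
    (w : Finset (Fin M) → β) :
    Measurable[R.sigma (.participants t)] fun ω => w (R.participants t ω) := by
  have h1 : @Measurable _ _ (R.sigma (.participants t)) ⊤ (R.participants t) :=
    comap_measurable _
  have h2 : @Measurable _ _ ⊤ _ w := measurable_from_top
  exact h2.comp h1

theorem measurable_comp_participants (t : ℕ) {β : Type*} [MeasurableSpace β]
    (w : Finset (Fin M) → β) : Measurable fun ω => w (R.participants t ω) :=
  (R.measurable_sigma_participants t w).mono (R.sigma_le _) le_rfl

theorem integral_comp_participants [IsFiniteMeasure μ] (t : ℕ) (w : Finset (Fin M) → ℝ) :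
    ∫ ω, w (R.participants t ω) ∂μ
      = (M.choose h.A : ℝ)⁻¹ * ∑ S ∈ Finset.univ.powersetCard h.A, w S := by
  have h1 : ∀ ω, w (R.participants t ω)
      = ∑ S, Set.indicator {ω | R.participants t ω = S} (fun _ => w S) ω := by
    intro ω
    simp [Set.indicator_apply]
  simp only [h1]
  rw [integral_finsetSum _ fun S _ =>
    (integrable_const (w S)).indicator (R.participants_meas t S)]
  simp only [integral_indicator (R.participants_meas t _), setIntegral_const, Measure.real,
    R.participants_law, smul_eq_mul]
  have h2 : (Finset.univ : Finset (Fin M)).powersetCard h.A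
      = Finset.univ.filter fun S => S.card = h.A := by
    ext S
    simp [Finset.mem_powersetCard]
  rw [h2, Finset.sum_filter, Finset.mul_sum]
  refine Finset.sum_congr rfl fun S _ => ?_
  split_ifs <;> simp

/-- The participants of a round are independent of everything decided by other sources. -/
theorem integral_mul_participants [IsProbabilityMeasure μ] {S : Set (Source M)} {t : ℕ}
    (ht : .participants t ∉ S) {Y : Ω → ℝ} (hY : Measurable[R.field S] Y)
    (w : Finset (Fin M) → ℝ) :
    ∫ ω, Y ω * w (R.participants t ω) ∂μ = (∫ ω, Y ω ∂μ) * ∫ ω, w (R.participants t ω) ∂μ :=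
  (R.indepFun_of_notMem ht hY
    (R.measurable_sigma_participants t w)).integral_fun_mul_eq_mul_integral
      (hY.mono (R.field_le S) le_rfl).aestronglyMeasurable
      (R.measurable_comp_participants t w).aestronglyMeasurable

/-- The indicator of the event that a client does not participate. -/
noncomputable def absent (m : Fin M) (S : Finset (Fin M)) : ℝ := if m ∈ S then 0 else 1

theorem absent_nonneg (m : Fin M) (S : Finset (Fin M)) : 0 ≤ absent m S := by
  unfold absent
  split_ifs <;> norm_num

theorem absent_mul_self (m : Fin M) (S : Finset (Fin M)) : absent m S * absent m S = absent m S := by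
  unfold absent
  split_ifs <;> norm_num

theorem sum_powersetCard_avoiding (A : ℕ) (T : Finset (Fin M)) :
    ∑ S ∈ (Finset.univ : Finset (Fin M)).powersetCard A, (if Disjoint T S then (1 : ℝ) else 0)
      = (M - T.card).choose A := by
  rw [Finset.sum_boole]
  congr 1
  have h1 : ((Finset.univ : Finset (Fin M)).powersetCard A).filter (fun S => Disjoint T S)
      = Tᶜ.powersetCard A := by
    ext S
    simp only [Finset.mem_filter, Finset.mem_powersetCard, Finset.subset_univ, true_and]
    rw [disjoint_comm, ← Finset.subset_compl_iff_disjoint_right]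
    tauto
  rw [h1, Finset.card_powersetCard, Finset.card_compl, Fintype.card_fin]

/-- Applied with `M` and with `M - 1`, it yields the probabilities that one or two given clients are
missing from a uniform `A`-subset. -/
theorem choose_pred_mul {M A : ℕ} (hM : 1 ≤ M) :
    ((M - 1).choose A : ℝ) * M = (M.choose A : ℝ) * ((M - A : ℕ) : ℝ) := by
  obtain ⟨n, rfl⟩ : ∃ n, M = n + 1 := ⟨M - 1, by omega⟩
  have := Nat.choose_mul_succ_eq n A
  exact_mod_cast this

theorem integral_absent [IsProbabilityMeasure μ] (hA : 1 ≤ h.A) (hAM : h.A ≤ M) (t : ℕ)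
    (m : Fin M) : ∫ ω, absent m (R.participants t ω) ∂μ = 1 - (h.A : ℝ) / M := by
  rw [R.integral_comp_participants]
  have h1 : ∀ S, absent m S = if Disjoint {m} S then (1 : ℝ) else 0 := by
    intro S
    simp [absent, Finset.disjoint_singleton_left]
  simp only [h1]
  rw [sum_powersetCard_avoiding, Finset.card_singleton]
  have hM : 1 ≤ M := hA.trans hAM
  have hM' : (0 : ℝ) < M := by exact_mod_cast hM
  have hc : (0 : ℝ) < M.choose h.A := by exact_mod_cast Nat.choose_pos hAM
  have h2 := choose_pred_mul (A := h.A) hM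
  rw [Nat.cast_sub hAM] at h2
  field_simp
  linarith

/-- Sampling without replacement makes absences negatively correlated: the pair probability is
`(M-A)(M-1-A) / (M(M-1))`, and `(M-1-A)/(M-1) ≤ (M-A)/M`. -/
theorem integral_absent_mul_absent_le [IsProbabilityMeasure μ] (hA : 1 ≤ h.A) (hAM : h.A ≤ M)
    (t : ℕ) {m m' : Fin M} (hmm : m ≠ m') :
    ∫ ω, absent m (R.participants t ω) * absent m' (R.participants t ω) ∂μ
      ≤ (1 - (h.A : ℝ) / M) ^ 2 := by
  rw [R.integral_comp_participants t fun S => absent m S * absent m' S]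
  have h1 : ∀ S, absent m S * absent m' S = if Disjoint {m, m'} S then (1 : ℝ) else 0 := by
    intro S
    by_cases h1 : m ∈ S <;> by_cases h2 : m' ∈ S <;>
      simp [absent, Finset.disjoint_insert_left, Finset.disjoint_singleton_left, h1, h2]
  simp only [h1]
  rw [sum_powersetCard_avoiding, Finset.card_pair hmm]
  have hM : 1 < M := by
    have := m.2
    have := m'.2
    have := Fin.val_ne_of_ne hmm
    omega
  have hM' : (1 : ℝ) < M := by exact_mod_cast hM
  have hc : (0 : ℝ) < M.choose h.A := by exact_mod_cast Nat.choose_pos hAM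
  have h2 := choose_pred_mul (A := h.A) hM.le
  have h3 := choose_pred_mul (M := M - 1) (A := h.A) (by omega)
  rw [Nat.cast_sub hAM] at h2
  have e : M - 1 - 1 = M - 2 := by omega
  rw [e, Nat.cast_sub hM.le] at h3
  have hA' : (h.A : ℝ) ≤ M := by exact_mod_cast hAM
  have hA1 : (1 : ℝ) ≤ h.A := by exact_mod_cast hA
  rw [inv_mul_le_iff₀ hc]
  have hM1 : (0 : ℝ) < (M : ℝ) - 1 := by linarith
  have hq : 1 - (h.A : ℝ) / M = (M - h.A) / M := by
    field_simp
  rw [hq]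
  -- Full participation is separate because `M - 1 - A` is truncated subtraction there; nobody is
  -- then absent.
  rcases hAM.eq_or_lt with heq | hlt
  · have : (M - 2).choose h.A = 0 := Nat.choose_eq_zero_of_lt (by omega)
    rw [this]
    push_cast
    positivity
  · rw [Nat.cast_sub (by omega), Nat.cast_sub hM.le] at h3
    push_cast at h3
    have hx : ((M - 2).choose h.A : ℝ)
        = (M.choose h.A : ℝ) * ((M - h.A) * (M - 1 - h.A) / (M * (M - 1))) := by
      have h4 : ((M - 1).choose h.A : ℝ) = (M.choose h.A : ℝ) * (M - h.A) / M := by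
        rw [eq_div_iff (by positivity)]
        exact h2
      rw [h4] at h3
      rw [mul_div_assoc', eq_div_iff (by positivity)]
      field_simp at h3
      linarith
    rw [hx]
    gcongr
    rw [div_pow, div_le_div_iff₀ (by positivity) (by positivity)]
    have h5 : (M : ℝ) * (M - 1 - h.A) ≤ (M - h.A) * (M - 1) := by nlinarith
    have h6 : (0 : ℝ) ≤ (M - h.A) * M := mul_nonneg (by linarith) (by linarith)
    nlinarith [mul_le_mul_of_nonneg_left h5 h6]

end Draws

/-! ### The cyclic process: recursions, measurability with respect to the past, square
integrability, local noise. -/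

/-- The standing assumptions of the convergence analysis. The number `ς` bounds the noise of the
caching gradients. -/
structure Setting {d M : ℕ} {Z : Type*} [MeasurableSpace Z] (P : Problem d M Z) (h : Params d)
    (L σ Lσ ς : ℝ) : Prop where
  regular : P.Regular
  smooth : P.LSmooth L
  noise : P.BoundedNoise σ
  averageSmooth : P.AverageSmooth Lσ
  L_pos : 0 < L
  one_le_A : 1 ≤ h.A
  A_le : h.A ≤ M
  one_le_K : 1 ≤ h.K
  one_le_b : 1 ≤ h.b
  b_le : (h.b : ℕ∞) ≤ P.data.size
  one_le_b' : 1 ≤ h.b'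
  b'_le : (h.b' : ℕ∞) ≤ P.data.size
  cacheNoise_nonneg : 0 ≤ ς
  cacheNoise : ∀ (m : Fin M) (v : Vec d),
    ∫⁻ B : Fin h.b → Z, ‖P.noise m v B‖ₑ ^ 2 ∂(P.data.batchLaw m h.b) ≤ ENNReal.ofReal ς
  ηl_smooth : 24 * h.ηl ^ 2 * L ^ 2 * (h.K : ℝ) ^ 2 ≤ 1
  ηl_noise : 48 * (Lσ ^ 2 / h.b') * h.ηl ^ 2 * h.K ≤ 1

/-- The last round before which the outcome of a source can matter, plus one. -/
def Source.time {M : ℕ} : Source M → ℕ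
  | .participants t => t + 1
  | .coin t _ => t + 1
  | .initBatch _ => 0
  | .anchorBatch t _ => t + 1
  | .minerBatch t _ _ => t + 1

/-- The sources that are used before round `t`. -/
def past {M : ℕ} (t : ℕ) : Set (Source M) := {s | s.time ≤ t}

/-- The sources that are used before the local iteration `k` of miner `i` in round `t`. -/
def localPast {M : ℕ} (t : ℕ) (i : Fin M) (k : ℕ) : Set (Source M) :=
  past t ∪ {s | ∃ j < k, s = .minerBatch t i j}

theorem past_mono {M : ℕ} {s t : ℕ} (hst : s ≤ t) : (past s : Set (Source M)) ⊆ past t :=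
  fun _ hx => Nat.le_trans (m := s) hx hst

theorem localPast_mono {M : ℕ} (t : ℕ) (i : Fin M) {k l : ℕ} (hkl : k ≤ l) :
    localPast t i k ⊆ localPast t i l :=
  Set.union_subset_union_right _ fun _ ⟨j, hj, hs⟩ => ⟨j, hj.trans_le hkl, hs⟩

/-- The server model, the caching gradients and the points at which these were computed. -/
structure Run (d M : ℕ) where
  x : Vec d
  cache : Fin M → Vec d
  anchor : Fin M → Vec d

namespace Draws

variable {d M : ℕ} {Z : Type*} [MeasurableSpace Z] {P : Problem d M Z} {h : Params d}
  {Ω : Type*} [MeasurableSpace Ω] {μ : Measure Ω} (R : Draws P h μ)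

/-- The algorithm in which all participants of the rounds divisible by `τ` are anchors, and all
participants of the other rounds are miners. -/
noncomputable def run (τ : ℕ) (ω : Ω) : ℕ → Run d M
  | 0 =>
    { x := h.x₀
      cache := fun m => P.batchGrad m (R.initBatch m ω) h.x₀
      anchor := fun _ => h.x₀ }
  | t + 1 =>
    let r := run τ ω t
    if t % τ = 0 then
      { x := r.x
        cache := fun i =>
          if i ∈ R.participants t ω then P.batchGrad i (R.anchorBatch t i ω) r.x else r.cache i
        anchor := fun i => if i ∈ R.participants t ω then r.x else r.anchor i }
    else
      { x := r.x - (h.ηs / h.A) • ∑ i ∈ R.participants t ω,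
          (r.x - (R.miner ω t i r.x ((M : ℝ)⁻¹ • ∑ m, r.cache m) h.K).cur)
        cache := r.cache
        anchor := r.anchor }

noncomputable def model (τ t : ℕ) (ω : Ω) : Vec d := (R.run τ ω t).x

noncomputable def cache (τ t : ℕ) (m : Fin M) (ω : Ω) : Vec d := (R.run τ ω t).cache m

noncomputable def anchorPt (τ t : ℕ) (m : Fin M) (ω : Ω) : Vec d := (R.run τ ω t).anchor m

/-- The averaged caching gradient. -/
noncomputable def cacheMean (τ t : ℕ) (ω : Ω) : Vec d := (M : ℝ)⁻¹ • ∑ m, R.cache τ t m ω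

/-- The local iterations of client `i` in round `t`. -/
noncomputable def localState (τ t : ℕ) (i : Fin M) (k : ℕ) (ω : Ω) : MinerState d :=
  R.miner ω t i (R.model τ t ω) (R.cacheMean τ t ω) k

/-- The effect of sampling on the local iteration `k`. -/
noncomputable def localNoise (τ t : ℕ) (i : Fin M) (k : ℕ) (ω : Ω) : Vec d :=
  P.noise i (R.localState τ t i k ω).cur (R.minerBatch t i k ω)
    - P.noise i (R.localState τ t i k ω).prev (R.minerBatch t i k ω)

variable {τ t : ℕ}

/-- A sum over the random set becomes a sum over all clients with random weights, to which
linearity, measurability and independence apply termwise. -/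
theorem sum_participants {V : Type*} [AddCommGroup V] [Module ℝ V] (S : Finset (Fin M))
    (y : Fin M → V) : ∑ i ∈ S, y i = ∑ i, (1 - absent i S) • y i := by
  have h1 : ∀ i, (1 - absent i S) • y i = if i ∈ S then y i else 0 := by
    intro i
    unfold absent
    split_ifs <;> simp
  simp only [h1]
  simp

theorem cache_zero (m : Fin M) (ω : Ω) :
    R.cache τ 0 m ω = P.batchGrad m (R.initBatch m ω) h.x₀ := rfl

theorem model_succ_anchor (ht : t % τ = 0) (ω : Ω) : R.model τ (t + 1) ω = R.model τ t ω := by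
  simp [model, run, ht]

theorem cache_succ_anchor (ht : t % τ = 0) (i : Fin M) (ω : Ω) : R.cache τ (t + 1) i ω =
    (1 - absent i (R.participants t ω)) • P.batchGrad i (R.anchorBatch t i ω) (R.model τ t ω)
      + absent i (R.participants t ω) • R.cache τ t i ω := by
  simp only [cache, model, run, ht, if_true, absent]
  split_ifs <;> simp

theorem anchorPt_succ_anchor (ht : t % τ = 0) (i : Fin M) (ω : Ω) : R.anchorPt τ (t + 1) i ω =
    (1 - absent i (R.participants t ω)) • R.model τ t ω
      + absent i (R.participants t ω) • R.anchorPt τ t i ω := by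
  simp only [anchorPt, model, run, ht, if_true, absent]
  split_ifs <;> simp

theorem model_succ_miner (ht : t % τ ≠ 0) (ω : Ω) : R.model τ (t + 1) ω = R.model τ t ω -
    (h.ηs / h.A) • ∑ i, (1 - absent i (R.participants t ω)) •
      (R.model τ t ω - (R.localState τ t i h.K ω).cur) := by
  rw [← sum_participants]
  simp [model, run, ht, localState, cacheMean, cache]

theorem cache_succ_miner (ht : t % τ ≠ 0) (i : Fin M) (ω : Ω) :
    R.cache τ (t + 1) i ω = R.cache τ t i ω := by
  simp [cache, run, ht]

theorem anchorPt_succ_miner (ht : t % τ ≠ 0) (i : Fin M) (ω : Ω) :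
    R.anchorPt τ (t + 1) i ω = R.anchorPt τ t i ω := by
  simp [anchorPt, run, ht]

theorem measurable_initBatch_past (t : ℕ) (m : Fin M) :
    Measurable[R.field (past t)] (R.initBatch m) :=
  (comap_measurable (R.initBatch m)).mono
    (R.sigma_le_field (s := .initBatch m) (Nat.zero_le t)) le_rfl

theorem measurable_anchorBatch_field {S : Set (Source M)} {t : ℕ} {m : Fin M}
    (hS : .anchorBatch t m ∈ S) : Measurable[R.field S] (R.anchorBatch t m) :=
  (comap_measurable (R.anchorBatch t m)).mono (R.sigma_le_field hS) le_rfl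

theorem measurable_minerBatch_field {S : Set (Source M)} {t : ℕ} {m : Fin M} {k : ℕ}
    (hS : .minerBatch t m k ∈ S) : Measurable[R.field S] (R.minerBatch t m k) :=
  (comap_measurable (R.minerBatch t m k)).mono (R.sigma_le_field hS) le_rfl

theorem measurable_participants_field {S : Set (Source M)} {t : ℕ}
    (hS : .participants t ∈ S) {β : Type*} [MeasurableSpace β] (w : Finset (Fin M) → β) :
    Measurable[R.field S] fun ω => w (R.participants t ω) :=
  (R.measurable_sigma_participants t w).mono (R.sigma_le_field hS) le_rfl

theorem measurable_miner (hr : P.Regular) {S : Set (Source M)} {t : ℕ} {i : Fin M}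
    {x g : Ω → Vec d} (hx : Measurable[R.field S] x) (hg : Measurable[R.field S] g) {k : ℕ}
    (hB : ∀ j < k, .minerBatch t i j ∈ S) :
    Measurable[R.field S] (fun ω => (R.miner ω t i (x ω) (g ω) k).prev) ∧
    Measurable[R.field S] (fun ω => (R.miner ω t i (x ω) (g ω) k).cur) ∧
    Measurable[R.field S] (fun ω => (R.miner ω t i (x ω) (g ω) k).dir) := by
  induction k with
  | zero => exact ⟨hx, hx, hg⟩
  | succ k ih =>
    obtain ⟨h1, h2, h3⟩ := ih fun j hj => hB j (hj.trans (Nat.lt_succ_self k))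
    have hBk := R.measurable_minerBatch_field (hB k (Nat.lt_succ_self k))
    have h4 : Measurable[R.field S] fun ω => (R.miner ω t i (x ω) (g ω) (k + 1)).dir := by
      have h5 := (h3.sub (Problem.measurable_batchGrad_comp hr i h1 hBk)).add
        (Problem.measurable_batchGrad_comp hr i h2 hBk)
      exact h5
    have h6 : Measurable[R.field S] fun ω => (R.miner ω t i (x ω) (g ω) (k + 1)).cur := by
      have h7 := h2.sub (h4.const_smul h.ηl)
      exact h7
    exact ⟨h2, h6, h4⟩

theorem measurable_run (hr : P.Regular) (τ t : ℕ) :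
    Measurable[R.field (past t)] (R.model τ t) ∧
    (∀ m, Measurable[R.field (past t)] (R.cache τ t m)) ∧
    (∀ m, Measurable[R.field (past t)] (R.anchorPt τ t m)) := by
  induction t with
  | zero =>
    refine ⟨measurable_const, fun m => ?_, fun m => measurable_const⟩
    rw [funext (R.cache_zero (τ := τ) m)]
    exact Problem.measurable_batchGrad_comp hr m measurable_const (R.measurable_initBatch_past 0 m)
  | succ t ih =>
    obtain ⟨h1, h2, h3⟩ := ih
    have hle : R.field (past t) ≤ R.field (past (t + 1)) := R.field_mono (past_mono (Nat.le_succ t))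
    have h1' := h1.mono hle le_rfl
    have h2' := fun m => (h2 m).mono hle le_rfl
    have h3' := fun m => (h3 m).mono hle le_rfl
    have hS : ∀ i : Fin M, Measurable[R.field (past (t + 1))]
        fun ω => absent i (R.participants t ω) := fun i =>
      R.measurable_participants_field (S := past (t + 1)) (t := t)
        (show t + 1 ≤ t + 1 from le_rfl) (absent i)
    have hS' : ∀ i : Fin M, Measurable[R.field (past (t + 1))]
        fun ω => 1 - absent i (R.participants t ω) := fun i => measurable_const.sub (hS i)
    by_cases ht : t % τ = 0
    · refine ⟨?_, fun m => ?_, fun m => ?_⟩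
      · rwa [funext (R.model_succ_anchor ht)]
      · rw [funext (R.cache_succ_anchor ht m)]
        have hB : Measurable[R.field (past (t + 1))] (R.anchorBatch t m) :=
          R.measurable_anchorBatch_field (S := past (t + 1)) (show t + 1 ≤ t + 1 from le_rfl)
        have hb := Problem.measurable_batchGrad_comp hr m h1' hB
        exact ((hS' m).smul hb).add ((hS m).smul (h2' m))
      · rw [funext (R.anchorPt_succ_anchor ht m)]
        exact ((hS' m).smul h1').add ((hS m).smul (h3' m))
    · refine ⟨?_, fun m => ?_, fun m => ?_⟩
      · rw [funext (R.model_succ_miner ht)]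
        have hg : Measurable[R.field (past (t + 1))] (R.cacheMean τ t) :=
          (Finset.measurable_fun_sum Finset.univ fun m _ => h2' m).const_smul (M : ℝ)⁻¹
        have hend : ∀ i, Measurable[R.field (past (t + 1))]
            fun ω => (R.localState τ t i h.K ω).cur := fun i =>
          (R.measurable_miner hr h1' hg fun j _ => show t + 1 ≤ t + 1 from le_rfl).2.1
        have hsum := Finset.measurable_fun_sum Finset.univ fun i _ =>
          (hS' i).smul (h1'.sub (hend i))
        exact h1'.sub (hsum.const_smul (h.ηs / h.A))
      · rw [funext (R.cache_succ_miner ht m)]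
        exact h2' m
      · rw [funext (R.anchorPt_succ_miner ht m)]
        exact h3' m

theorem measurable_cacheMean (hr : P.Regular) (τ t : ℕ) :
    Measurable[R.field (past t)] (R.cacheMean τ t) :=
  (Finset.measurable_fun_sum Finset.univ fun m _ => (R.measurable_run hr τ t).2.1 m).const_smul
    (M : ℝ)⁻¹

theorem measurable_localState (hr : P.Regular) (τ t : ℕ) (i : Fin M) (k : ℕ) :
    Measurable[R.field (localPast t i k)] (fun ω => (R.localState τ t i k ω).prev) ∧
    Measurable[R.field (localPast t i k)] (fun ω => (R.localState τ t i k ω).cur) ∧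
    Measurable[R.field (localPast t i k)] (fun ω => (R.localState τ t i k ω).dir) := by
  have hle : R.field (past t) ≤ R.field (localPast t i k) := R.field_mono Set.subset_union_left
  exact R.measurable_miner hr ((R.measurable_run hr τ t).1.mono hle le_rfl)
    ((R.measurable_cacheMean hr τ t).mono hle le_rfl) fun j hj =>
      Or.inr ⟨j, hj, rfl⟩

theorem measurable_localNoise (hr : P.Regular) {L : ℝ} (hs : P.LSmooth L) (τ t : ℕ) (i : Fin M)
    (k : ℕ) : Measurable[R.field (localPast t i (k + 1))] (R.localNoise τ t i k) := by
  have hle : R.field (localPast t i k) ≤ R.field (localPast t i (k + 1)) :=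
    R.field_mono (localPast_mono t i (Nat.le_succ k))
  obtain ⟨h1, h2, -⟩ := R.measurable_localState hr τ t i k
  have hB : Measurable[R.field (localPast t i (k + 1))] (R.minerBatch t i k) :=
    R.measurable_minerBatch_field (S := localPast t i (k + 1))
      (Or.inr ⟨k, Nat.lt_succ_self k, rfl⟩)
  exact (Problem.measurable_noise_comp hr hs i (h2.mono hle le_rfl) hB).sub
    (Problem.measurable_noise_comp hr hs i (h1.mono hle le_rfl) hB)

theorem measurable_of_field {S : Set (Source M)} {E : Type*} [MeasurableSpace E] {X : Ω → E}
    (hX : Measurable[R.field S] X) : Measurable X := hX.mono (R.field_le S) le_rfl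

theorem notMem_past_participants (t : ℕ) : (.participants t : Source M) ∉ past t :=
  fun hx => absurd (show t + 1 ≤ t from hx) (by omega)

theorem notMem_past_anchorBatch (t : ℕ) (i : Fin M) : (.anchorBatch t i : Source M) ∉ past t :=
  fun hx => absurd (show t + 1 ≤ t from hx) (by omega)

theorem notMem_localPast_minerBatch (t : ℕ) (i : Fin M) (k : ℕ) :
    (.minerBatch t i k : Source M) ∉ localPast t i k := by
  rintro (hx | ⟨j, hj, hx⟩)
  · exact absurd (show t + 1 ≤ t from hx) (by omega)
  · cases hx
    exact lt_irrefl _ hj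

theorem notMem_localPast_participants (t : ℕ) (i : Fin M) (k : ℕ) :
    (.participants t : Source M) ∉ localPast t i k := by
  rintro (hx | ⟨j, hj, hx⟩)
  · exact absurd (show t + 1 ≤ t from hx) (by omega)
  · cases hx

/-- The two batch gradients use the same batch, so the update is the exact change of the local
gradient plus a difference of noises. Without noise the direction would track `∇F_i` along the local
path up to a constant offset. -/
theorem localState_dir_succ (i : Fin M) (k : ℕ) (ω : Ω) :
    (R.localState τ t i (k + 1) ω).dir = (R.localState τ t i k ω).dir +
      (gradient (P.localObj i) (R.localState τ t i k ω).cur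
        - gradient (P.localObj i) (R.localState τ t i k ω).prev) + R.localNoise τ t i k ω := by
  simp only [localNoise, Problem.noise]
  change (R.localState τ t i k ω).dir
    - P.batchGrad i (R.minerBatch t i k ω) (R.localState τ t i k ω).prev
    + P.batchGrad i (R.minerBatch t i k ω) (R.localState τ t i k ω).cur = _
  abel

theorem localState_cur_succ (i : Fin M) (k : ℕ) (ω : Ω) :
    (R.localState τ t i (k + 1) ω).cur
      = (R.localState τ t i k ω).cur - h.ηl • (R.localState τ t i (k + 1) ω).dir := rfl

theorem localState_prev_succ (i : Fin M) (k : ℕ) (ω : Ω) :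
    (R.localState τ t i (k + 1) ω).prev = (R.localState τ t i k ω).cur := rfl

theorem memLp_absent_smul {X : Ω → Vec d} (hX : MemLp X 2 μ) (t : ℕ) (i : Fin M) :
    MemLp (fun ω => absent i (R.participants t ω) • X ω) 2 μ := by
  refine hX.of_le ((R.measurable_comp_participants t (absent i)).aestronglyMeasurable.smul hX.1)
    (Filter.Eventually.of_forall fun ω => ?_)
  unfold absent
  split_ifs <;> simp

theorem memLp_present_smul {X : Ω → Vec d} (hX : MemLp X 2 μ) (t : ℕ) (i : Fin M) :
    MemLp (fun ω => (1 - absent i (R.participants t ω)) • X ω) 2 μ := by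
  have h1 := hX.sub (R.memLp_absent_smul hX t i)
  simp only [Pi.sub_def] at h1
  simpa only [sub_smul, one_smul] using h1

section MeanSquares

variable [IsProbabilityMeasure μ] {L σ Lσ ς : ℝ}

theorem memLp_localGrad (hs : P.LSmooth L) (m : Fin M) {X : Ω → Vec d} (hX : MemLp X 2 μ) :
    MemLp (fun ω => gradient (P.localObj m) (X ω)) 2 μ := by
  have h1 : MemLp (fun ω => gradient (P.localObj m) (X ω) - gradient (P.localObj m) 0) 2 μ := by
    refine (hX.const_smul L).of_le
      (((Problem.continuous_localGrad hs m).comp_aestronglyMeasurable hX.1).sub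
        aestronglyMeasurable_const) (Filter.Eventually.of_forall fun ω => ?_)
    refine (hs.lipschitz m (X ω) 0).trans ?_
    rw [sub_zero, Pi.smul_apply, norm_smul]
    gcongr
    exact Real.le_norm_self L
  have h2 := h1.add (memLp_const (gradient (P.localObj m) 0))
  simp only [Pi.add_def, sub_add_cancel] at h2
  exact h2

/-- The noise of a large batch at a point that is independent of the batch. -/
theorem cacheNoise_bound (hS : Setting P h L σ Lσ ς) {X : Ω → Vec d} {m : Fin M}
    {B : Ω → (Fin h.b → Z)} (hX : Measurable X) (hB : Measurable B) (hXB : IndepFun X B μ)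
    (hlaw : μ.map B = P.data.batchLaw m h.b) :
    MemLp (fun ω => P.noise m (X ω) (B ω)) 2 μ ∧
      msq μ (fun ω => P.noise m (X ω) (B ω)) ≤ ς := by
  have hn := Problem.measurable_noise hS.regular hS.smooth m h.b
  have hle : ∫⁻ ω, ‖P.noise m (X ω) (B ω)‖ₑ ^ 2 ∂μ ≤ ENNReal.ofReal ς := by
    rw [lintegral_of_indepFun (f := fun p => ‖P.noise m p.1 p.2‖ₑ ^ 2) hX hB hXB
      (hn.enorm.pow_const 2), hlaw]
    calc _ ≤ ∫⁻ _ω, ENNReal.ofReal ς ∂μ := lintegral_mono fun ω => hS.cacheNoise m (X ω)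
      _ = _ := by simp
  have hL2 : MemLp (fun ω => P.noise m (X ω) (B ω)) 2 μ :=
    memLp_two_of_lintegral
      (Problem.measurable_noise_comp hS.regular hS.smooth m hX hB).aestronglyMeasurable
      (hle.trans_lt ENNReal.ofReal_lt_top)
  exact ⟨hL2, msq_le_of_lintegral hL2 hS.cacheNoise_nonneg hle⟩

/-- Average smoothness, applied with both iterates frozen: they depend only on sources in `localPast
t i k`, which does not contain the current batch. The noise is therefore proportional to the last
local step. -/
theorem localNoise_bound (hS : Setting P h L σ Lσ ς) (i : Fin M) (k : ℕ)
    (hdiff : MemLp (fun ω => (R.localState τ t i k ω).cur - (R.localState τ t i k ω).prev) 2 μ) :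
    MemLp (R.localNoise τ t i k) 2 μ ∧
      msq μ (R.localNoise τ t i k) ≤ Lσ ^ 2 / h.b' *
        msq μ (fun ω => (R.localState τ t i k ω).cur - (R.localState τ t i k ω).prev) := by
  obtain ⟨h1, h2, -⟩ := R.measurable_localState hS.regular τ t i k
  have hX := h2.prodMk h1
  have hle : ∫⁻ ω, ‖R.localNoise τ t i k ω‖ₑ ^ 2 ∂μ ≤ ENNReal.ofReal (Lσ ^ 2 / h.b' *
        msq μ (fun ω => (R.localState τ t i k ω).cur - (R.localState τ t i k ω).prev)) := by
    have hf : Measurable fun p : (Vec d × Vec d) × (Fin h.b' → Z) =>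
        ‖P.noise i p.1.1 p.2 - P.noise i p.1.2 p.2‖ₑ ^ 2 :=
      ((Problem.measurable_noise_comp hS.regular hS.smooth i
        (measurable_fst.comp measurable_fst) measurable_snd).sub
        (Problem.measurable_noise_comp hS.regular hS.smooth i
          (measurable_snd.comp measurable_fst) measurable_snd)).enorm.pow_const 2
    have e := lintegral_of_indepFun (R.measurable_of_field hX) (R.minerBatch_meas t i k)
      (R.indepFun_of_notMem (notMem_localPast_minerBatch t i k) hX (comap_measurable _)) hf
    refine le_of_eq_of_le e ?_
    rw [R.minerBatch_law, ENNReal.ofReal_mul (by positivity), ofReal_msq hdiff,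
      ← lintegral_const_mul' _ _ ENNReal.ofReal_ne_top]
    refine lintegral_mono fun ω => ?_
    have e2 := hS.averageSmooth i h.b' hS.one_le_b' hS.b'_le (R.localState τ t i k ω).cur
      (R.localState τ t i k ω).prev
    rw [ENNReal.ofReal_mul (by positivity), ENNReal.ofReal_pow (norm_nonneg _), ofReal_norm] at e2
    refine le_of_eq_of_le (lintegral_congr fun B => ?_) e2
    simp only [Problem.noise]
    congr 2
    abel
  have hL2 : MemLp (R.localNoise τ t i k) 2 μ :=
    memLp_two_of_lintegral (R.measurable_of_field
      (R.measurable_localNoise hS.regular hS.smooth τ t i k)).aestronglyMeasurable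
      (hle.trans_lt ENNReal.ofReal_lt_top)
  exact ⟨hL2, msq_le_of_lintegral hL2 (mul_nonneg (by positivity) (msq_nonneg _)) hle⟩

theorem memLp_localState (hS : Setting P h L σ Lσ ς) (hx : MemLp (R.model τ t) 2 μ)
    (hg : MemLp (R.cacheMean τ t) 2 μ) (i : Fin M) (k : ℕ) :
    MemLp (fun ω => (R.localState τ t i k ω).prev) 2 μ ∧
    MemLp (fun ω => (R.localState τ t i k ω).cur) 2 μ ∧
    MemLp (fun ω => (R.localState τ t i k ω).dir) 2 μ := by
  induction k with
  | zero => exact ⟨hx, hx, hg⟩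
  | succ k ih =>
    obtain ⟨h1, h2, h3⟩ := ih
    have h4 : MemLp (fun ω => (R.localState τ t i (k + 1) ω).dir) 2 μ := by
      simp only [localState_dir_succ]
      exact (h3.add ((memLp_localGrad hS.smooth i h2).sub (memLp_localGrad hS.smooth i h1))).add
        (R.localNoise_bound hS i k (h2.sub h1)).1
    exact ⟨h2, h2.sub (h4.const_smul h.ηl), h4⟩

/-- The noises are martingale differences: given the iterates, the current batch is fresh and
unbiased at both of them. -/
theorem integral_inner_localNoise (hS : Setting P h L σ Lσ ς) (i : Fin M) (k : ℕ) {Y : Ω → Vec d}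
    (hY : Measurable[R.field (localPast t i k)] Y) (hY2 : MemLp Y 2 μ)
    (hn2 : MemLp (R.localNoise τ t i k) 2 μ) :
    ∫ ω, inner ℝ (Y ω) (R.localNoise τ t i k ω) ∂μ = 0 := by
  obtain ⟨h1, h2, -⟩ := R.measurable_localState hS.regular τ t i k
  have hX := h2.prodMk h1
  have hprob : IsProbabilityMeasure (μ.map (R.minerBatch t i k)) :=
    Measure.isProbabilityMeasure_map (R.minerBatch_meas t i k).aemeasurable
  have hint : ∀ v : Vec d, Integrable (fun B : Fin h.b' → Z => P.noise i v B)
      (μ.map (R.minerBatch t i k)) := by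
    intro v
    have : MemLp (fun B : Fin h.b' → Z => P.noise i v B) 2 (μ.map (R.minerBatch t i k)) := by
      rw [R.minerBatch_law]
      exact memLp_two_of_lintegral
        (Problem.measurable_noise_left hS.regular hS.smooth i h.b' v).aestronglyMeasurable
        ((hS.noise i h.b' hS.one_le_b' hS.b'_le v).trans_lt ENNReal.ofReal_lt_top)
    exact this.integrable (by norm_num)
  refine integral_inner_eq_zero_of_indepFun (B := R.minerBatch t i k)
    (X := fun ω => ((R.localState τ t i k ω).cur, (R.localState τ t i k ω).prev))
    (φ := fun x B => P.noise i x.1 B - P.noise i x.2 B)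
    (R.measurable_of_field hY) (R.measurable_of_field hX) (R.minerBatch_meas t i k)
    (R.indepFun_of_notMem (notMem_localPast_minerBatch t i k) (hY.prodMk hX)
      (comap_measurable _)) ?_ hY2 hn2 (fun x => (hint x.1).sub (hint x.2)) fun x => ?_
  · exact (Problem.measurable_noise_comp hS.regular hS.smooth i
      (measurable_fst.comp measurable_fst) measurable_snd).sub
      (Problem.measurable_noise_comp hS.regular hS.smooth i
        (measurable_snd.comp measurable_fst) measurable_snd)
  · rw [integral_sub (hint x.1) (hint x.2), R.minerBatch_law,
      Problem.integral_noise hS.regular hS.smooth hS.noise i hS.one_le_b' hS.b'_le,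
      Problem.integral_noise hS.regular hS.smooth hS.noise i hS.one_le_b' hS.b'_le, sub_zero]

/-- The directions of the local iterations stay close to the averaged caching gradient. -/
theorem local_deviation_bound (hS : Setting P h L σ Lσ ς) (hx : MemLp (R.model τ t) 2 μ)
    (hg : MemLp (R.cacheMean τ t) 2 μ) (i : Fin M) :
    ∑ k ∈ Finset.range h.K,
      msq μ (fun ω => (R.localState τ t i (k + 1) ω).dir - R.cacheMean τ t ω)
      ≤ h.K * (7 / 60 * msq μ (R.cacheMean τ t)) := by
  have hmem := R.memLp_localState hS hx hg i
  have hnoise := fun k => R.localNoise_bound (τ := τ) (t := t) hS i k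
    ((hmem k).2.1.sub (hmem k).1)
  -- `N k` is the noise contained in direction `k + 1`. Its first summand vanishes because the first
  -- iteration evaluates both gradients at the same point; the gradient differences telescope.
  set N : ℕ → Ω → Vec d := fun k ω => ∑ j ∈ Finset.range (k + 1), R.localNoise τ t i j ω with hN
  have hN2 : ∀ k, MemLp (N k) 2 μ := fun k => memLp_finsetSum _ fun j _ => (hnoise j).1
  have hzero : ∀ ω, R.localNoise τ t i 0 ω = 0 := by
    intro ω
    simp [localNoise, localState, miner]
  have hNsucc : ∀ k ω, N (k + 1) ω = N k ω + R.localNoise τ t i (k + 1) ω := fun k ω =>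
    Finset.sum_range_succ _ _
  have hgN : ∀ k ω, (R.localState τ t i (k + 1) ω).dir = (R.localState τ t i 0 ω).dir +
      ((gradient (P.localObj i) (R.localState τ t i k ω).cur
        - gradient (P.localObj i) (R.localState τ t i 0 ω).cur) + N k ω) := by
    intro k ω
    induction k with
    | zero =>
      rw [localState_dir_succ, hzero]
      simp [hN, hzero, localState, miner]
    | succ k ih =>
      rw [localState_dir_succ, ih, localState_prev_succ, hNsucc]
      abel
  refine local_direction_bound (N := N) (g := fun k ω => (R.localState τ t i k ω).dir)
    (x := fun k ω => (R.localState τ t i k ω).cur) (G := gradient (P.localObj i))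
    (ν := Lσ ^ 2 / h.b') (hS.smooth.lipschitz i) (fun k => (hmem k).2.2) hN2
    (fun k => (memLp_localGrad hS.smooth i (hmem k).2.1).sub
      (memLp_localGrad hS.smooth i (hmem 0).2.1))
    (fun k ω => R.localState_cur_succ i k ω) hgN ?_ (fun k => ?_) hS.ηl_smooth hS.ηl_noise
  · simp [hN, hzero, msq]
  · have hNm : Measurable[R.field (localPast t i (k + 1))] (N k) := by
      refine Finset.measurable_fun_sum _ fun j hj => ?_
      refine (R.measurable_localNoise hS.regular hS.smooth τ t i j).mono
        (R.field_mono (localPast_mono t i ?_)) le_rfl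
      have := Finset.mem_range.1 hj
      omega
    have e : msq μ (N (k + 1)) = msq μ (N k) + msq μ (R.localNoise τ t i (k + 1)) := by
      rw [funext (hNsucc k), msq_add_eq (hN2 k) (hnoise (k + 1)).1,
        R.integral_inner_localNoise hS i (k + 1) hNm (hN2 k) (hnoise (k + 1)).1]
      ring
    have e2 : msq μ (fun ω => (R.localState τ t i (k + 1) ω).cur
        - (R.localState τ t i (k + 1) ω).prev)
        = h.ηl ^ 2 * msq μ (fun ω => (R.localState τ t i (k + 1) ω).dir) := by
      rw [← neg_sq, ← msq_smul]
      congr 1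
      ext1 ω
      rw [localState_cur_succ, localState_prev_succ]
      simp
    have e3 := (hnoise (k + 1)).2
    rw [e2] at e3
    rw [e]
    linarith

theorem memLp_run (hS : Setting P h L σ Lσ ς) (τ t : ℕ) :
    MemLp (R.model τ t) 2 μ ∧ (∀ m, MemLp (R.cache τ t m) 2 μ) ∧
      (∀ m, MemLp (R.anchorPt τ t m) 2 μ) := by
  induction t with
  | zero =>
    refine ⟨memLp_const _, fun m => ?_, fun m => memLp_const _⟩
    have h1 := (cacheNoise_bound hS (X := fun _ => h.x₀) measurable_const (R.initBatch_meas m)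
      (indepFun_const_left _ _) (R.initBatch_law m)).1
    have h2 := h1.add (memLp_const (gradient (P.localObj m) h.x₀))
    simp only [Pi.add_def, Problem.noise, sub_add_cancel] at h2
    rw [funext (R.cache_zero (τ := τ) m)]
    exact h2
  | succ t ih =>
    obtain ⟨h1, h2, h3⟩ := ih
    by_cases ht : t % τ = 0
    · refine ⟨?_, fun m => ?_, fun m => ?_⟩
      · rwa [funext (R.model_succ_anchor ht)]
      · rw [funext (R.cache_succ_anchor ht m)]
        refine (R.memLp_present_smul ?_ t m).add (R.memLp_absent_smul (h2 m) t m)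
        have hm := (R.measurable_run hS.regular τ t).1
        have h4 := (cacheNoise_bound hS (R.measurable_of_field hm) (R.anchorBatch_meas t m)
          (R.indepFun_of_notMem (notMem_past_anchorBatch t m) hm (comap_measurable _))
          (R.anchorBatch_law t m)).1
        have h5 := h4.add (memLp_localGrad hS.smooth m h1)
        simp only [Pi.add_def, Problem.noise, sub_add_cancel] at h5
        exact h5
      · rw [funext (R.anchorPt_succ_anchor ht m)]
        exact (R.memLp_present_smul h1 t m).add (R.memLp_absent_smul (h3 m) t m)
    · refine ⟨?_, fun m => ?_, fun m => ?_⟩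
      · rw [funext (R.model_succ_miner ht)]
        have hg : MemLp (R.cacheMean τ t) 2 μ :=
          (memLp_finsetSum Finset.univ fun m _ => h2 m).const_smul (M : ℝ)⁻¹
        have hsum : MemLp (fun ω => ∑ i, (1 - absent i (R.participants t ω)) •
            (R.model τ t ω - (R.localState τ t i h.K ω).cur)) 2 μ :=
          memLp_finsetSum Finset.univ fun i _ => R.memLp_present_smul
            (h1.sub (R.memLp_localState hS h1 hg i h.K).2.1) t i
        exact h1.sub (hsum.const_smul (h.ηs / h.A))
      · rw [funext (R.cache_succ_miner ht m)]
        exact h2 m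
      · rw [funext (R.anchorPt_succ_miner ht m)]
        exact h3 m

theorem memLp_cacheMean (hS : Setting P h L σ Lσ ς) (τ t : ℕ) : MemLp (R.cacheMean τ t) 2 μ :=
  (memLp_finsetSum Finset.univ fun m _ => (R.memLp_run hS τ t).2.1 m).const_smul (M : ℝ)⁻¹

end MeanSquares

end Draws

/-! ### Errors of the caching gradients and of the average local direction. -/

/-- The sources that are used before the large batch of client `i` in round `t` is looked at. -/
def anchorPast {M : ℕ} (t : ℕ) (i : Fin M) : Set (Source M) :=
  past t ∪ {s | s = .participants t ∨ ∃ l ≠ i, s = .anchorBatch t l}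

theorem measurable_norm_sq {d : ℕ} {Ω : Type*} {m' : MeasurableSpace Ω} {X : Ω → Vec d}
    (hX : Measurable X) : Measurable fun ω => ‖X ω‖ ^ 2 := hX.norm.pow_const 2

namespace Draws

variable {d M : ℕ} {Z : Type*} [MeasurableSpace Z] {P : Problem d M Z} {h : Params d}
  {Ω : Type*} [MeasurableSpace Ω] {μ : Measure Ω} (R : Draws P h μ) {τ t : ℕ}

/-- The deviation of a caching gradient from the local gradient at the point at which it was
computed. -/
noncomputable def cacheErr (τ t : ℕ) (m : Fin M) (ω : Ω) : Vec d :=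
  R.cache τ t m ω - gradient (P.localObj m) (R.anchorPt τ t m ω)

/-- The deviation of the large batch gradient of client `m` in round `t`. -/
noncomputable def anchorNoise (τ t : ℕ) (m : Fin M) (ω : Ω) : Vec d :=
  P.noise m (R.model τ t ω) (R.anchorBatch t m ω)

theorem cacheErr_zero (m : Fin M) (ω : Ω) :
    R.cacheErr τ 0 m ω = P.noise m h.x₀ (R.initBatch m ω) := rfl

theorem cacheErr_succ_anchor (ht : t % τ = 0) (i : Fin M) (ω : Ω) : R.cacheErr τ (t + 1) i ω =
    (1 - absent i (R.participants t ω)) • R.anchorNoise τ t i ω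
      + absent i (R.participants t ω) • R.cacheErr τ t i ω := by
  simp only [cacheErr, anchorNoise, Problem.noise, R.cache_succ_anchor ht,
    R.anchorPt_succ_anchor ht, absent]
  split_ifs <;> simp

theorem cacheErr_succ_miner (ht : t % τ ≠ 0) (i : Fin M) (ω : Ω) :
    R.cacheErr τ (t + 1) i ω = R.cacheErr τ t i ω := by
  simp only [cacheErr, R.cache_succ_miner ht, R.anchorPt_succ_miner ht]

theorem notMem_anchorPast (t : ℕ) (i : Fin M) : (.anchorBatch t i : Source M) ∉ anchorPast t i := by
  rintro (hx | hx | ⟨l, hl, hx⟩)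
  · exact notMem_past_anchorBatch t i hx
  · cases hx
  · cases hx
    exact hl rfl

variable {L σ Lσ ς : ℝ}

theorem measurable_cacheErr (hS : Setting P h L σ Lσ ς) (τ t : ℕ) (m : Fin M) :
    Measurable[R.field (past t)] (R.cacheErr τ t m) :=
  ((R.measurable_run hS.regular τ t).2.1 m).sub
    ((Problem.continuous_localGrad hS.smooth m).measurable.comp
      ((R.measurable_run hS.regular τ t).2.2 m))

theorem integrable_mul_participants {Y : Ω → ℝ} (hY : Integrable Y μ) (t : ℕ)
    (w : Finset (Fin M) → ℝ) : Integrable (fun ω => Y ω * w (R.participants t ω)) μ := by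
  refine hY.mul_bdd (c := ∑ S, |w S|) (R.measurable_comp_participants t w).aestronglyMeasurable
    (Filter.Eventually.of_forall fun ω => ?_)
  exact Finset.single_le_sum (f := fun S => |w S|) (fun S _ => abs_nonneg _) (Finset.mem_univ _)

/-- The average over the participants of the mean local direction. -/
noncomputable def avgDir (τ t : ℕ) (ω : Ω) : Vec d :=
  (h.A : ℝ)⁻¹ • ∑ i, (1 - absent i (R.participants t ω)) •
    ((h.K : ℝ)⁻¹ • ∑ k ∈ Finset.range h.K, (R.localState τ t i (k + 1) ω).dir)

/-- The displacement of a miner telescopes to `η_l` times the sum of its `K` directions, so a round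
is one step of length `η_s η_l K` along their mean. -/
theorem model_succ_eq (hS : Setting P h L σ Lσ ς) (ht : t % τ ≠ 0) (ω : Ω) :
    R.model τ (t + 1) ω = R.model τ t ω - (h.ηs * h.ηl * h.K) • R.avgDir τ t ω := by
  have hK : (h.K : ℝ) ≠ 0 := by
    have := hS.one_le_K
    positivity
  have h1 : ∀ i k, R.model τ t ω - (R.localState τ t i k ω).cur
      = h.ηl • ∑ j ∈ Finset.range k, (R.localState τ t i (j + 1) ω).dir := by
    intro i k
    induction k with
    | zero => simp [localState, miner]
    | succ k ih =>
      rw [localState_cur_succ, Finset.sum_range_succ, smul_add, ← ih]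
      abel
  rw [R.model_succ_miner ht, avgDir]
  congr 1
  simp only [h1, smul_smul, Finset.smul_sum]
  refine Finset.sum_congr rfl fun i _ => Finset.sum_congr rfl fun k _ => ?_
  congr 1
  field_simp

theorem ae_card_participants (t : ℕ) : ∀ᵐ ω ∂μ, (R.participants t ω).card = h.A := by
  have h1 : ∀ S : Finset (Fin M), S.card ≠ h.A → ∀ᵐ ω ∂μ, R.participants t ω ≠ S := by
    intro S hS
    rw [ae_iff]
    simp [R.participants_law, hS]
  have h2 : ∀ᵐ ω ∂μ, ∀ S : Finset (Fin M), S.card ≠ h.A → R.participants t ω ≠ S :=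
    ae_all_iff.2 fun S => by
      by_cases hS : S.card = h.A
      · exact ae_of_all _ fun ω hne => absurd hS hne
      · filter_upwards [h1 S hS] with ω hω _ using hω
  filter_upwards [h2] with ω hω
  by_contra hne
  exact hω _ hne rfl

variable [IsProbabilityMeasure μ]

theorem memLp_cacheErr (hS : Setting P h L σ Lσ ς) (τ t : ℕ) (m : Fin M) :
    MemLp (R.cacheErr τ t m) 2 μ :=
  ((R.memLp_run hS τ t).2.1 m).sub (memLp_localGrad hS.smooth m ((R.memLp_run hS τ t).2.2 m))

theorem anchorNoise_bound (hS : Setting P h L σ Lσ ς) (τ t : ℕ) (m : Fin M) :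
    MemLp (R.anchorNoise τ t m) 2 μ ∧ msq μ (R.anchorNoise τ t m) ≤ ς := by
  have hm := (R.measurable_run hS.regular τ t).1
  exact cacheNoise_bound hS (R.measurable_of_field hm) (R.anchorBatch_meas t m)
    (R.indepFun_of_notMem (notMem_past_anchorBatch t m) hm (comap_measurable _))
    (R.anchorBatch_law t m)

theorem integrable_cacheNoise (hS : Setting P h L σ Lσ ς) {B : Ω → (Fin h.b → Z)} {m : Fin M}
    (hB : Measurable B) (hlaw : μ.map B = P.data.batchLaw m h.b) (v : Vec d) :
    Integrable (fun b : Fin h.b → Z => P.noise m v b) (μ.map B) := by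
  have hprob : IsProbabilityMeasure (μ.map B) :=
    Measure.isProbabilityMeasure_map hB.aemeasurable
  have : MemLp (fun b : Fin h.b → Z => P.noise m v b) 2 (μ.map B) := by
    rw [hlaw]
    exact memLp_two_of_lintegral
      (Problem.measurable_noise_left hS.regular hS.smooth m h.b v).aestronglyMeasurable
      ((hS.cacheNoise m v).trans_lt ENNReal.ofReal_lt_top)
  exact this.integrable (by norm_num)

theorem integral_inner_anchorNoise (hS : Setting P h L σ Lσ ς) (τ t : ℕ) (i : Fin M)
    {Y : Ω → Vec d} (hY : Measurable[R.field (anchorPast t i)] Y) (hY2 : MemLp Y 2 μ) :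
    ∫ ω, inner ℝ (Y ω) (R.anchorNoise τ t i ω) ∂μ = 0 := by
  have hX : Measurable[R.field (anchorPast t i)] (R.model τ t) :=
    (R.measurable_run hS.regular τ t).1.mono (R.field_mono Set.subset_union_left) le_rfl
  refine integral_inner_eq_zero_of_indepFun (B := R.anchorBatch t i) (X := R.model τ t)
    (φ := fun x B => P.noise i x B) (R.measurable_of_field hY) (R.measurable_of_field hX)
    (R.anchorBatch_meas t i) (R.indepFun_of_notMem (notMem_anchorPast t i) (hY.prodMk hX)
      (comap_measurable _)) (Problem.measurable_noise hS.regular hS.smooth i h.b) hY2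
    (R.anchorNoise_bound hS τ t i).1
    (fun v => integrable_cacheNoise hS (R.anchorBatch_meas t i) (R.anchorBatch_law t i) v)
    fun v => ?_
  rw [R.anchorBatch_law]
  exact Problem.integral_noise hS.regular hS.smooth hS.noise i hS.one_le_b hS.b_le v

theorem integral_mul_absent (hS : Setting P h L σ Lσ ς) {S : Set (Source M)} {t : ℕ}
    (ht : .participants t ∉ S) {Y : Ω → ℝ} (hY : Measurable[R.field S] Y) (i : Fin M) :
    ∫ ω, Y ω * absent i (R.participants t ω) ∂μ = (1 - (h.A : ℝ) / M) * ∫ ω, Y ω ∂μ := by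
  rw [R.integral_mul_participants ht hY, R.integral_absent hS.one_le_A hS.A_le, mul_comm]

theorem integral_mul_present (hS : Setting P h L σ Lσ ς) {S : Set (Source M)} {t : ℕ}
    (ht : .participants t ∉ S) {Y : Ω → ℝ} (hY : Measurable[R.field S] Y) (hYi : Integrable Y μ)
    (i : Fin M) :
    ∫ ω, Y ω * (1 - absent i (R.participants t ω)) ∂μ = (h.A : ℝ) / M * ∫ ω, Y ω ∂μ := by
  have h1 := R.integral_mul_absent hS ht hY i
  simp only [mul_sub, mul_one]
  rw [integral_sub hYi (R.integrable_mul_participants hYi t (absent i)), h1]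
  ring

/-- The new error is fresh noise with probability `A/M` and the old error otherwise. Participation
is independent of both, so their mean squares are averaged with these weights. -/
theorem msq_cacheErr_succ_anchor (hS : Setting P h L σ Lσ ς) (ht : t % τ = 0) (i : Fin M)
    (ih : msq μ (R.cacheErr τ t i) ≤ ς) : msq μ (R.cacheErr τ (t + 1) i) ≤ ς := by
  have hN := R.anchorNoise_bound hS τ t i
  have hE := R.memLp_cacheErr hS τ t i
  have hNi := integrable_norm_sq hN.1
  have hEi := integrable_norm_sq hE
  have h1 : ∀ ω, ‖R.cacheErr τ (t + 1) i ω‖ ^ 2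
      = ‖R.anchorNoise τ t i ω‖ ^ 2 * (1 - absent i (R.participants t ω))
        + ‖R.cacheErr τ t i ω‖ ^ 2 * absent i (R.participants t ω) := by
    intro ω
    rw [R.cacheErr_succ_anchor ht]
    unfold absent
    split_ifs <;> simp
  have hNm : Measurable[R.field (past t ∪ {.anchorBatch t i})] (R.anchorNoise τ t i) :=
    Problem.measurable_noise_comp hS.regular hS.smooth i
      ((R.measurable_run hS.regular τ t).1.mono (R.field_mono Set.subset_union_left) le_rfl)
      (R.measurable_anchorBatch_field (Or.inr rfl))
  have hnot : (.participants t : Source M) ∉ past t ∪ {.anchorBatch t i} := by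
    rintro (hx | hx)
    · exact notMem_past_participants t hx
    · cases hx
  have h2 := R.integral_mul_present hS hnot (measurable_norm_sq hNm) hNi i
  have h3 := R.integral_mul_absent hS (notMem_past_participants t)
    (measurable_norm_sq (R.measurable_cacheErr hS τ t i)) i
  have h4 : Integrable (fun ω => ‖R.anchorNoise τ t i ω‖ ^ 2
      * (1 - absent i (R.participants t ω))) μ :=
    R.integrable_mul_participants hNi t fun S => 1 - absent i S
  have h5 := R.integrable_mul_participants hEi t (absent i)
  rw [msq, integral_congr_ae (Filter.Eventually.of_forall h1), integral_add h4 h5, h2, h3]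
  have hM : (0 : ℝ) < M := by exact_mod_cast hS.one_le_A.trans hS.A_le
  have ha : (h.A : ℝ) / M ≤ 1 := by
    rw [div_le_one hM]
    exact_mod_cast hS.A_le
  have ha0 : 0 ≤ (h.A : ℝ) / M := by positivity
  have h6 := hN.2
  simp only [msq] at h6 ih
  nlinarith

/-- Orthogonality survives although the participations of the two clients are correlated. Expanding
the product leaves a term with the fresh noise of `i`, one with the fresh noise of `j` against the
old error of `i`, and one with both old errors. The first two vanish because each batch is unbiased
given `anchorPast`, which contains the participant set and the other clients' batches; the third
factors, since the participants are independent of the past. -/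
theorem integral_inner_cacheErr_succ_anchor (hS : Setting P h L σ Lσ ς) (ht : t % τ = 0)
    {i j : Fin M} (hij : i ≠ j)
    (ih : ∫ ω, inner ℝ (R.cacheErr τ t i ω) (R.cacheErr τ t j ω) ∂μ = 0) :
    ∫ ω, inner ℝ (R.cacheErr τ (t + 1) i ω) (R.cacheErr τ (t + 1) j ω) ∂μ = 0 := by
  have hE := R.memLp_cacheErr hS τ t
  have hE' := R.memLp_cacheErr hS τ (t + 1)
  have hN := fun i => (R.anchorNoise_bound hS τ t i).1
  have hpart : ∀ l (w : Finset (Fin M) → ℝ), Measurable[R.field (anchorPast t l)]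
      fun ω => w (R.participants t ω) := fun l w =>
    R.measurable_participants_field (Or.inr (Or.inl rfl)) w
  have hEm : ∀ l m, Measurable[R.field (anchorPast t l)] (R.cacheErr τ t m) := fun l m =>
    (R.measurable_cacheErr hS τ t m).mono (R.field_mono Set.subset_union_left) le_rfl
  have hE'j : Measurable[R.field (anchorPast t i)] (R.cacheErr τ (t + 1) j) := by
    rw [funext (R.cacheErr_succ_anchor ht j)]
    refine ((hpart i fun S => 1 - absent j S).smul ?_).add ((hpart i (absent j)).smul (hEm i j))
    exact Problem.measurable_noise_comp hS.regular hS.smooth j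
      ((R.measurable_run hS.regular τ t).1.mono (R.field_mono Set.subset_union_left) le_rfl)
      (R.measurable_anchorBatch_field (Or.inr (Or.inr ⟨j, hij.symm, rfl⟩)))
  have e1 := R.integral_inner_anchorNoise hS τ t i
    (Y := fun ω => (1 - absent i (R.participants t ω)) • R.cacheErr τ (t + 1) j ω)
    ((hpart i fun S => 1 - absent i S).smul hE'j) (R.memLp_present_smul (hE' j) t i)
  have hw2 := R.memLp_present_smul (R.memLp_absent_smul (hE i) t i) t j
  have e2 := R.integral_inner_anchorNoise hS τ t j
    (Y := fun ω => (1 - absent j (R.participants t ω)) •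
      (absent i (R.participants t ω) • R.cacheErr τ t i ω))
    ((hpart j fun S => 1 - absent j S).smul ((hpart j (absent i)).smul (hEm j i))) hw2
  have e3 : ∫ ω, inner ℝ (R.cacheErr τ t i ω) (R.cacheErr τ t j ω)
      * (absent i (R.participants t ω) * absent j (R.participants t ω)) ∂μ = 0 := by
    rw [R.integral_mul_participants (notMem_past_participants t)
      ((R.measurable_cacheErr hS τ t i).inner (R.measurable_cacheErr hS τ t j))
      fun S => absent i S * absent j S, ih, zero_mul]
  have i1 := integrable_inner_of_memLp (R.memLp_present_smul (hE' j) t i) (hN i)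
  have i2 := integrable_inner_of_memLp hw2 (hN j)
  have i3 := R.integrable_mul_participants (integrable_inner_of_memLp (hE i) (hE j)) t
    fun S => absent i S * absent j S
  have hpt : ∀ ω, inner ℝ (R.cacheErr τ (t + 1) i ω) (R.cacheErr τ (t + 1) j ω)
      = inner ℝ ((1 - absent i (R.participants t ω)) • R.cacheErr τ (t + 1) j ω)
          (R.anchorNoise τ t i ω)
        + (inner ℝ ((1 - absent j (R.participants t ω)) •
            (absent i (R.participants t ω) • R.cacheErr τ t i ω)) (R.anchorNoise τ t j ω)
        + inner ℝ (R.cacheErr τ t i ω) (R.cacheErr τ t j ω)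
            * (absent i (R.participants t ω) * absent j (R.participants t ω))) := by
    intro ω
    rw [R.cacheErr_succ_anchor ht i]
    have hc : inner ℝ ((1 - absent i (R.participants t ω)) • R.cacheErr τ (t + 1) j ω)
          (R.anchorNoise τ t i ω) = (1 - absent i (R.participants t ω)) *
            inner ℝ (R.anchorNoise τ t i ω) (R.cacheErr τ (t + 1) j ω) := by
      rw [real_inner_smul_left, real_inner_comm]
    rw [hc, inner_add_left, real_inner_smul_left]
    congr 1
    rw [R.cacheErr_succ_anchor ht j]
    simp only [inner_add_right, real_inner_smul_left, real_inner_smul_right]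
    ring
  rw [integral_congr_ae (Filter.Eventually.of_forall hpt),
    integral_add i1 (i2.add i3 : Integrable (fun ω => _ + _) μ), integral_add i2 i3, e1, e2, e3]
  simp

theorem integral_inner_initNoise (hS : Setting P h L σ Lσ ς) {i j : Fin M} (hij : i ≠ j) :
    ∫ ω, inner ℝ (R.cacheErr τ 0 i ω) (R.cacheErr τ 0 j ω) ∂μ = 0 := by
  have hY : Measurable[R.field {.initBatch i}] (R.cacheErr τ 0 i) := by
    have hB : Measurable[R.field {.initBatch i}] (R.initBatch i) :=
      (comap_measurable (R.initBatch i)).mono (R.sigma_le_field (s := .initBatch i) (Set.mem_singleton _)) le_rfl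
    rw [funext (R.cacheErr_zero (τ := τ) i)]
    exact Problem.measurable_noise_comp hS.regular hS.smooth i measurable_const hB
  have hX : Measurable[R.field {.initBatch i}] (fun _ : Ω => h.x₀) := measurable_const
  have hnot : (.initBatch j : Source M) ∉ ({.initBatch i} : Set (Source M)) := by
    intro hx
    cases hx
    exact hij rfl
  refine integral_inner_eq_zero_of_indepFun (B := R.initBatch j) (X := fun _ => h.x₀)
    (φ := fun x B => P.noise j x B) (R.measurable_of_field hY) measurable_const
    (R.initBatch_meas j) (R.indepFun_of_notMem hnot (hY.prodMk hX) (comap_measurable _))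
    (Problem.measurable_noise hS.regular hS.smooth j h.b) (R.memLp_cacheErr hS τ 0 i)
    (R.memLp_cacheErr hS τ 0 j)
    (fun v => integrable_cacheNoise hS (R.initBatch_meas j) (R.initBatch_law j) v)
    fun v => ?_
  rw [R.initBatch_law]
  exact Problem.integral_noise hS.regular hS.smooth hS.noise j hS.one_le_b hS.b_le v

/-- The errors of the caching gradients are bounded and mutually orthogonal. -/
theorem cacheErr_bound (hS : Setting P h L σ Lσ ς) (τ t : ℕ) :
    (∀ i, msq μ (R.cacheErr τ t i) ≤ ς) ∧
      ∀ i j, i ≠ j → ∫ ω, inner ℝ (R.cacheErr τ t i ω) (R.cacheErr τ t j ω) ∂μ = 0 := by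
  induction t with
  | zero =>
    refine ⟨fun i => ?_, fun i j hij => R.integral_inner_initNoise hS hij⟩
    exact (cacheNoise_bound hS (X := fun _ => h.x₀) measurable_const (R.initBatch_meas i)
      (indepFun_const_left _ _) (R.initBatch_law i)).2
  | succ t ih =>
    by_cases ht : t % τ = 0
    · exact ⟨fun i => R.msq_cacheErr_succ_anchor hS ht i (ih.1 i),
        fun i j hij => R.integral_inner_cacheErr_succ_anchor hS ht hij (ih.2 i j hij)⟩
    · simpa only [funext (R.cacheErr_succ_miner ht _)] using ih

/-- The average of the errors of the caching gradients. -/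
noncomputable def meanErr (τ t : ℕ) (ω : Ω) : Vec d := (M : ℝ)⁻¹ • ∑ m, R.cacheErr τ t m ω

theorem memLp_meanErr (hS : Setting P h L σ Lσ ς) (τ t : ℕ) : MemLp (R.meanErr τ t) 2 μ :=
  (memLp_finsetSum Finset.univ fun m _ => R.memLp_cacheErr hS τ t m).const_smul (M : ℝ)⁻¹

/-- By orthogonality the sum of the `M` errors has mean square at most `M ς`, and the average gains
`1/M²`. The batch size `⌈κσ²/(Mε)⌉` relies on this reduction. -/
theorem msq_meanErr_le (hS : Setting P h L σ Lσ ς) (τ t : ℕ) :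
    msq μ (R.meanErr τ t) ≤ ς / M := by
  have hM : (0 : ℝ) < M := by exact_mod_cast hS.one_le_A.trans hS.A_le
  have h1 := R.cacheErr_bound hS τ t
  have e : msq μ (R.meanErr τ t) = (M : ℝ)⁻¹ ^ 2 * ∑ m, msq μ (R.cacheErr τ t m) := by
    rw [← msq_sum_of_orthogonal Finset.univ (R.memLp_cacheErr hS τ t) h1.2, ← msq_smul]
    rfl
  rw [e]
  calc _ ≤ (M : ℝ)⁻¹ ^ 2 * ∑ _m : Fin M, ς := by
        gcongr with m
        exact h1.1 m
    _ = ς / M := by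
        simp
        field_simp

theorem memLp_meanLocalDir (hS : Setting P h L σ Lσ ς) (τ t : ℕ) (i : Fin M) :
    MemLp (fun ω => (h.K : ℝ)⁻¹ • ∑ k ∈ Finset.range h.K, (R.localState τ t i (k + 1) ω).dir)
      2 μ :=
  (memLp_finsetSum _ fun k _ => (R.memLp_localState hS (R.memLp_run hS τ t).1
    (R.memLp_cacheMean hS τ t) i (k + 1)).2.2).const_smul (h.K : ℝ)⁻¹

theorem memLp_avgDir (hS : Setting P h L σ Lσ ς) (τ t : ℕ) : MemLp (R.avgDir τ t) 2 μ :=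
  (memLp_finsetSum Finset.univ fun i _ =>
    R.memLp_present_smul (R.memLp_meanLocalDir hS τ t i) t i).const_smul (h.A : ℝ)⁻¹

/-- Local paths are defined for all clients, whether or not they participate, and are independent of
the participant set of the round. Each client then contributes with probability `A/M`, and the bound
of `local_deviation_bound` passes to the average by convexity. -/
theorem msq_avgDir_sub_le (hS : Setting P h L σ Lσ ς) (τ t : ℕ) :
    msq μ (fun ω => R.avgDir τ t ω - R.cacheMean τ t ω) ≤ 7 / 60 * msq μ (R.cacheMean τ t) := by
  have hM : (0 : ℝ) < M := by exact_mod_cast hS.one_le_A.trans hS.A_le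
  have hA : (0 : ℝ) < h.A := by exact_mod_cast hS.one_le_A
  have hK : (0 : ℝ) < h.K := by exact_mod_cast hS.one_le_K
  set Y : Fin M → Ω → Vec d := fun i ω =>
    ((h.K : ℝ)⁻¹ • ∑ k ∈ Finset.range h.K, (R.localState τ t i (k + 1) ω).dir)
      - R.cacheMean τ t ω with hY
  have hYmem : ∀ i, MemLp (Y i) 2 μ := fun i =>
    (R.memLp_meanLocalDir hS τ t i).sub (R.memLp_cacheMean hS τ t)
  have hYint := fun i => integrable_norm_sq (hYmem i)
  have hYmsq : ∀ i, msq μ (Y i) ≤ 7 / 60 * msq μ (R.cacheMean τ t) := by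
    intro i
    have e1 : Y i = fun ω => (h.K : ℝ)⁻¹ • ∑ k ∈ Finset.range h.K,
        ((R.localState τ t i (k + 1) ω).dir - R.cacheMean τ t ω) := by
      ext1 ω
      simp only [hY, Finset.sum_sub_distrib, Finset.sum_const, Finset.card_range, smul_sub,
        ← Nat.cast_smul_eq_nsmul ℝ, smul_smul]
      rw [inv_mul_cancel₀ hK.ne', one_smul]
    have e2 := msq_sum_le (μ := μ) (Finset.range h.K)
      (X := fun k ω => (R.localState τ t i (k + 1) ω).dir - R.cacheMean τ t ω) fun k _ =>
        (R.memLp_localState hS (R.memLp_run hS τ t).1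
          (R.memLp_cacheMean hS τ t) i (k + 1)).2.2.sub (R.memLp_cacheMean hS τ t)
    have e3 := R.local_deviation_bound (τ := τ) (t := t) hS (R.memLp_run hS τ t).1
      (R.memLp_cacheMean hS τ t) i
    rw [Finset.card_range] at e2
    rw [e1, msq_smul]
    calc _ ≤ (h.K : ℝ)⁻¹ ^ 2 * (h.K * (h.K * (7 / 60 * msq μ (R.cacheMean τ t)))) := by
          gcongr
          exact e2.trans (by gcongr)
      _ = _ := by field_simp
  have hYmeas : ∀ i, Measurable[R.field (localPast t i h.K)] (Y i) := by
    intro i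
    have hle : R.field (past t) ≤ R.field (localPast t i h.K) := R.field_mono Set.subset_union_left
    refine (Measurable.const_smul (Finset.measurable_fun_sum _ fun k hk => ?_) (h.K : ℝ)⁻¹).sub
      ((R.measurable_cacheMean hS.regular τ t).mono hle le_rfl)
    exact (R.measurable_localState hS.regular τ t i (k + 1)).2.2.mono
      (R.field_mono (localPast_mono t i (Finset.mem_range.1 hk))) le_rfl
  have hpt : ∀ᵐ ω ∂μ, ‖R.avgDir τ t ω - R.cacheMean τ t ω‖ ^ 2
      ≤ (h.A : ℝ)⁻¹ * ∑ i, ‖Y i ω‖ ^ 2 * (1 - absent i (R.participants t ω)) := by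
    filter_upwards [R.ae_card_participants t] with ω hω
    have e1 : R.avgDir τ t ω - R.cacheMean τ t ω
        = (h.A : ℝ)⁻¹ • ∑ i ∈ R.participants t ω, Y i ω := by
      rw [avgDir, ← sum_participants]
      simp only [hY, Finset.sum_sub_distrib, Finset.sum_const, hω, smul_sub,
        ← Nat.cast_smul_eq_nsmul ℝ, smul_smul]
      rw [inv_mul_cancel₀ hA.ne', one_smul]
    have e2 : ∑ i, ‖Y i ω‖ ^ 2 * (1 - absent i (R.participants t ω))
        = ∑ i ∈ R.participants t ω, ‖Y i ω‖ ^ 2 := by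
      rw [sum_participants (R.participants t ω) fun i => ‖Y i ω‖ ^ 2]
      exact Finset.sum_congr rfl fun i _ => mul_comm _ _
    rw [e1, e2, norm_smul, mul_pow, Real.norm_of_nonneg (by positivity)]
    calc _ ≤ (h.A : ℝ)⁻¹ ^ 2 * (h.A * ∑ i ∈ R.participants t ω, ‖Y i ω‖ ^ 2) := by
          gcongr
          rw [← hω]
          exact norm_sum_sq_le_card_mul _ _
      _ = _ := by field_simp
  have hint : ∀ i, Integrable (fun ω => ‖Y i ω‖ ^ 2 * (1 - absent i (R.participants t ω))) μ :=
    fun i => R.integrable_mul_participants (hYint i) t fun S => 1 - absent i S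
  calc msq μ (fun ω => R.avgDir τ t ω - R.cacheMean τ t ω)
      ≤ ∫ ω, (h.A : ℝ)⁻¹ * ∑ i, ‖Y i ω‖ ^ 2 * (1 - absent i (R.participants t ω)) ∂μ :=
        integral_mono_ae
          (integrable_norm_sq ((R.memLp_avgDir hS τ t).sub (R.memLp_cacheMean hS τ t)))
          ((integrable_finsetSum _ fun i _ => hint i).const_mul _) hpt
    _ = (h.A : ℝ)⁻¹ * ∑ i, (h.A : ℝ) / M * msq μ (Y i) := by
        rw [integral_const_mul, integral_finsetSum _ fun i _ => hint i]
        congr 1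
        refine Finset.sum_congr rfl fun i _ => ?_
        exact R.integral_mul_present hS (notMem_localPast_participants t i h.K)
          (measurable_norm_sq (hYmeas i)) (hYint i) i
    _ ≤ (h.A : ℝ)⁻¹ * ∑ _i : Fin M, (h.A : ℝ) / M * (7 / 60 * msq μ (R.cacheMean τ t)) := by
        gcongr with i
        exact hYmsq i
    _ = _ := by
        simp
        field_simp

end Draws

/-! ### Staleness: missed anchor rounds, geometric weights, total movement. -/

theorem add_sq_le_mul_add {p q F G F' G' : ℝ} (hF : 0 ≤ F) (hG : 0 ≤ G) (hF' : 0 ≤ F')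
    (hG' : 0 ≤ G') (hp : p ^ 2 ≤ F * G) (hq : q ^ 2 ≤ F' * G') :
    (p + q) ^ 2 ≤ (F + F') * (G + G') := by
  have h1 : (2 * p * q) ^ 2 ≤ (F * G' + F' * G) ^ 2 := by
    have h2 : p ^ 2 * q ^ 2 ≤ F * G * (F' * G') :=
      mul_le_mul hp hq (by positivity) (by positivity)
    nlinarith [sq_nonneg (F * G' - F' * G)]
  have h3 : 2 * p * q ≤ F * G' + F' * G :=
    le_of_abs_le (abs_le_of_sq_le_sq h1 (by positivity))
  nlinarith

/-- Cauchy–Schwarz with geometric weights. -/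
theorem weighted_sum_sq_le {y : ℝ} (hy : 0 < y) (N n i : ℕ) (p : ℕ → ℝ) (φ : ℕ → ℝ)
    (δ : ℕ → ℕ → ℝ) :
    (∑ j ∈ Finset.range i, p j
        + ∑ l ∈ Finset.range n, φ l * ∑ j ∈ Finset.range N, δ l j) ^ 2 ≤
      (i + N * ∑ j ∈ Finset.range n, y ^ (j + 1)) *
        (∑ j ∈ Finset.range i, p j ^ 2
          + ∑ l ∈ Finset.range n, ∑ j ∈ Finset.range N, (y ^ (n - l))⁻¹ * (δ l j ^ 2 * φ l ^ 2)) := by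
  have hF : ∑ j ∈ Finset.range n, y ^ (j + 1) = ∑ l ∈ Finset.range n, y ^ (n - l) := by
    rw [← Finset.sum_range_reflect]
    refine Finset.sum_congr rfl fun l hl => ?_
    have := Finset.mem_range.1 hl
    congr 1
    omega
  rw [hF, Finset.mul_sum]
  refine add_sq_le_mul_add (by positivity) (by positivity) (by positivity) (by positivity) ?_ ?_
  · simpa using sq_sum_le_card_mul_sum_sq (s := Finset.range i) (f := p)
  · refine Finset.sum_sq_le_sum_mul_sum_of_sq_le_mul _ (fun l _ => by positivity)
      (fun l _ => by positivity) fun l _ => ?_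
    have h1 : (∑ j ∈ Finset.range N, δ l j) ^ 2 ≤ N * ∑ j ∈ Finset.range N, δ l j ^ 2 := by
      simpa using sq_sum_le_card_mul_sum_sq (s := Finset.range N) (f := δ l)
    calc (φ l * ∑ j ∈ Finset.range N, δ l j) ^ 2
        = φ l ^ 2 * (∑ j ∈ Finset.range N, δ l j) ^ 2 := by ring
      _ ≤ φ l ^ 2 * (N * ∑ j ∈ Finset.range N, δ l j ^ 2) := by gcongr
      _ = _ := by
        rw [← Finset.mul_sum, ← Finset.sum_mul]
        field_simp

/-- The round of the move `i` in cycle `n`. -/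
def roundIdx (τ n i : ℕ) : ℕ := n * τ + 1 + i

theorem roundIdx_mod {τ n i : ℕ} (hi : i < τ - 1) : roundIdx τ n i % τ ≠ 0 := by
  have h1 : roundIdx τ n i % τ = (1 + i) % τ := by
    rw [roundIdx, add_assoc, add_comm, Nat.add_mul_mod_self_right]
  rw [h1, Nat.mod_eq_of_lt (by omega)]
  omega

theorem roundIdx_last {τ : ℕ} (hτ : 1 ≤ τ) (n : ℕ) : roundIdx τ n (τ - 1) = (n + 1) * τ := by
  rw [roundIdx, add_mul]
  omega

namespace Draws

variable {d M : ℕ} {Z : Type*} [MeasurableSpace Z] {P : Problem d M Z} {h : Params d}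
  {Ω : Type*} [MeasurableSpace Ω] {μ : Measure Ω} (R : Draws P h μ) {τ t : ℕ}

/-- The length of the move `i` in cycle `n`. -/
noncomputable def moveLen (τ n i : ℕ) (ω : Ω) : ℝ :=
  ‖R.model τ (roundIdx τ n i + 1) ω - R.model τ (roundIdx τ n i) ω‖

/-- The indicator of the event that client `m` takes part in none of the anchor rounds of the cycles
`l + 1, …, n`. -/
noncomputable def away (τ l n : ℕ) (m : Fin M) (ω : Ω) : ℝ :=
  ∏ c ∈ Finset.Ioc l n, absent m (R.participants (c * τ) ω)

/-- The fraction of the clients that take part in none of the anchor rounds of the cycles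
`l + 1, …, n`. -/
noncomputable def awayFrac (τ l n : ℕ) (ω : Ω) : ℝ := (M : ℝ)⁻¹ * ∑ m, R.away τ l n m ω

/-- The average distance of the server model from the points of the caching gradients. -/
noncomputable def staleness (τ t : ℕ) (ω : Ω) : ℝ :=
  (M : ℝ)⁻¹ * ∑ m, ‖R.anchorPt τ t m ω - R.model τ t ω‖

theorem away_self (l : ℕ) (m : Fin M) (ω : Ω) : R.away τ l l m ω = 1 := by
  simp [away]

theorem away_succ {l n : ℕ} (hl : l ≤ n) (m : Fin M) (ω : Ω) : R.away τ l (n + 1) m ω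
    = R.away τ l n m ω * absent m (R.participants ((n + 1) * τ) ω) := by
  rw [away, ← Finset.insert_Ioc_right_eq_Ioc_add_one hl, Finset.prod_insert (by simp), mul_comm]
  rfl

theorem away_nonneg (l n : ℕ) (m : Fin M) (ω : Ω) : 0 ≤ R.away τ l n m ω :=
  Finset.prod_nonneg fun _ _ => absent_nonneg _ _

/-- A move adds at most its length. An anchor round multiplies the accumulated distance by the
indicator of absence, since a participant's point is reset to the current model; thus movement of
cycle `l` counts only for clients absent from all later anchor rounds. -/
theorem anchorPt_dist_le (hτ : 1 ≤ τ) (n i : ℕ) (hi : i ≤ τ - 1) (m : Fin M) (ω : Ω) :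
    ‖R.anchorPt τ (roundIdx τ n i) m ω - R.model τ (roundIdx τ n i) ω‖ ≤
      ∑ j ∈ Finset.range i, R.moveLen τ n j ω
        + ∑ l ∈ Finset.range n, R.away τ l n m ω *
          ∑ j ∈ Finset.range (τ - 1), R.moveLen τ l j ω := by
  induction n generalizing i with
  | zero =>
    induction i with
    | zero =>
      -- After round `0` nothing is stale, whoever participates: the initial caches were computed at
      -- the same point `x₀`.
      have h0 : (0 : ℕ) % τ = 0 := Nat.zero_mod τ
      have e : roundIdx τ 0 0 = 0 + 1 := by simp [roundIdx]
      rw [e, R.anchorPt_succ_anchor h0, R.model_succ_anchor h0]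
      simp [anchorPt, model, run, ← add_smul]
    | succ i ih =>
      have hmod : roundIdx τ 0 i % τ ≠ 0 := roundIdx_mod (by omega)
      have e : roundIdx τ 0 (i + 1) = roundIdx τ 0 i + 1 := rfl
      have h1 := ih (by omega)
      rw [e, R.anchorPt_succ_miner hmod, Finset.sum_range_succ]
      have h2 := norm_sub_le_norm_sub_add_norm_sub (R.anchorPt τ (roundIdx τ 0 i) m ω)
        (R.model τ (roundIdx τ 0 i) ω) (R.model τ (roundIdx τ 0 i + 1) ω)
      have h3 : ‖R.model τ (roundIdx τ 0 i) ω - R.model τ (roundIdx τ 0 i + 1) ω‖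
        = R.moveLen τ 0 i ω := norm_sub_rev _ _
      linarith
  | succ n ihn =>
    induction i with
    | zero =>
      have h0 : ((n + 1) * τ) % τ = 0 := Nat.mul_mod_left _ _
      have e : roundIdx τ (n + 1) 0 = (n + 1) * τ + 1 := rfl
      have h1 := ihn (τ - 1) le_rfl
      rw [roundIdx_last hτ] at h1
      rw [e, R.anchorPt_succ_anchor h0, R.model_succ_anchor h0]
      set w := absent m (R.participants ((n + 1) * τ) ω) with hw
      have hw0 : 0 ≤ w := absent_nonneg _ _
      have h2 : (1 - w) • R.model τ ((n + 1) * τ) ω + w • R.anchorPt τ ((n + 1) * τ) m ω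
          - R.model τ ((n + 1) * τ) ω
          = w • (R.anchorPt τ ((n + 1) * τ) m ω - R.model τ ((n + 1) * τ) ω) := by
        rw [sub_smul, one_smul, smul_sub]
        abel
      rw [h2, norm_smul, Real.norm_of_nonneg hw0]
      refine (mul_le_mul_of_nonneg_left h1 hw0).trans (le_of_eq ?_)
      rw [Finset.sum_range_succ _ n, R.away_succ le_rfl, away_self, Finset.range_zero,
        Finset.sum_empty, one_mul, ← hw, mul_add, Finset.mul_sum, zero_add, add_comm]
      congr 1
      rw [Finset.mul_sum]
      refine Finset.sum_congr rfl fun l hl => ?_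
      rw [R.away_succ (Finset.mem_range.1 hl).le, ← hw]
      ring
    | succ i ih =>
      have hmod : roundIdx τ (n + 1) i % τ ≠ 0 := roundIdx_mod (by omega)
      have e : roundIdx τ (n + 1) (i + 1) = roundIdx τ (n + 1) i + 1 := rfl
      have h1 := ih (by omega)
      rw [e, R.anchorPt_succ_miner hmod, Finset.sum_range_succ _ i]
      have h2 := norm_sub_le_norm_sub_add_norm_sub (R.anchorPt τ (roundIdx τ (n + 1) i) m ω)
        (R.model τ (roundIdx τ (n + 1) i) ω) (R.model τ (roundIdx τ (n + 1) i + 1) ω)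
      have h3 : ‖R.model τ (roundIdx τ (n + 1) i) ω - R.model τ (roundIdx τ (n + 1) i + 1) ω‖
        = R.moveLen τ (n + 1) i ω := norm_sub_rev _ _
      linarith

theorem staleness_le (hτ : 1 ≤ τ) (hM : 0 < M) (n i : ℕ) (hi : i ≤ τ - 1) (ω : Ω) :
    R.staleness τ (roundIdx τ n i) ω ≤
      ∑ j ∈ Finset.range i, R.moveLen τ n j ω
        + ∑ l ∈ Finset.range n, R.awayFrac τ l n ω *
          ∑ j ∈ Finset.range (τ - 1), R.moveLen τ l j ω := by
  have hM' : (0 : ℝ) < M := by exact_mod_cast hM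
  rw [staleness, inv_mul_le_iff₀ hM']
  refine (Finset.sum_le_sum fun m _ => R.anchorPt_dist_le hτ n i hi m ω).trans (le_of_eq ?_)
  rw [Finset.sum_add_distrib, mul_add]
  congr 1
  · simp
  · rw [Finset.sum_comm, Finset.mul_sum]
    refine Finset.sum_congr rfl fun l _ => ?_
    rw [awayFrac, ← Finset.sum_mul]
    field_simp

theorem measurable_away (l n : ℕ) (m : Fin M) :
    Measurable[R.field (past (n * τ + 1))] (R.away τ l n m) := by
  refine Finset.measurable_fun_prod _ fun c hc => ?_
  refine R.measurable_participants_field (S := past (n * τ + 1)) ?_ (absent m)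
  have := Nat.mul_le_mul_right τ (Finset.mem_Ioc.1 hc).2
  exact Nat.succ_le_succ this

variable {L σ Lσ ς : ℝ}

theorem measurable_moveLen (hS : Setting P h L σ Lσ ς) (τ n i : ℕ) :
    Measurable[R.field (past (roundIdx τ n i + 1))] (R.moveLen τ n i) := by
  have h1 := (R.measurable_run hS.regular τ (roundIdx τ n i + 1)).1
  have h2 := (R.measurable_run hS.regular τ (roundIdx τ n i)).1.mono
    (R.field_mono (past_mono (Nat.le_succ _))) le_rfl
  exact measurable_norm.comp (h1.sub h2)

variable [IsProbabilityMeasure μ]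

/-- The expected share of pairs of clients that have been away, weighted by a variable from before
the absence. -/
theorem integral_mul_away_mul_away_le (hS : Setting P h L σ Lσ ς) (hτ : 1 ≤ τ) {l : ℕ}
    {X : Ω → ℝ} (hX : Measurable[R.field (past ((l + 1) * τ))] X) (hXi : Integrable X μ)
    (hX0 : ∀ ω, 0 ≤ X ω) (m m' : Fin M) (j : ℕ) :
    Integrable (fun ω => X ω * (R.away τ l (l + j) m ω * R.away τ l (l + j) m' ω)) μ ∧
    ∫ ω, X ω * (R.away τ l (l + j) m ω * R.away τ l (l + j) m' ω) ∂μ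
      ≤ (if m = m' then 1 - (h.A : ℝ) / M else (1 - (h.A : ℝ) / M) ^ 2) ^ j * ∫ ω, X ω ∂μ := by
  have hM : (0 : ℝ) < M := by exact_mod_cast hS.one_le_A.trans hS.A_le
  have hq : 0 ≤ 1 - (h.A : ℝ) / M := by
    rw [sub_nonneg, div_le_one hM]
    exact_mod_cast hS.A_le
  set c := if m = m' then 1 - (h.A : ℝ) / M else (1 - (h.A : ℝ) / M) ^ 2 with hc
  have hc0 : 0 ≤ c := by
    rw [hc]
    split_ifs <;> positivity
  induction j with
  | zero => simpa [away_self] using hXi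
  | succ j ih =>
    -- Peel off the last anchor round: its participants are independent of `X` and of the earlier
    -- absences.
    obtain ⟨ih1, ih2⟩ := ih
    set t := (l + j + 1) * τ with ht
    set Y : Ω → ℝ := fun ω => X ω * (R.away τ l (l + j) m ω * R.away τ l (l + j) m' ω) with hY
    have hle1 : (l + 1) * τ ≤ t := Nat.mul_le_mul_right τ (by omega)
    have hle2 : (l + j) * τ + 1 ≤ t := by
      rw [ht, add_mul (l + j) 1 τ]
      omega
    have hYm : Measurable[R.field (past t)] Y :=
      (hX.mono (R.field_mono (past_mono hle1)) le_rfl).mul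
        (((R.measurable_away l (l + j) m).mono (R.field_mono (past_mono hle2)) le_rfl).mul
          ((R.measurable_away l (l + j) m').mono (R.field_mono (past_mono hle2)) le_rfl))
    have hstep : ∀ ω, X ω * (R.away τ l (l + (j + 1)) m ω * R.away τ l (l + (j + 1)) m' ω)
        = Y ω * (absent m (R.participants t ω) * absent m' (R.participants t ω)) := by
      intro ω
      rw [← add_assoc, R.away_succ (by omega), R.away_succ (by omega)]
      simp only [hY, ht]
      ring
    simp only [hstep]
    refine ⟨R.integrable_mul_participants ih1 t fun S => absent m S * absent m' S, ?_⟩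
    rw [R.integral_mul_participants (notMem_past_participants t) hYm
      fun S => absent m S * absent m' S]
    have hY0 : 0 ≤ ∫ ω, Y ω ∂μ := integral_nonneg fun ω =>
      mul_nonneg (hX0 ω) (mul_nonneg (R.away_nonneg _ _ _ _) (R.away_nonneg _ _ _ _))
    have hpair : ∫ ω, absent m (R.participants t ω) * absent m' (R.participants t ω) ∂μ ≤ c := by
      rw [hc]
      split_ifs with hmm
      · subst hmm
        simp only [absent_mul_self]
        rw [R.integral_absent hS.one_le_A hS.A_le]
      · exact R.integral_absent_mul_absent_le hS.one_le_A hS.A_le t hmm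
    calc (∫ ω, Y ω ∂μ) * ∫ ω, absent m (R.participants t ω) * absent m' (R.participants t ω) ∂μ
        ≤ (∫ ω, Y ω ∂μ) * c := mul_le_mul_of_nonneg_left hpair hY0
      _ ≤ (c ^ j * ∫ ω, X ω ∂μ) * c := mul_le_mul_of_nonneg_right ih2 hc0
      _ = _ := by ring

/-- The square of the fraction is an average over pairs of clients: a share `1/M` is diagonal and
decays like `(1-a)^j`, the rest like `(1-a)^(2j)`, where `a = A/M`. -/
theorem integral_mul_awayFrac_sq_le (hS : Setting P h L σ Lσ ς) (hτ : 1 ≤ τ) {l : ℕ}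
    {X : Ω → ℝ} (hX : Measurable[R.field (past ((l + 1) * τ))] X) (hXi : Integrable X μ)
    (hX0 : ∀ ω, 0 ≤ X ω) (j : ℕ) :
    Integrable (fun ω => X ω * R.awayFrac τ l (l + j) ω ^ 2) μ ∧
    ∫ ω, X ω * R.awayFrac τ l (l + j) ω ^ 2 ∂μ
      ≤ ((1 - (h.A : ℝ) / M) * ((1 - (h.A : ℝ) / M) ^ 2) ^ j
          + h.A / M * (1 - (h.A : ℝ) / M) ^ j) * ∫ ω, X ω ∂μ := by
  have hMn : 0 < M := hS.one_le_A.trans hS.A_le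
  have hM : (0 : ℝ) < M := by exact_mod_cast hMn
  have hA : (1 : ℝ) ≤ h.A := by exact_mod_cast hS.one_le_A
  set q := 1 - (h.A : ℝ) / M with hq
  have hq0 : 0 ≤ q := by
    rw [hq, sub_nonneg, div_le_one hM]
    exact_mod_cast hS.A_le
  have hq1 : q ≤ 1 := by
    rw [hq]
    have : 0 ≤ (h.A : ℝ) / M := by positivity
    linarith
  have hp := fun m m' => R.integral_mul_away_mul_away_le hS hτ hX hXi hX0 m m' j
  have hexp : ∀ ω, X ω * R.awayFrac τ l (l + j) ω ^ 2 = ((M : ℝ)⁻¹) ^ 2 *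
      ∑ m, ∑ m', X ω * (R.away τ l (l + j) m ω * R.away τ l (l + j) m' ω) := by
    intro ω
    rw [awayFrac, mul_pow, sq (∑ m, _), Finset.sum_mul_sum]
    simp only [← Finset.mul_sum]
    ring
  simp only [hexp]
  have hint := integrable_finsetSum (Finset.univ : Finset (Fin M)) fun m _ =>
    integrable_finsetSum (Finset.univ : Finset (Fin M)) fun m' _ => (hp m m').1
  refine ⟨hint.const_mul _, ?_⟩
  rw [integral_const_mul, integral_finsetSum _ fun m _ =>
    integrable_finsetSum (Finset.univ : Finset (Fin M)) fun m' _ => (hp m m').1]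
  have hI0 : 0 ≤ ∫ ω, X ω ∂μ := integral_nonneg hX0
  have hrow : ∀ m : Fin M,
      ∫ ω, ∑ m', X ω * (R.away τ l (l + j) m ω * R.away τ l (l + j) m' ω) ∂μ
        ≤ (q ^ j + ((M : ℝ) - 1) * (q ^ 2) ^ j) * ∫ ω, X ω ∂μ := by
    intro m
    rw [integral_finsetSum _ fun m' _ => (hp m m').1]
    refine (Finset.sum_le_sum fun m' _ => (hp m m').2).trans (le_of_eq ?_)
    rw [← Finset.sum_mul]
    congr 1
    rw [← Finset.add_sum_erase _ _ (Finset.mem_univ m), if_pos rfl]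
    congr 1
    rw [Finset.sum_congr rfl (g := fun _ => (q ^ 2) ^ j) fun m' hm' => by
      rw [if_neg (Finset.ne_of_mem_erase hm').symm]]
    rw [Finset.sum_const, Finset.card_erase_of_mem (Finset.mem_univ m), Finset.card_univ,
      Fintype.card_fin, nsmul_eq_mul, Nat.cast_sub hMn, Nat.cast_one]
  calc _ ≤ (M : ℝ)⁻¹ ^ 2 * ∑ _m : Fin M,
        (q ^ j + ((M : ℝ) - 1) * (q ^ 2) ^ j) * ∫ ω, X ω ∂μ := by
        gcongr with m
        exact hrow m
    _ = ((q ^ 2) ^ j + (M : ℝ)⁻¹ * (q ^ j - (q ^ 2) ^ j)) * ∫ ω, X ω ∂μ := by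
        simp only [Finset.sum_const, Finset.card_univ, Fintype.card_fin, nsmul_eq_mul]
        field_simp
        ring
    -- Enlarging the diagonal share from `1/M` to `A/M` makes the kernel depend on `a` alone, so
    -- that a one-variable inequality suffices later.
    _ ≤ ((q ^ 2) ^ j + h.A / M * (q ^ j - (q ^ 2) ^ j)) * ∫ ω, X ω ∂μ := by
        have h1 : (q ^ 2) ^ j ≤ q ^ j := by
          gcongr
          nlinarith
        have h2 : (M : ℝ)⁻¹ ≤ h.A / M := by
          rw [inv_eq_one_div]
          gcongr
        have h3 : 0 ≤ q ^ j - (q ^ 2) ^ j := sub_nonneg.2 h1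
        gcongr
    _ = _ := by
        have : (h.A : ℝ) / M = 1 - q := by rw [hq]; ring
        rw [this]
        ring

theorem memLp_staleness (hS : Setting P h L σ Lσ ς) (τ t : ℕ) : MemLp (R.staleness τ t) 2 μ := by
  have h1 : MemLp (fun ω => ∑ m, ‖R.anchorPt τ t m ω - R.model τ t ω‖) 2 μ :=
    memLp_finsetSum Finset.univ fun m _ =>
      (((R.memLp_run hS τ t).2.2 m).sub (R.memLp_run hS τ t).1).norm
  exact h1.const_mul (M : ℝ)⁻¹

theorem memLp_moveLen (hS : Setting P h L σ Lσ ς) (τ n i : ℕ) : MemLp (R.moveLen τ n i) 2 μ :=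
  ((R.memLp_run hS τ _).1.sub (R.memLp_run hS τ _).1).norm

/-- Pathwise Cauchy–Schwarz with weights `y ^ (n - l)`, then expectation. The lengths of the moves
of cycle `l` are decided before the anchor rounds counted in `awayFrac`, so expectations factor. -/
theorem msq_staleness_le (hS : Setting P h L σ Lσ ς) (hτ : 1 ≤ τ) {y : ℝ} (hy : 0 < y)
    (n i : ℕ) (hi : i < τ - 1) :
    msq μ (R.staleness τ (roundIdx τ n i)) ≤
      (i + (τ - 1 : ℕ) * ∑ j ∈ Finset.range n, y ^ (j + 1)) *
        ∑ l ∈ Finset.range (n + 1), ((1 - (h.A : ℝ) / M) * ((1 - (h.A : ℝ) / M) ^ 2) ^ (n - l)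
          + h.A / M * (1 - (h.A : ℝ) / M) ^ (n - l)) / y ^ (n - l) *
            ∑ j ∈ Finset.range (τ - 1), msq μ (R.moveLen τ l j) := by
  have hMn : 0 < M := hS.one_le_A.trans hS.A_le
  have hmsq : ∀ l j, ∫ ω, R.moveLen τ l j ω ^ 2 ∂μ = msq μ (R.moveLen τ l j) := by
    intro l j
    simp [msq]
  have hsqi : ∀ l j, Integrable (fun ω => R.moveLen τ l j ω ^ 2) μ := by
    intro l j
    simpa using integrable_norm_sq (R.memLp_moveLen hS τ l j)
  have haway : ∀ l ∈ Finset.range n, ∀ j ∈ Finset.range (τ - 1),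
      Integrable (fun ω => R.moveLen τ l j ω ^ 2 * R.awayFrac τ l n ω ^ 2) μ ∧
      ∫ ω, R.moveLen τ l j ω ^ 2 * R.awayFrac τ l n ω ^ 2 ∂μ
      ≤ ((1 - (h.A : ℝ) / M) * ((1 - (h.A : ℝ) / M) ^ 2) ^ (n - l)
          + h.A / M * (1 - (h.A : ℝ) / M) ^ (n - l)) * msq μ (R.moveLen τ l j) := by
    intro l hl j hj
    have hl' := Finset.mem_range.1 hl
    have hj' := Finset.mem_range.1 hj
    have hle : roundIdx τ l j + 1 ≤ (l + 1) * τ := by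
      rw [← roundIdx_last hτ, roundIdx, roundIdx]
      omega
    have := R.integral_mul_awayFrac_sq_le hS hτ (l := l) (X := fun ω => R.moveLen τ l j ω ^ 2)
      (((R.measurable_moveLen hS τ l j).mono (R.field_mono (past_mono hle)) le_rfl).pow_const 2)
      (hsqi l j) (fun ω => sq_nonneg _) (n - l)
    rw [Nat.add_sub_cancel' hl'.le, hmsq] at this
    exact this
  set C := (i + (τ - 1 : ℕ) * ∑ j ∈ Finset.range n, y ^ (j + 1) : ℝ) with hC
  have hC0 : 0 ≤ C := by positivity
  have hi1 : Integrable (fun ω => ∑ j ∈ Finset.range i, R.moveLen τ n j ω ^ 2) μ :=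
    integrable_finsetSum _ fun j _ => hsqi n j
  have hi2 : ∀ l ∈ Finset.range n, Integrable (fun ω => ∑ j ∈ Finset.range (τ - 1),
      (y ^ (n - l))⁻¹ * (R.moveLen τ l j ω ^ 2 * R.awayFrac τ l n ω ^ 2)) μ := fun l hl =>
    integrable_finsetSum _ fun j hj => (haway l hl j hj).1.const_mul _
  have hi3 := integrable_finsetSum _ hi2
  calc msq μ (R.staleness τ (roundIdx τ n i))
      ≤ ∫ ω, C * (∑ j ∈ Finset.range i, R.moveLen τ n j ω ^ 2
          + ∑ l ∈ Finset.range n, ∑ j ∈ Finset.range (τ - 1),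
            (y ^ (n - l))⁻¹ * (R.moveLen τ l j ω ^ 2 * R.awayFrac τ l n ω ^ 2)) ∂μ := by
        refine integral_mono (integrable_norm_sq (R.memLp_staleness hS τ _))
          ((hi1.add hi3).const_mul C) fun ω => ?_
        refine le_trans ?_ (weighted_sum_sq_le hy (τ - 1) n i (fun j => R.moveLen τ n j ω)
          (fun l => R.awayFrac τ l n ω) fun l j => R.moveLen τ l j ω)
        have h1 : 0 ≤ R.staleness τ (roundIdx τ n i) ω := by
          unfold staleness
          positivity
        have h2 := R.staleness_le hτ hMn n i hi.le ω
        simp only [Real.norm_eq_abs, sq_abs]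
        gcongr
    _ = C * (∑ j ∈ Finset.range i, msq μ (R.moveLen τ n j)
          + ∑ l ∈ Finset.range n, ∑ j ∈ Finset.range (τ - 1),
            (y ^ (n - l))⁻¹ * ∫ ω, R.moveLen τ l j ω ^ 2 * R.awayFrac τ l n ω ^ 2 ∂μ) := by
        rw [integral_const_mul, integral_add hi1 hi3, integral_finsetSum _ fun j _ => hsqi n j,
          integral_finsetSum _ hi2]
        congr 2
        · exact Finset.sum_congr rfl fun j _ => hmsq n j
        · refine Finset.sum_congr rfl fun l hl => ?_
          rw [integral_finsetSum _ fun j hj => (haway l hl j hj).1.const_mul _]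
          simp only [integral_const_mul]
    _ ≤ _ := by
        rw [Finset.sum_range_succ _ n, add_comm (∑ j ∈ Finset.range i, msq μ (R.moveLen τ n j))]
        gcongr with l hl
        · rw [Finset.mul_sum]
          refine Finset.sum_le_sum fun j hj => ?_
          rw [div_mul_eq_mul_div, div_eq_inv_mul]
          gcongr
          exact (haway l hl j hj).2
        -- The current cycle enters as `l = n`, where the kernel equals `(1 - a) + a = 1`; its `i`
        -- moves are extended to all `τ - 1`.
        · simp only [Nat.sub_self, pow_zero, mul_one, div_one, sub_add_cancel, one_mul]
          exact Finset.sum_le_sum_of_subset_of_nonneg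
            (Finset.range_subset_range.2 hi.le) fun j _ _ => msq_nonneg _

/-- The total staleness is controlled by the total movement. -/
theorem sum_msq_staleness_le (hS : Setting P h L σ Lσ ς) (hτ : 1 ≤ τ) (J : ℕ) :
    ∑ n ∈ Finset.range J, ∑ i ∈ Finset.range (τ - 1), msq μ (R.staleness τ (roundIdx τ n i))
      ≤ ((τ - 1 : ℕ) : ℝ) ^ 2 * (9 / (5 * ((h.A : ℝ) / M) ^ 2)) *
        ∑ n ∈ Finset.range J, ∑ i ∈ Finset.range (τ - 1), msq μ (R.moveLen τ n i) := by
  have hM : (0 : ℝ) < M := by exact_mod_cast hS.one_le_A.trans hS.A_le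
  have hA : (0 : ℝ) < h.A := by exact_mod_cast hS.one_le_A
  have ha1 : (h.A : ℝ) / M ≤ 1 := by
    rw [div_le_one hM]
    exact_mod_cast hS.A_le
  exact staleness_sum_le (by positivity) ha1 J (τ - 1)
    (fun l => Finset.sum_nonneg fun j _ => msq_nonneg _)
    fun n i hi => R.msq_staleness_le hS hτ (by linarith) n i hi

end Draws

/-! ### Expected descent and telescoping over the cycles. -/

namespace Draws

variable {d M : ℕ} {Z : Type*} [MeasurableSpace Z] {P : Problem d M Z} {h : Params d}
  {Ω : Type*} [MeasurableSpace Ω] {μ : Measure Ω} (R : Draws P h μ) {τ t : ℕ}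
  {L σ Lσ ς : ℝ}

/-- Once sampling errors are removed, the averaged cache differs from `∇F` by a mean of differences
of local gradients. Bounding the norm of the mean by the mean of the norms keeps the average
distance, whose second moment is the smaller one. -/
theorem norm_cacheMean_sub_le (hS : Setting P h L σ Lσ ς) (t : ℕ) (ω : Ω) :
    ‖R.cacheMean τ t ω - R.meanErr τ t ω - gradient P.obj (R.model τ t ω)‖
      ≤ L * R.staleness τ t ω := by
  have hM : (0 : ℝ) < M := by exact_mod_cast hS.one_le_A.trans hS.A_le
  have e : R.cacheMean τ t ω - R.meanErr τ t ω - gradient P.obj (R.model τ t ω)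
      = (M : ℝ)⁻¹ • ∑ m, (gradient (P.localObj m) (R.anchorPt τ t m ω)
        - gradient (P.localObj m) (R.model τ t ω)) := by
    rw [Problem.gradient_obj hS.smooth, cacheMean, meanErr, ← smul_sub, ← smul_sub,
      ← Finset.sum_sub_distrib, ← Finset.sum_sub_distrib]
    simp [cacheErr]
  rw [e, norm_smul, Real.norm_of_nonneg (by positivity), staleness, mul_left_comm]
  gcongr
  rw [Finset.mul_sum]
  exact (norm_sum_le _ _).trans (Finset.sum_le_sum fun m _ => hS.smooth.lipschitz m _ _)

variable [IsProbabilityMeasure μ]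

/-- The objective lies between a constant and a quadratic polynomial in the norm, hence is
integrable along square-integrable iterates. -/
theorem integrable_obj (hS : Setting P h L σ Lσ ς) {Fstar : ℝ} (hF : ∀ x, Fstar ≤ P.obj x)
    {X : Ω → Vec d} (hX : MemLp X 2 μ) : Integrable (fun ω => P.obj (X ω)) μ := by
  have hM : 0 < M := hS.one_le_A.trans hS.A_le
  have hd := Problem.differentiable_obj hS.smooth
  have hub : ∀ x, P.obj x ≤ P.obj 0 + inner ℝ (gradient P.obj 0) x + L / 2 * ‖x‖ ^ 2 := by
    intro x
    simpa using descent_bound hd (Problem.lipschitz_gradient_obj hS.smooth hM) 0 x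
  have hint : Integrable (fun ω => |Fstar| + (|P.obj 0| +
      ‖gradient P.obj 0‖ * ‖X ω‖ + L / 2 * ‖X ω‖ ^ 2)) μ :=
    (integrable_const _).add (((integrable_const _).add
      ((hX.integrable (by norm_num)).norm.const_mul _)).add
        ((integrable_norm_sq hX).const_mul _))
  refine hint.mono' (hd.continuous.comp_aestronglyMeasurable hX.1)
    (Filter.Eventually.of_forall fun ω => ?_)
  have h1 := hub (X ω)
  have h2 := hF (X ω)
  have h3 := real_inner_le_norm (gradient P.obj 0) (X ω)
  have h4 := le_abs_self (P.obj 0)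
  have h5 := neg_abs_le Fstar
  have h6 := abs_nonneg Fstar
  have h7 := abs_nonneg (P.obj 0)
  have h8 : 0 ≤ ‖gradient P.obj 0‖ * ‖X ω‖ := by positivity
  have h9 : 0 ≤ L / 2 * ‖X ω‖ ^ 2 := by
    have := hS.L_pos
    positivity
  rw [Real.norm_eq_abs, abs_le]
  constructor <;> linarith

theorem memLp_gradient_obj (hS : Setting P h L σ Lσ ς) (τ t : ℕ) :
    MemLp (fun ω => gradient P.obj (R.model τ t ω)) 2 μ := by
  simp only [Problem.gradient_obj hS.smooth]
  exact (memLp_finsetSum Finset.univ fun m _ =>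
    memLp_localGrad hS.smooth m (R.memLp_run hS τ t).1).const_smul (M : ℝ)⁻¹

/-- The error of the averaged caching gradient. -/
theorem msq_cacheMean_sub_le (hS : Setting P h L σ Lσ ς) (τ t : ℕ) :
    msq μ (fun ω => R.cacheMean τ t ω - gradient P.obj (R.model τ t ω))
      ≤ 26 / 25 * (L ^ 2 * msq μ (R.staleness τ t)) + 26 * (ς / M) := by
  have hg := R.memLp_cacheMean hS τ t
  have hW := R.memLp_meanErr hS τ t
  have hG := R.memLp_gradient_obj hS τ t
  -- A small `z` loads the loss onto the sampling error, where it only affects `c₀`; the staleness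
  -- factor must stay close to `1`.
  have h1 := msq_add_le ((hg.sub hW).sub hG) hW (z := 1 / 25) (by norm_num)
  have e1 : (fun ω => (R.cacheMean τ t - R.meanErr τ t -
      fun ω => gradient P.obj (R.model τ t ω)) ω + R.meanErr τ t ω)
      = fun ω => R.cacheMean τ t ω - gradient P.obj (R.model τ t ω) := by
    ext1 ω
    simp only [Pi.sub_apply]
    abel
  rw [e1] at h1
  have h2 : msq μ (R.cacheMean τ t - R.meanErr τ t - fun ω => gradient P.obj (R.model τ t ω))
      ≤ L ^ 2 * msq μ (R.staleness τ t) := by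
    have hst := R.memLp_staleness hS τ t
    refine (msq_mono (Y := fun ω => L • R.staleness τ t ω) (hst.const_smul L) fun ω => ?_).trans
      (le_of_eq (msq_smul L _))
    exact (R.norm_cacheMean_sub_le hS t ω).trans (Real.le_norm_self _)
  have h3 := R.msq_meanErr_le hS τ t
  norm_num at h1
  linarith

/-- The error of the averaged local direction. -/
theorem msq_avgDir_sub_gradient_le (hS : Setting P h L σ Lσ ς) (τ t : ℕ) :
    msq μ (fun ω => R.avgDir τ t ω - gradient P.obj (R.model τ t ω))
      ≤ 7 / 8 * msq μ (fun ω => gradient P.obj (R.model τ t ω))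
        + (13 / 6 * (L ^ 2 * msq μ (R.staleness τ t)) + 325 / 6 * (ς / M)) := by
  have hg := R.memLp_cacheMean hS τ t
  have hd := R.memLp_avgDir hS τ t
  have hG := R.memLp_gradient_obj hS τ t
  -- The weights `2` and `3/2` give `3 · 7/60 · 5/2 = 7/8`, below `1`, for the gradient, and `3/2 +
  -- 7/20 · 5/3 = 25/12` for the cache error. Multiplied by `26/25` and `26`, the latter becomes
  -- `13/6` and `325/6`.
  have h1 := msq_add_le (hd.sub hg) (hg.sub hG) (z := 2) (by norm_num)
  have h2 := msq_add_le hG (hg.sub hG) (z := 3 / 2) (by norm_num)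
  have e1 : (fun ω => (R.avgDir τ t - R.cacheMean τ t) ω + (R.cacheMean τ t -
      fun ω => gradient P.obj (R.model τ t ω)) ω)
      = fun ω => R.avgDir τ t ω - gradient P.obj (R.model τ t ω) := by
    ext1 ω
    simp only [Pi.sub_apply]
    abel
  have e2 : (fun ω => gradient P.obj (R.model τ t ω) + (R.cacheMean τ t -
      fun ω => gradient P.obj (R.model τ t ω)) ω) = R.cacheMean τ t := by
    ext1 ω
    simp only [Pi.sub_apply]
    abel
  rw [e1] at h1
  rw [e2] at h2
  have h3 := R.msq_avgDir_sub_le hS τ t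
  have h4 := R.msq_cacheMean_sub_le hS τ t
  have e3 : (R.avgDir τ t - R.cacheMean τ t) = fun ω => R.avgDir τ t ω - R.cacheMean τ t ω := rfl
  have e4 : (R.cacheMean τ t - fun ω => gradient P.obj (R.model τ t ω))
      = fun ω => R.cacheMean τ t ω - gradient P.obj (R.model τ t ω) := rfl
  rw [e3, e4] at h1
  rw [e4] at h2
  norm_num at h1 h2
  linarith

/-- Expected decrease of the objective in a round of miners. -/
theorem integral_obj_succ_le (hS : Setting P h L σ Lσ ς) {Fstar : ℝ} (hF : ∀ x, Fstar ≤ P.obj x)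
    {γ : ℝ} (hγ : 0 < γ) (hγ' : h.ηs * h.ηl * h.K = γ) (ht : t % τ ≠ 0) :
    ∫ ω, P.obj (R.model τ (t + 1) ω) ∂μ
      + (γ / 16 * msq μ (fun ω => gradient P.obj (R.model τ t ω))
        + (1 - L * γ) / (2 * γ) * msq μ (fun ω => R.model τ (t + 1) ω - R.model τ t ω)
        - γ / 2 * (13 / 6 * (L ^ 2 * msq μ (R.staleness τ t)) + 325 / 6 * (ς / M)))
      ≤ ∫ ω, P.obj (R.model τ t ω) ∂μ := by
  have hM : 0 < M := hS.one_le_A.trans hS.A_le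
  have hx := (R.memLp_run hS τ t).1
  have hd := R.memLp_avgDir hS τ t
  have hG := R.memLp_gradient_obj hS τ t
  have hF0 := integrable_obj hS hF hx
  have hF1 := integrable_obj hS hF (R.memLp_run hS τ (t + 1)).1
  have hGi := integrable_norm_sq hG
  have hdi := integrable_norm_sq hd
  have hdG : Integrable (fun ω => ‖R.avgDir τ t ω - gradient P.obj (R.model τ t ω)‖ ^ 2) μ :=
    integrable_norm_sq (hd.sub hG)
  have hpt : ∀ ω, P.obj (R.model τ (t + 1) ω) ≤ P.obj (R.model τ t ω)
      + (-(γ / 2) * ‖gradient P.obj (R.model τ t ω)‖ ^ 2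
      + (-(γ / 2 * (1 - L * γ)) * ‖R.avgDir τ t ω‖ ^ 2
      + γ / 2 * ‖R.avgDir τ t ω - gradient P.obj (R.model τ t ω)‖ ^ 2)) := by
    intro ω
    have h1 := descent_bound (Problem.differentiable_obj hS.smooth)
      (Problem.lipschitz_gradient_obj hS.smooth hM) (R.model τ t ω) (-(γ • R.avgDir τ t ω))
    rw [← sub_eq_add_neg, ← hγ', ← R.model_succ_eq hS ht, hγ', inner_neg_right, norm_neg,
      real_inner_smul_right, norm_smul, Real.norm_of_nonneg hγ.le] at h1
    -- Polarization trades the inner product of direction and gradient for three squares. The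
    -- coefficient `1/16` of the gradient is half of `1 - 7/8`.
    have h2 := norm_sub_sq_real (R.avgDir τ t ω) (gradient P.obj (R.model τ t ω))
    rw [real_inner_comm] at h2
    rw [h2]
    refine h1.trans (le_of_eq ?_)
    ring
  have hmove : msq μ (fun ω => R.model τ (t + 1) ω - R.model τ t ω) = γ ^ 2 * msq μ (R.avgDir τ t) := by
    rw [← neg_sq, ← msq_smul]
    congr 1
    ext1 ω
    rw [R.model_succ_eq hS ht, hγ']
    simp
  have hI2 : Integrable (fun ω => -(γ / 2 * (1 - L * γ)) * ‖R.avgDir τ t ω‖ ^ 2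
      + γ / 2 * ‖R.avgDir τ t ω - gradient P.obj (R.model τ t ω)‖ ^ 2) μ :=
    (hdi.const_mul _).add (hdG.const_mul _)
  have hI1 : Integrable (fun ω => -(γ / 2) * ‖gradient P.obj (R.model τ t ω)‖ ^ 2
      + (-(γ / 2 * (1 - L * γ)) * ‖R.avgDir τ t ω‖ ^ 2
      + γ / 2 * ‖R.avgDir τ t ω - gradient P.obj (R.model τ t ω)‖ ^ 2)) μ :=
    (hGi.const_mul _).add hI2
  have hint := integral_mono hF1 (hF0.add hI1 : Integrable (fun ω => _ + _) μ) hpt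
  have e : ∫ ω, (P.obj (R.model τ t ω) +
      (-(γ / 2) * ‖gradient P.obj (R.model τ t ω)‖ ^ 2
      + (-(γ / 2 * (1 - L * γ)) * ‖R.avgDir τ t ω‖ ^ 2
      + γ / 2 * ‖R.avgDir τ t ω - gradient P.obj (R.model τ t ω)‖ ^ 2))) ∂μ
      = ∫ ω, P.obj (R.model τ t ω) ∂μ
      + (-(γ / 2) * msq μ (fun ω => gradient P.obj (R.model τ t ω))
      + (-(γ / 2 * (1 - L * γ)) * msq μ (R.avgDir τ t)
      + γ / 2 * msq μ (fun ω => R.avgDir τ t ω - gradient P.obj (R.model τ t ω)))) := by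
    rw [integral_add hF0 hI1, integral_add (hGi.const_mul _) hI2,
      integral_add (hdi.const_mul _) (hdG.const_mul (γ / 2)), integral_const_mul,
      integral_const_mul, integral_const_mul]
    rfl
  rw [e] at hint
  have hdev := mul_le_mul_of_nonneg_left (R.msq_avgDir_sub_gradient_le hS τ t)
    (by positivity : 0 ≤ γ / 2)
  have e5 : (1 - L * γ) / (2 * γ) * (γ ^ 2 * msq μ (R.avgDir τ t))
      = γ / 2 * (1 - L * γ) * msq μ (R.avgDir τ t) := by
    field_simp
  rw [hmove, e5]
  linarith

/-- Anchor rounds leave the model fixed, so the end of one cycle and the first round of miners of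
the next have the same objective value. -/
theorem telescope_obj (hτ : 1 ≤ τ) {c : ℕ → ℕ → ℝ}
    (hc : ∀ n, ∀ i < τ - 1, ∫ ω, P.obj (R.model τ (roundIdx τ n i + 1) ω) ∂μ + c n i
      ≤ ∫ ω, P.obj (R.model τ (roundIdx τ n i) ω) ∂μ) (J : ℕ) :
    ∫ ω, P.obj (R.model τ (roundIdx τ J 0) ω) ∂μ
      + ∑ n ∈ Finset.range J, ∑ i ∈ Finset.range (τ - 1), c n i ≤ P.obj h.x₀ := by
  have hanchor : ∀ n ω, R.model τ (roundIdx τ n 0) ω = R.model τ (n * τ) ω := fun n ω =>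
    R.model_succ_anchor (Nat.mul_mod_left n τ) ω
  have hinner : ∀ n, ∀ i ≤ τ - 1, ∫ ω, P.obj (R.model τ (roundIdx τ n i) ω) ∂μ
      + ∑ j ∈ Finset.range i, c n j ≤ ∫ ω, P.obj (R.model τ (roundIdx τ n 0) ω) ∂μ := by
    intro n i
    induction i with
    | zero => simp
    | succ i ih =>
      intro hi
      have h1 := ih (by omega)
      have h2 := hc n i (by omega)
      have e : roundIdx τ n (i + 1) = roundIdx τ n i + 1 := rfl
      rw [e, Finset.sum_range_succ]
      linarith
  induction J with
  | zero =>
    simp only [hanchor]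
    simp [model, run]
  | succ J ih =>
    have h1 := hinner J (τ - 1) le_rfl
    rw [roundIdx_last hτ] at h1
    simp only [hanchor (J + 1)]
    rw [Finset.sum_range_succ]
    linarith

/-- The average squared gradient norm over the rounds of miners of the first `J` cycles. -/
theorem sum_msq_gradient_le (hS : Setting P h L σ Lσ ς) {Fstar : ℝ} (hF : ∀ x, Fstar ≤ P.obj x)
    {γ : ℝ} (hγ' : h.ηs * h.ηl * h.K = γ) (hτ : 1 ≤ τ)
    (hγL : L * γ * ((h.A : ℝ) / M + 2 * τ) = (h.A : ℝ) / M) (J : ℕ) :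
    ∑ n ∈ Finset.range J, ∑ i ∈ Finset.range (τ - 1),
        msq μ (fun ω => gradient P.obj (R.model τ (roundIdx τ n i) ω))
      ≤ 16 / γ * (P.obj h.x₀ - Fstar) + J * (τ - 1 : ℕ) * (1300 / 3 * (ς / M)) := by
  have hM : (0 : ℝ) < M := by exact_mod_cast hS.one_le_A.trans hS.A_le
  have hA : (0 : ℝ) < h.A := by exact_mod_cast hS.one_le_A
  have hL := hS.L_pos
  set a := (h.A : ℝ) / M with ha
  have ha0 : 0 < a := by positivity
  have hs : 0 < a + 2 * τ := by positivity
  have hLγ : L * γ = a / (a + 2 * τ) := by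
    rw [eq_div_iff hs.ne']
    exact hγL
  have hγ : 0 < γ := by
    have : 0 < L * γ := by
      rw [hLγ]
      positivity
    exact pos_of_mul_pos_right this hL.le
  set N := τ - 1 with hN
  have hNτ : (N : ℝ) = τ - 1 := by
    rw [hN, Nat.cast_sub hτ, Nat.cast_one]
  set G := ∑ n ∈ Finset.range J, ∑ i ∈ Finset.range N,
    msq μ (fun ω => gradient P.obj (R.model τ (roundIdx τ n i) ω)) with hGdef
  set S := ∑ n ∈ Finset.range J, ∑ i ∈ Finset.range N,
    msq μ (R.staleness τ (roundIdx τ n i)) with hSdef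
  set D := ∑ n ∈ Finset.range J, ∑ i ∈ Finset.range N, msq μ (R.moveLen τ n i) with hDdef
  have hD0 : 0 ≤ D := Finset.sum_nonneg fun n _ => Finset.sum_nonneg fun i _ => msq_nonneg _
  have hSD : S ≤ (N : ℝ) ^ 2 * (9 / (5 * a ^ 2)) * D := R.sum_msq_staleness_le hS hτ J
  have hmove : ∀ n i, msq μ (fun ω => R.model τ (roundIdx τ n i + 1) ω
      - R.model τ (roundIdx τ n i) ω) = msq μ (R.moveLen τ n i) := by
    intro n i
    simp [msq, moveLen]
  have htel := R.telescope_obj hτ (fun n i hi =>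
    R.integral_obj_succ_le hS hF hγ hγ' (roundIdx_mod hi)) J
  have hlow : Fstar ≤ ∫ ω, P.obj (R.model τ (roundIdx τ J 0) ω) ∂μ := by
    have := integral_mono (integrable_const Fstar)
      (integrable_obj hS hF (R.memLp_run hS τ (roundIdx τ J 0)).1) fun ω => hF _
    simpa using this
  have hsum : ∑ n ∈ Finset.range J, ∑ i ∈ Finset.range N,
      (γ / 16 * msq μ (fun ω => gradient P.obj (R.model τ (roundIdx τ n i) ω))
        + (1 - L * γ) / (2 * γ) * msq μ (fun ω => R.model τ (roundIdx τ n i + 1) ω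
          - R.model τ (roundIdx τ n i) ω)
        - γ / 2 * (13 / 6 * (L ^ 2 * msq μ (R.staleness τ (roundIdx τ n i)))
          + 325 / 6 * (ς / M)))
      = γ / 16 * G + (1 - L * γ) / (2 * γ) * D
        - γ / 2 * (13 / 6 * (L ^ 2 * S) + J * N * (325 / 6 * (ς / M))) := by
    simp only [hmove, hGdef, hSdef, hDdef, Finset.sum_sub_distrib, Finset.sum_add_distrib,
      ← Finset.mul_sum, Finset.sum_const, Finset.card_range, nsmul_eq_mul]
    ring
  rw [hsum] at htel
  -- The choice of step size enters here: `Lγ = a / (a + 2τ)` reduces the claim to `39/10 · (τ-1)² ≤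
  -- 2τ (a + 2τ)`, which holds as the right side exceeds `4τ²`.
  have hkey : γ / 2 * (13 / 6 * (L ^ 2 * S)) ≤ (1 - L * γ) / (2 * γ) * D := by
    have h1 : γ / 2 * (13 / 6 * (L ^ 2 * S))
        ≤ γ / 2 * (13 / 6 * (L ^ 2 * ((N : ℝ) ^ 2 * (9 / (5 * a ^ 2)) * D))) := by gcongr
    refine h1.trans ?_
    have h2 : γ / 2 * (13 / 6 * (L ^ 2 * ((N : ℝ) ^ 2 * (9 / (5 * a ^ 2)) * D)))
        = ((L * γ) ^ 2 * (39 / 10 * (N : ℝ) ^ 2 / a ^ 2)) / (2 * γ) * D := by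
      field_simp
      ring
    rw [h2]
    gcongr
    rw [hLγ]
    have h3 : (a / (a + 2 * τ)) ^ 2 * (39 / 10 * (N : ℝ) ^ 2 / a ^ 2)
        = 39 / 10 * (N : ℝ) ^ 2 / (a + 2 * τ) ^ 2 := by
      field_simp
    have h4 : 1 - a / (a + 2 * τ) = 2 * τ * (a + 2 * τ) / (a + 2 * τ) ^ 2 := by
      field_simp
      ring
    have hτ1 : (1 : ℝ) ≤ τ := by exact_mod_cast hτ
    have h5 : 39 / 10 * (N : ℝ) ^ 2 ≤ 2 * τ * (a + 2 * τ) := by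
      rw [hNτ]
      nlinarith [mul_nonneg (by linarith : (0 : ℝ) ≤ τ) ha0.le]
    rw [h3, h4]
    exact div_le_div_of_nonneg_right h5 (by positivity)
  have h5 : γ / 16 * G ≤ P.obj h.x₀ - Fstar + γ / 2 * (J * N * (325 / 6 * (ς / M))) := by
    linarith
  have h6 := mul_le_mul_of_nonneg_left h5 (by positivity : 0 ≤ 16 / γ)
  have e1 : 16 / γ * (γ / 16 * G) = G := by
    field_simp
  have e2 : 16 / γ * (P.obj h.x₀ - Fstar + γ / 2 * (J * N * (325 / 6 * (ς / M))))
      = 16 / γ * (P.obj h.x₀ - Fstar) + J * N * (1300 / 3 * (ς / M)) := by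
    field_simp
    ring
  rw [e1, e2] at h6
  exact h6

end Draws

/-! ### Almost sure schedule and exact costs of a cycle. -/

theorem eq_of_periodic_increments {u : ℕ → ℕ} {τ α β : ℕ} (hτ : 1 ≤ τ)
    (hu : ∀ t, u (t + 1) = u t + if t % τ = 0 then α else β) (J : ℕ) :
    u (J * τ) = u 0 + J * (α + (τ - 1) * β) := by
  induction J with
  | zero => simp
  | succ J ih =>
    have h1 : ∀ i ≤ τ - 1, u (roundIdx τ J i) = u (J * τ) + α + i * β := by
      intro i
      induction i with
      | zero =>
        intro _
        have h2 := hu (J * τ)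
        simpa [roundIdx] using h2
      | succ i ihi =>
        intro hi
        have h2 := hu (roundIdx τ J i)
        rw [if_neg (roundIdx_mod (by omega)), ihi (by omega)] at h2
        change u (roundIdx τ J i + 1) = _
        rw [h2]
        ring
    have h2 := h1 (τ - 1) le_rfl
    rw [roundIdx_last hτ, ih] at h2
    rw [h2]
    ring

namespace Draws

variable {d M : ℕ} {Z : Type*} [MeasurableSpace Z] {P : Problem d M Z} {h : Params d}
  {Ω : Type*} [MeasurableSpace Ω] {μ : Measure Ω} (R : Draws P h μ) {τ : ℕ}

theorem miner_grads (ω : Ω) (t : ℕ) (i : Fin M) (x g : Vec d) (k : ℕ) :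
    (R.miner ω t i x g k).grads = k * (2 * h.b') := by
  induction k with
  | zero => simp [miner]
  | succ k ih => simp [miner, ih, add_mul]

/-- Every round has `A` participants, and these are anchors exactly in the rounds divisible
by `τ`. -/
def Sequential (τ : ℕ) (ω : Ω) : Prop :=
  ∀ t, (R.participants t ω).card = h.A ∧ ∀ m, R.coin t m ω = decide (t % τ = 0)

theorem ae_sequential [IsProbabilityMeasure μ] (hp : h.p = seqProb τ) :
    ∀ᵐ ω ∂μ, R.Sequential τ ω := by
  refine ae_all_iff.2 fun t => (R.ae_card_participants t).and (ae_all_iff.2 fun m => ?_)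
  have hlaw := R.coin_law t m
  rw [hp, seqProb] at hlaw
  have hms : MeasurableSet {ω | R.coin t m ω = true} :=
    R.coin_meas t m (measurableSet_singleton true)
  by_cases ht : t % τ = 0
  · rw [if_pos ht, ENNReal.ofReal_one] at hlaw
    filter_upwards [(prob_compl_eq_zero_iff hms).2 hlaw] with ω hω
    simpa [ht] using hω
  · rw [if_neg ht, ENNReal.ofReal_zero] at hlaw
    filter_upwards [measure_eq_zero_iff_ae_notMem.1 hlaw] with ω hω
    simpa [ht] using hω

namespace Sequential

variable {R} {ω : Ω} {t : ℕ}

theorem anchors_eq (hω : R.Sequential τ ω) (t : ℕ) :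
    R.anchors ω t = if t % τ = 0 then R.participants t ω else ∅ := by
  by_cases ht : t % τ = 0 <;> simp [anchors, (hω t).2, ht]

theorem miners_eq (hω : R.Sequential τ ω) (t : ℕ) :
    R.miners ω t = if t % τ = 0 then ∅ else R.participants t ω := by
  by_cases ht : t % τ = 0 <;> simp [miners, (hω t).2, ht]

/-- When all participants share one role, the number of miners is `0` or `A`, so the division by the
random number of miners becomes division by `A`. -/
theorem state_eq_run (hω : R.Sequential τ ω) (hA : 1 ≤ h.A) (t : ℕ) :
    (R.state ω t).x = R.model τ t ω ∧ (R.state ω t).v = (R.run τ ω t).cache := by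
  induction t with
  | zero => exact ⟨rfl, rfl⟩
  | succ t ih =>
    obtain ⟨hx, hv⟩ := ih
    rw [model] at hx ⊢
    simp only [state, round, run, State.g, hω.anchors_eq, hω.miners_eq, hx, hv]
    by_cases ht : t % τ = 0
    · simp [ht]
    · simp [ht, (hω t).1, Nat.one_le_iff_ne_zero.1 hA]

theorem gradCount_eq (hω : R.Sequential τ ω) (hτ : 1 ≤ τ) (J : ℕ) :
    R.gradCount ω (J * τ)
      = M * h.b + J * (h.A * h.b + (τ - 1) * (h.A * (h.K * (2 * h.b')))) := by
  refine eq_of_periodic_increments (u := R.gradCount ω) hτ (fun t => ?_) J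
  simp only [gradCount, state, round, hω.anchors_eq, hω.miners_eq, miner_grads]
  by_cases ht : t % τ = 0 <;> simp [ht, (hω t).1]

theorem vecs_eq (hω : R.Sequential τ ω) (hτ : 1 ≤ τ) (J : ℕ) :
    (R.state ω (J * τ)).vecs = M + J * (2 * h.A + (τ - 1) * (3 * h.A)) := by
  refine eq_of_periodic_increments (u := fun t => (R.state ω t).vecs) hτ (fun t => ?_) J
  simp only [state, round, hω.anchors_eq, hω.miners_eq]
  by_cases ht : t % τ = 0 <;> simp [ht, (hω t).1]

end Sequential

end Draws

/-! ### Comparison of the periods -/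

theorem roundBound_two_lt {M A τ : ℕ} {ε : ℝ} (hA : 1 ≤ A) (hAM : A ≤ M) (hε : 0 < ε)
    (hτ : 2 < τ) : roundBound M A 2 ε < roundBound M A τ ε := by
  have hA' : (1 : ℝ) ≤ A := by exact_mod_cast hA
  have hAM' : (A : ℝ) ≤ M := by exact_mod_cast hAM
  have hτ' : (3 : ℝ) ≤ τ := by exact_mod_cast hτ
  have hc : 1 ≤ (M : ℝ) / A := (one_le_div (by linarith)).2 hAM'
  unfold roundBound
  refine mul_lt_mul_of_pos_right ?_ (by positivity)
  have e1 : ∀ s : ℝ, 2 * (M : ℝ) * s / A = 2 * ((M : ℝ) / A) * s := fun s => by ring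
  rw [e1, e1, ← mul_div_assoc _ (τ : ℝ), lt_div_iff₀ (by linarith)]
  generalize (M : ℝ) / A = c at hc
  push_cast
  -- With `c = M/A ≥ 1`, this is exactly `(1 + 2cτ) τ - 2 (1 + 4c) (τ - 1)`.
  have h1 : 0 < ((τ : ℝ) - 2) * (2 * c * ((τ : ℝ) - 2) - 1) :=
    mul_pos (by linarith) (by nlinarith)
  norm_num
  nlinarith

theorem gradBound_two_lt {M K b b' τ : ℕ} {ε : ℝ} (hM : 1 ≤ M) (hK : 1 ≤ K) (hb' : 1 ≤ b')
    (hε : 0 < ε) (hτ : 2 < τ) : gradBound M K b b' 2 ε < gradBound M K b b' τ ε := by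
  have hM' : (0 : ℝ) < M := by exact_mod_cast hM
  have hK' : (0 : ℝ) < K := by exact_mod_cast hK
  have hb'' : (0 : ℝ) < b' := by exact_mod_cast hb'
  have hτ' : ((2 : ℕ) : ℝ) < τ := by exact_mod_cast hτ
  unfold gradBound
  gcongr

theorem commBound_two_lt {M A τ : ℕ} {ε : ℝ} (hA : 1 ≤ A) (hM : 1 ≤ M) (hε : 0 < ε)
    (hτ : 2 < τ) : commBound M A 2 ε < commBound M A τ ε := by
  have hM' : (0 : ℝ) < M := by exact_mod_cast hM
  have hA' : (0 : ℝ) < A := by exact_mod_cast hA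
  have hτ' : ((2 : ℕ) : ℝ) < τ := by exact_mod_cast hτ
  unfold commBound
  gcongr

/-! ### The learning rates -/

theorem ηl_smooth_of_le {η L : ℝ} {K : ℕ} (hη : 0 < η) (hL : 0 < L) (hK : 1 ≤ K)
    (hle : η ≤ 1 / (2 * Real.sqrt 6 * K * L)) : 24 * η ^ 2 * L ^ 2 * (K : ℝ) ^ 2 ≤ 1 := by
  have hK' : (0 : ℝ) < K := by exact_mod_cast hK
  rw [le_div_iff₀ (by positivity)] at hle
  have h1 : (η * (2 * Real.sqrt 6 * K * L)) ^ 2 ≤ 1 := pow_le_one₀ (by positivity) hle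
  have h6 : Real.sqrt 6 ^ 2 = 6 := Real.sq_sqrt (by norm_num)
  calc _ = η ^ 2 * (4 * 6 * K ^ 2 * L ^ 2) := by ring
    _ = (η * (2 * Real.sqrt 6 * K * L)) ^ 2 := by
      rw [mul_pow η, mul_pow, mul_pow, mul_pow, h6]
      ring
    _ ≤ 1 := h1

theorem ηl_noise_of_le {η Lσ : ℝ} {K b' : ℕ} (hη : 0 < η) (hLσ : 0 ≤ Lσ) (hK : 1 ≤ K)
    (hb' : 1 ≤ b') (hle : 4 * Real.sqrt 3 * Lσ * η ≤ Real.sqrt ((b' : ℝ) / K)) :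
    48 * (Lσ ^ 2 / b') * η ^ 2 * K ≤ 1 := by
  have hK' : (0 : ℝ) < K := by exact_mod_cast hK
  have hb'' : (0 : ℝ) < b' := by exact_mod_cast hb'
  have h1 := pow_le_pow_left₀ (by positivity) hle 2
  rw [Real.sq_sqrt (by positivity), le_div_iff₀ hK'] at h1
  have h3 : Real.sqrt 3 ^ 2 = 3 := Real.sq_sqrt (by norm_num)
  have h2 : 48 * (Lσ ^ 2 / b') * η ^ 2 * K = (4 * Real.sqrt 3 * Lσ * η) ^ 2 * K / b' := by
    rw [mul_pow, mul_pow, mul_pow, h3]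
    ring
  rw [h2]
  exact (div_le_one hb'').2 h1

/-! ### The number of rounds -/

/-- A number `J` of periods that suffices for accuracy `ε`, and the size of `J` in terms of the
complexity bounds. -/
theorem exists_periods {M A τ : ℕ} {L Δ ε ε₀ : ℝ} (hL : 0 < L) (hΔ : 0 ≤ Δ) (hε : 0 < ε)
    (hεε₀ : ε ≤ ε₀) (hA : 1 ≤ A) (hAM : A ≤ M) (hτ : 2 ≤ τ) :
    ∃ J : ℕ, 1 ≤ J ∧
      32 * Δ * L * (1 + 2 * (M : ℝ) * τ / A) / ε ≤ J * (τ - 1 : ℕ) ∧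
      (J * τ : ℕ) ≤ (32 * Δ * L + ε₀) * roundBound M A τ ε ∧
      (J : ℝ) * A ≤ (192 * Δ * L + 2 * ε₀) * (M / ε) ∧
      (J : ℝ) * (τ - 1 : ℕ) * A ≤ (96 * Δ * L + 2 * ε₀) * (M * τ / ε) := by
  have hA1 : (1 : ℝ) ≤ A := by exact_mod_cast hA
  have hA0 : (0 : ℝ) < A := by linarith
  have hAM' : (A : ℝ) ≤ M := by exact_mod_cast hAM
  have hM0 : (0 : ℝ) < M := by linarith
  have hτ2 : (2 : ℝ) ≤ τ := by exact_mod_cast hτ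
  have hN : ((τ - 1 : ℕ) : ℝ) = (τ : ℝ) - 1 := by
    rw [Nat.cast_sub (by omega)]
    simp
  rw [hN]
  set N : ℝ := (τ : ℝ) - 1 with hNdef
  have hN1 : 1 ≤ N := by linarith
  have hN0 : 0 < N := by linarith
  have hΔL : 0 ≤ Δ * L := by positivity
  set W : ℝ := 1 + 2 * (M : ℝ) * τ / A with hW
  have hWA : W * A = A + 2 * (M * τ) := by
    rw [hW]
    field_simp
  have hWA' : W * A ≤ 3 * (M * τ) := by nlinarith
  have hWτ : 2 * (τ : ℝ) ≤ W := by
    have : 2 * (τ : ℝ) ≤ 2 * (M : ℝ) * τ / A := by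
      rw [le_div_iff₀ hA0]
      nlinarith
    linarith
  set X : ℝ := 32 * Δ * L * W / ε with hX
  have hX0 : 0 ≤ X := by positivity
  have hXA : X * A ≤ 96 * Δ * L * (M * τ / ε) := by
    have e1 : X * A = 32 * (Δ * L) / ε * (W * A) := by
      rw [hX]
      ring
    have e2 : 96 * Δ * L * (M * τ / ε) = 32 * (Δ * L) / ε * (3 * (M * τ)) := by ring
    rw [e1, e2]
    gcongr
  have hone : 1 ≤ ε₀ / ε := (one_le_div hε).2 hεε₀
  have hceil := Nat.le_ceil (X / N)
  have hceil' := (Nat.ceil_lt_add_one (a := X / N) (by positivity)).le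
  -- The extra `1` guarantees a cycle even if `Δ = 0`. The additive `2` in `J ≤ X / N + 2` is
  -- absorbed by `ε₀ / ε ≥ 1`; this is why the constant depends on `ε₀`.
  refine ⟨⌈X / N⌉₊ + 1, by omega, ?_, ?_, ?_, ?_⟩
  · push_cast
    rw [div_le_iff₀ hN0] at hceil
    linarith
  · have hle : ((⌈X / N⌉₊ + 1 : ℕ) : ℝ) ≤ X / N + 2 := by
      push_cast
      linarith
    rw [Nat.cast_mul]
    refine (mul_le_mul_of_nonneg_right hle (by linarith)).trans ?_
    have e1 : X / N * τ = 32 * Δ * L * roundBound M A τ ε := by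
      rw [roundBound, ← hW, ← hNdef, hX]
      field_simp
    have e2 : 2 * (τ : ℝ) ≤ ε₀ * roundBound M A τ ε := by
      have e3 : ε₀ * roundBound M A τ ε = W * (τ / N) * (ε₀ / ε) := by
        rw [roundBound, ← hW, ← hNdef]
        ring
      have e4 : 1 ≤ (τ : ℝ) / N := (one_le_div hN0).2 (by linarith)
      rw [e3]
      calc 2 * (τ : ℝ) = 2 * τ * 1 * 1 := by ring
        _ ≤ W * (τ / N) * (ε₀ / ε) := by gcongr
    linarith
  · have hle : ((⌈X / N⌉₊ + 1 : ℕ) : ℝ) ≤ X / N + 2 := by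
      push_cast
      linarith
    refine (mul_le_mul_of_nonneg_right hle hA0.le).trans ?_
    have e1 : X / N * A ≤ 192 * Δ * L * (M / ε) := by
      rw [div_mul_eq_mul_div, div_le_iff₀ hN0]
      refine hXA.trans ?_
      have e2 : 96 * Δ * L * (M * τ / ε) = 96 * (Δ * L) * M / ε * τ := by ring
      have e3 : 192 * Δ * L * (M / ε) * N = 96 * (Δ * L) * M / ε * (2 * N) := by ring
      rw [e2, e3]
      gcongr
      linarith
    have e2 : 2 * (A : ℝ) ≤ 2 * ε₀ * (M / ε) := by
      have e3 : 2 * ε₀ * (M / ε) = 2 * M * (ε₀ / ε) := by ring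
      rw [e3]
      calc 2 * (A : ℝ) = 2 * A * 1 := by ring
        _ ≤ 2 * M * (ε₀ / ε) := by gcongr
    linarith
  · have hle : ((⌈X / N⌉₊ + 1 : ℕ) : ℝ) * N ≤ X + 2 * N := by
      push_cast
      rw [← sub_le_iff_le_add, le_div_iff₀ hN0] at hceil'
      linarith
    refine (mul_le_mul_of_nonneg_right hle hA0.le).trans ?_
    have e2 : 2 * N * A ≤ 2 * ε₀ * (M * τ / ε) := by
      have e3 : 2 * ε₀ * (M * τ / ε) = 2 * τ * M * (ε₀ / ε) := by ring
      rw [e3]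
      calc 2 * N * A = 2 * N * A * 1 := by ring
        _ ≤ 2 * τ * M * (ε₀ / ε) := by
          gcongr
          linarith
    linarith

theorem exists_le_of_double_sum_le {J N : ℕ} (hJ : 1 ≤ J) (hN : 1 ≤ N) {u : ℕ → ℕ → ℝ} {c : ℝ}
    (hu : ∑ n ∈ Finset.range J, ∑ i ∈ Finset.range N, u n i ≤ J * N * c) :
    ∃ n < J, ∃ i < N, u n i ≤ c := by
  by_contra! hlt
  have hJ' : (Finset.range J).Nonempty := Finset.nonempty_range_iff.2 (by omega)
  have hN' : (Finset.range N).Nonempty := Finset.nonempty_range_iff.2 (by omega)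
  have h1 := Finset.sum_lt_sum_of_nonempty hJ' fun n hn => Finset.sum_lt_sum_of_nonempty hN'
    fun i hi => hlt n (Finset.mem_range.1 hn) i (Finset.mem_range.1 hi)
  simp only [Finset.sum_const, Finset.card_range, nsmul_eq_mul] at h1
  linarith

end FedAMD

/-! ### Assembly of the theorem. -/

open FedAMD

theorem corollary2 :
    -- an absolute constant
    ∃ c₀ : ℝ, 0 < c₀ ∧
    -- the smoothness constant, the initial gap and the largest accuracy are treated as constants
    ∀ L Δ ε₀ : ℝ, 0 < L → 0 ≤ Δ → 0 < ε₀ →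
    ∃ C : ℝ, 0 < C ∧
    ∀ {d M : ℕ} {Z : Type*} [MeasurableSpace Z] (P : FedAMD.Problem d M Z) (h : FedAMD.Params d)
      {Ω : Type*} [MeasurableSpace Ω] (μ : Measure Ω) [IsProbabilityMeasure μ]
      (R : FedAMD.Draws P h μ) (σ Lσ Fstar ε κ : ℝ) (τ : ℕ),
      -- the problem
      P.Regular → P.LSmooth L →
      0 ≤ σ → P.BoundedNoise σ →
      0 ≤ Lσ → P.AverageSmooth Lσ →
      IsGLB (Set.range P.obj) Fstar → P.obj h.x₀ - Fstar ≤ Δ →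
      -- participation, accuracy, sequential probabilities
      1 ≤ h.A → h.A ≤ M → 1 ≤ h.K →
      0 < ε → ε ≤ ε₀ →
      2 ≤ τ → h.p = FedAMD.seqProb τ →
      -- batch sizes
      0 < κ →
      (h.b : ℕ∞) = min ((⌈κ * σ ^ 2 / (M * ε)⌉₊ : ℕ) : ℕ∞) P.data.size →
      1 ≤ h.b' → h.b' < h.b →
      -- learning rates
      0 < h.ηl →
      h.ηs * h.ηl = 1 / (h.K * L) * (1 + 2 * (M : ℝ) * τ / h.A)⁻¹ →
      h.ηl ≤ 1 / (2 * Real.sqrt 6 * h.K * L) →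
      4 * Real.sqrt 3 * Lσ * h.ηl ≤ Real.sqrt ((h.b' : ℝ) / h.K) →
      -- number of rounds, accuracy, gradients, communication
      (∃ T : ℕ, 1 ≤ T ∧ (T : ℝ) ≤ C * FedAMD.roundBound M h.A τ ε ∧
        (∃ t < T,
          Integrable (fun ω => ‖gradient P.obj (R.state ω t).x‖ ^ 2) μ ∧
          ∫ ω, ‖gradient P.obj (R.state ω t).x‖ ^ 2 ∂μ ≤ max 1 (c₀ / κ) * ε) ∧
        (∀ᵐ ω ∂μ, (R.gradCount ω T : ℝ) ≤ C * FedAMD.gradBound M h.K h.b h.b' τ ε) ∧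
        (∀ᵐ ω ∂μ, R.commOverhead ω T ≤ C * FedAMD.commBound M h.A τ ε)) ∧
      -- all the bounds are smallest at `τ = 2`, and only there
      (2 < τ →
        FedAMD.roundBound M h.A 2 ε < FedAMD.roundBound M h.A τ ε ∧
        FedAMD.gradBound M h.K h.b h.b' 2 ε < FedAMD.gradBound M h.K h.b h.b' τ ε ∧
        FedAMD.commBound M h.A 2 ε < FedAMD.commBound M h.A τ ε) := by
  -- `867/2` is just above `1300/3`, so the noise contributes at most half of `c₀ ε / κ`. The
  -- communication count fixes `C`: `M` initial vectors, two per anchor and three per miner give `ε₀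
  -- + 2 (192ΔL + 2ε₀) + 3 (96ΔL + 2ε₀)`; the other bounds need less.
  refine ⟨867, by norm_num, fun L Δ ε₀ hL hΔ hε₀ =>
    ⟨672 * Δ * L + 11 * ε₀, by positivity, ?_⟩⟩
  intro d M Z _ P h Ω _ μ _ R σ Lσ Fstar ε κ τ hr hs hσ0 hσ hLσ0 hLσ hF hgap hA hAM hK hε hεε₀ hτ
    hp hκ hb hb'1 hb'b hηl hη hη1 hη2
  have hM : 1 ≤ M := hA.trans hAM
  have hM0 : (0 : ℝ) < M := by exact_mod_cast hM
  have hA0 : (0 : ℝ) < h.A := by exact_mod_cast hA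
  have hK0 : (0 : ℝ) < h.K := by exact_mod_cast hK
  have hτ2 : (2 : ℝ) ≤ τ := by exact_mod_cast hτ
  have hΔL : 0 ≤ Δ * L := by positivity
  refine ⟨?_, fun hτ' => ⟨roundBound_two_lt hA hAM hε hτ', gradBound_two_lt hM hK hb'1 hε hτ',
    commBound_two_lt hA hM hε hτ'⟩⟩
  have hbsize : (h.b : ℕ∞) ≤ P.data.size := hb.trans_le (min_le_right _ _)
  obtain ⟨ς, hς0, hς, hcache⟩ :=
    Problem.exists_cache_noise_bound hr hs hσ hM hε hκ (by omega : 1 ≤ h.b) hb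
  have hS : Setting P h L σ Lσ ς :=
    { regular := hr, smooth := hs, noise := hσ, averageSmooth := hLσ, L_pos := hL, one_le_A := hA
      A_le := hAM, one_le_K := hK, one_le_b := by omega, b_le := hbsize, one_le_b' := hb'1
      b'_le := le_trans (by exact_mod_cast hb'b.le) hbsize
      cacheNoise_nonneg := hς0, cacheNoise := hcache
      ηl_smooth := ηl_smooth_of_le hηl hL hK hη1
      ηl_noise := ηl_noise_of_le hηl hLσ0 hK hb'1 hη2 }
  have hFle : ∀ x, Fstar ≤ P.obj x := fun x => hF.1 ⟨x, rfl⟩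
  obtain ⟨J, hJ1, hJX, hJT, hJA, hJNA⟩ := exists_periods hL hΔ hε hεε₀ hA hAM hτ
  set W : ℝ := 1 + 2 * (M : ℝ) * τ / h.A with hW
  have hW0 : 0 < W := by positivity
  set γ : ℝ := h.ηs * h.ηl * h.K with hγ
  have hγW : γ = 1 / (L * W) := by
    rw [hγ, hη]
    field_simp
  have hγL : L * γ * ((h.A : ℝ) / M + 2 * τ) = (h.A : ℝ) / M := by
    rw [hγW, hW]
    field_simp
  have hsum := R.sum_msq_gradient_le hS hFle hγ.symm (by omega : 1 ≤ τ) hγL J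
  have hgood := R.ae_sequential hp
  have hςM : ς / M ≤ ε / κ := by
    rw [div_le_iff₀ hM0]
    exact hς.trans_eq (by ring)
  have hbound : ∑ n ∈ Finset.range J, ∑ i ∈ Finset.range (τ - 1),
      msq μ (fun ω => gradient P.obj (R.model τ (roundIdx τ n i) ω))
      ≤ J * (τ - 1 : ℕ) * (max 1 (867 / κ) * ε) := by
    have h1 : 16 / γ * (P.obj h.x₀ - Fstar) ≤ J * (τ - 1 : ℕ) * (ε / 2) := by
      have e1 : 16 / γ = 16 * L * W := by
        rw [hγW]
        field_simp
      rw [div_le_iff₀ hε] at hJX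
      have e2 := mul_le_mul_of_nonneg_left hgap (by positivity : 0 ≤ 16 * L * W)
      rw [e1]
      linarith
    have h2 : (J : ℝ) * (τ - 1 : ℕ) * (1300 / 3 * (ς / M))
        ≤ J * (τ - 1 : ℕ) * (867 / 2 * (ε / κ)) :=
      mul_le_mul_of_nonneg_left (mul_le_mul (by norm_num) hςM (by positivity) (by norm_num))
        (by positivity)
    have h3 : ε / 2 + 867 / 2 * (ε / κ) ≤ max 1 (867 / κ) * ε := by
      have e1 := mul_le_mul_of_nonneg_right (le_max_left 1 (867 / κ)) hε.le
      have e2 := mul_le_mul_of_nonneg_right (le_max_right 1 (867 / κ)) hε.le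
      have e3 : 867 / κ * ε = 867 * (ε / κ) := by ring
      linarith
    have h4 := mul_le_mul_of_nonneg_left h3
      (by positivity : (0 : ℝ) ≤ J * (τ - 1 : ℕ))
    linarith
  obtain ⟨n, hn, i, hi, hni⟩ := exists_le_of_double_sum_le hJ1 (by omega) hbound
  have hae : (fun ω => ‖gradient P.obj (R.state ω (roundIdx τ n i)).x‖ ^ 2)
      =ᵐ[μ] fun ω => ‖gradient P.obj (R.model τ (roundIdx τ n i) ω)‖ ^ 2 := by
    filter_upwards [hgood] with ω hω
    rw [(hω.state_eq_run hA _).1]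
  refine ⟨J * τ, Nat.mul_pos hJ1 (by omega), ?_, ⟨roundIdx τ n i, ?_, ?_, ?_⟩, ?_, ?_⟩
  · refine hJT.trans (mul_le_mul_of_nonneg_right (by linarith) ?_)
    have : (0 : ℝ) < (τ : ℝ) - 1 := by linarith
    unfold roundBound
    positivity
  -- The selected round is a round of miners in cycle `n < J`, hence precedes the next anchor round
  -- `(n + 1) τ`.
  · have h1 : (n + 1) * τ ≤ J * τ := Nat.mul_le_mul_right τ hn
    rw [← roundIdx_last (by omega : 1 ≤ τ)] at h1
    exact lt_of_lt_of_le (by unfold roundIdx; omega) h1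
  · exact (integrable_norm_sq (R.memLp_gradient_obj hS τ _)).congr hae.symm
  · rw [integral_congr_ae hae]
    exact hni
  · filter_upwards [hgood] with ω hω
    rw [hω.gradCount_eq (by omega)]
    push_cast
    have e1 : (M : ℝ) * h.b ≤ ε₀ * (M * h.b / ε) := by
      rw [← mul_div_assoc, le_div_iff₀ hε, mul_comm]
      gcongr
    have e2 := mul_le_mul_of_nonneg_right hJA (by positivity : (0 : ℝ) ≤ h.b)
    have e3 := mul_le_mul_of_nonneg_right hJNA (by positivity : (0 : ℝ) ≤ 2 * h.b' * h.K)
    have e4 : 0 ≤ (480 * (Δ * L) + 8 * ε₀) * (M * h.b / ε)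
        + (480 * (Δ * L) + 7 * ε₀) * (M * τ / ε * (h.b' * h.K)) := by positivity
    have e5 : (672 * Δ * L + 11 * ε₀) * gradBound M h.K h.b h.b' τ ε
        = (672 * Δ * L + 11 * ε₀) * (M * h.b / ε)
        + (672 * Δ * L + 11 * ε₀) * (M * τ / ε * (h.b' * h.K)) := by
      unfold gradBound
      ring
    have e6 : (192 * Δ * L + 2 * ε₀) * (M / ε) * h.b
        = (192 * Δ * L + 2 * ε₀) * (M * h.b / ε) := by ring
    rw [e5]
    rw [e6] at e2
    linarith
  · filter_upwards [hgood] with ω hω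
    rw [Draws.commOverhead, hω.vecs_eq (by omega), div_le_iff₀ hA0]
    push_cast
    have e0 : (672 * Δ * L + 11 * ε₀) * commBound M h.A τ ε * h.A
        = (672 * Δ * L + 11 * ε₀) * (M * τ / ε) := by
      unfold commBound
      field_simp
    rw [e0]
    have e1 : (M : ℝ) ≤ ε₀ * (M * τ / ε) := by
      rw [← mul_div_assoc, le_div_iff₀ hε, mul_comm]
      calc ε * (M : ℝ) ≤ ε₀ * (M * 1) := by rw [mul_one]; gcongr
        _ ≤ ε₀ * (M * τ) := by gcongr; linarith
    have e2 : (192 * Δ * L + 2 * ε₀) * (M / ε) ≤ (192 * Δ * L + 2 * ε₀) * (M * τ / ε) := by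
      rw [mul_div_right_comm]
      refine mul_le_mul_of_nonneg_left ?_ (by nlinarith)
      exact le_mul_of_one_le_right (by positivity) (by linarith)
    linarith
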